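/- Let $\alpha\in(0,1)$ and $c>0$. There is a constant $C>0$, depending only on $\alpha$ and $c$, such that the following holds for all $R,d>0$ with $R\ge c\,d$. Let $B_r=\{x\in\mathbb R^2:|x|<r\}$ and $\Omega=\{x\in\mathbb{R}^2: R<|x|<R+d\}$. For $x\in\Omega$ put $x^*=\frac{R^2}{|x|^2}x$ and $$G_N(x,y)=-\frac1{2\pi}\log|y-x|-\frac1{2\pi}\log|y-x^*|+\frac{|y|^2}{4\pi R^2}.$$ Write $\|h\|_\infty$ for the supremum of $|h|$ and $[h]_{0,\alpha}=\sup_{x\ne y}\frac{|h(x)-h(y)|}{|x-y|^\alpha}$. Norms and seminorms of $Du$ and $D^2u$ are taken over $\Omega$, those of $g$ and of its derivative $g'$ with respect to arc length over $\partial B_R$, and those of $f$ over $\mathbb R^2$. (i) Let $g\in C^{1,\alpha}(\partial B_R)$ and $u(x)=\int_{\partial B_R}g(y)\,G_N(x,y)\,dS(y)$. Then for each $x\in\Omega$ the integral converges absolutely, $u\in C^2(\Omega)$, and $$\|Du\|_\infty\le C\big(\|g\|_\infty+R^\alpha[g]_{0,\alpha}\big),$$ $$[Du]_{0,\alpha}\le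 C\big(R^{-\alpha}\|g\|_\infty+[g]_{0,\alpha}\big),$$ $$\|D^2u\|_\infty\le C\big(R^{-1}\|g\|_\infty+R^{\alpha-1}[g]_{0,\alpha}+\|g'\|_\infty+R^\alpha[g']_{0,\alpha}\big),$$ $$[D^2u]_{0,\alpha}\le C\big(R^{-1-\alpha}\|g\|_\infty+R^{-1}[g]_{0,\alpha}+R^{-\alpha}\|g'\|_\infty+[g']_{0,\alpha}\big).$$ (ii) Let $f\in C^{0,\alpha}_c\big(B_{R+\frac23d}\setminus\overline{B_{R+\frac13d}}\big)$, extended by zero to $\mathbb R^2$, and $u(x)=\int_{\mathbb R^2}f(y)\,G_N(x,y)\,dy$. Then for each $x\in\Omega$ the integral converges absolutely, $u\in C^2(\Omega)$, and $$\|Du\|_\infty\le CR\|f\|_\infty,$$ $$[Du]_{0,\alpha}\le CR^{2-\alpha}d^{-1}\|f\|_\infty,$$ $$\|D^2u\|_\infty\le C\big(Rd^{-1}\|f\|_\infty+R^\alpha[f]_{0,\alpha}\big),$$ $$[D^2u]_{0,\alpha}\le C\big(R^{2-\alpha}d^{-2}\|f\|_\infty+[f]_{0,\alpha}\big).$$ 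-/

import Mathlib

open MeasureTheory Metric Set
open scoped NNReal ENNReal

noncomputable section

/-- The Euclidean plane. -/
abbrev Plane : Type := EuclideanSpace ℝ (Fin 2)

/-- The open annulus `r < |x| < s` centred at the origin. -/
def annulus (r s : ℝ) : Set Plane := {x | r < ‖x‖ ∧ ‖x‖ < s}

/-- The supremum of `‖f x‖` over `x ∈ s`, as an extended nonnegative number. -/
def supOn {F : Type*} [NormedAddCommGroup F] (s : Set Plane) (f : Plane → F) : ℝ≥0∞ :=
  ⨆ x ∈ s, ‖f x‖ₑ

/-- The Hölder seminorm `[f]_{0,α}` on `s`, i.e. the least `K ∈ [0,∞]` such that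
`‖f x - f y‖ ≤ K |x - y|^α` for all `x, y ∈ s` (it is `∞` if `f` is not `α`-Hölder on `s`). -/
def holderOn {F : Type*} [NormedAddCommGroup F] (α : ℝ≥0) (s : Set Plane) (f : Plane → F) :
    ℝ≥0∞ :=
  eHolderNorm α (s.domRestrict f)

/-- The first derivative of a scalar function, measured in the dual norm. -/
def grad (u : Plane → ℝ) : Plane → (Plane →L[ℝ] ℝ) := fderiv ℝ u

/-- The second derivative of a scalar function, measured in the operator norm. -/
def hess (u : Plane → ℝ) : Plane → (Plane →L[ℝ] Plane →L[ℝ] ℝ) := fderiv ℝ (fderiv ℝ u)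

/-- Counterclockwise rotation by the angle `θ` about the origin. -/
def rotate (θ : ℝ) (y : Plane) : Plane :=
  !₂[Real.cos θ * y 0 - Real.sin θ * y 1, Real.sin θ * y 0 + Real.cos θ * y 1]

/-- The derivative of `g` with respect to arc length on the circle `|y| = R`:
the point `rotate (s / R) y` is at (signed) arc length `s` from `y`. -/
def tangentialDeriv (R : ℝ) (g : Plane → ℝ) (y : Plane) : ℝ :=
  deriv (fun s : ℝ => g (rotate (s / R) y)) 0

/-- `g ∈ C^{1,α}(∂B_R)`; only the values of `g` on the circle matter. -/
def IsC1HolderOnCircle (α : ℝ≥0) (R : ℝ) (g : Plane → ℝ) : Prop :=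
  (∀ y ∈ sphere (0 : Plane) R, DifferentiableAt ℝ (fun s : ℝ => g (rotate (s / R) y)) 0) ∧
    holderOn α (sphere (0 : Plane) R) (tangentialDeriv R g) ≠ ∞

/-- `f ∈ C_c^{0,α}(U)`, extended by zero to the plane. -/
def IsHolderCompactlySupportedIn (α : ℝ≥0) (U : Set Plane) (f : Plane → ℝ) : Prop :=
  HasCompactSupport f ∧ tsupport f ⊆ U ∧ holderOn α univ f ≠ ∞

/-- `Φ(z) = - (1/2π) log |z|`. -/
def fundSol (z : Plane) : ℝ := -(1 / (2 * Real.pi)) * Real.log ‖z‖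

/-- `φ^x(y) = (1/2π) log |y - x*| - |y|² / (4πR²)`, where `x* = (R²/|x|²) x` is the inversion
of `x` in the circle of radius `R` about the origin. -/
def corrector (R : ℝ) (x y : Plane) : ℝ :=
  1 / (2 * Real.pi) * Real.log ‖y - EuclideanGeometry.inversion (0 : Plane) R x‖
    - ‖y‖ ^ 2 / (4 * Real.pi * R ^ 2)

/-- The Neumann-Green function `G_N(x,y) = Φ(y - x) - φ^x(y)`. -/
def greenN (R : ℝ) (x y : Plane) : ℝ := fundSol (y - x) - corrector R x y

/-- The point of the circle of radius `R` at polar angle `θ`. -/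
def circlePoint (R θ : ℝ) : Plane := !₂[R * Real.cos θ, R * Real.sin θ]

/-- The single-layer potential `∫_{∂B_R} g(y) G_N(x,y) dS(y)`, with `dS = R dθ`. -/
def singleLayer (R : ℝ) (g : Plane → ℝ) (x : Plane) : ℝ :=
  ∫ θ in (0 : ℝ)..(2 * Real.pi), g (circlePoint R θ) * greenN R x (circlePoint R θ) * R

/-- The volume potential `∫_{ℝ²} f(y) G_N(x,y) dy`. -/
def volumePotential (R : ℝ) (f : Plane → ℝ) (x : Plane) : ℝ :=
  ∫ y : Plane, f y * greenN R x y

end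

/-! Identify the plane with ℂ and encode a differential du by the complex number F with du(v) = Re(F
v). Then log|z - p| has complex gradient 1/(z - p), so logarithmic potentials have Cauchy transforms
as gradients, and every claim follows from sup and Hölder bounds for F and for its real derivative
(`estimates_of_complex_gradient`). The identity |x| |y - x*| = |y| |x - y*| (`norm_sub_inversion`)
moves the inversion from x to y: as a function of x, the kernel is a combination of logarithms with
poles y, y* and 0, up to a term independent of x.

Single layer: on the circle y* = y, and the complex gradient is exactly the Cauchy transform on the
unit circle of an explicit density, evaluated at z/R. Subtracting the value of the density at the
boundary point nearest to z shows that the derivative of the transform is O((|z| - 1)^(α-1))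
(`norm_integral_circle_sq_le`). A Hardy–Littlewood argument (`holder_of_norm_fderiv_le_rpow`) turns
this growth into sup and Hölder bounds up to the circle (`exists_circleCauchy_bound`). Integration
by parts along the circle writes the second derivative as the Cauchy transform of a density
involving g' (`integral_circle_sq_eq_circleCauchy`), so the same bound applies a second time.

Volume potential: the pole y gives the Newtonian potential of f. Its gradient is weakly singular;
its second derivative is a singular integral of (f(w) - f(z))/(z - w)² plus a multiple of f(z)
(`hasFDerivAt_newtonGrad`), estimated by the classical near/far splitting, where the zero mean of
1/w² on annuli is essential (`norm_beurling_sub_le`). The poles y* and 0 stay at distance at least c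
d/(3c + 1) from Ω (`sub_invMap_ge`). The annulus containing the support has area O(R d), so
integrals of |z - p|^(-n) are O(R d^(1-n)); this is the source of the powers of d. -/

/-! ### Complex gradients and the extended norms. -/

/-- The identification of the Euclidean plane with `ℂ`. -/
noncomputable def planeToComplex : Plane ≃ₗᵢ[ℝ] ℂ := Complex.orthonormalBasisOneI.repr.symm

/-- The real linear form `v ↦ Re (a v)` on `ℂ`, as a function of `a`. -/
noncomputable def reMul : ℂ →L[ℝ] ℂ →L[ℝ] ℝ :=
  (ContinuousLinearMap.compL ℝ ℂ ℂ ℝ Complex.reCLM).comp (ContinuousLinearMap.mul ℝ ℂ)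

lemma reMul_apply (a v : ℂ) : reMul a v = (a * v).re := rfl

/-- The linear form `v ↦ Re (a v)` on the plane, as a function of `a`. -/
noncomputable def reMulPlane : ℂ →L[ℝ] Plane →L[ℝ] ℝ :=
  ((ContinuousLinearMap.compL ℝ Plane ℂ ℝ).flip
    (planeToComplex.toContinuousLinearEquiv : Plane →L[ℝ] ℂ)).comp reMul

lemma reMulPlane_apply (a : ℂ) (v : Plane) : reMulPlane a v = (a * planeToComplex v).re := rfl

lemma norm_reMulPlane_le (a : ℂ) : ‖reMulPlane a‖ ≤ ‖a‖ := by
  refine ContinuousLinearMap.opNorm_le_bound _ (norm_nonneg _) fun v => ?_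
  rw [reMulPlane_apply, ← planeToComplex.norm_map v, ← norm_mul]
  exact Complex.abs_re_le_norm _

lemma supOn_le {F : Type*} [NormedAddCommGroup F] {s : Set Plane} {f : Plane → F} {A : ℝ}
    (h : ∀ x ∈ s, ‖f x‖ ≤ A) : supOn s f ≤ ENNReal.ofReal A := by
  refine iSup₂_le fun x hx => ?_
  rw [← ofReal_norm]
  exact ENNReal.ofReal_le_ofReal (h x hx)

lemma norm_le_toReal_supOn {F : Type*} [NormedAddCommGroup F] {s : Set Plane} {f : Plane → F}
    (h : supOn s f ≠ ∞) {x : Plane} (hx : x ∈ s) : ‖f x‖ ≤ (supOn s f).toReal := by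
  have h1 : ‖f x‖ₑ ≤ supOn s f := le_iSup₂ (f := fun x (_ : x ∈ s) => ‖f x‖ₑ) x hx
  have := ENNReal.toReal_mono h h1
  simpa using this

lemma holderOn_le {F : Type*} [NormedAddCommGroup F] {α : ℝ≥0} {s : Set Plane} {f : Plane → F}
    {A : ℝ} (hA : 0 ≤ A) (h : ∀ x ∈ s, ∀ y ∈ s, ‖f x - f y‖ ≤ A * ‖x - y‖ ^ (α : ℝ)) :
    holderOn α s f ≤ ENNReal.ofReal A := by
  refine HolderWith.eHolderNorm_le (C := A.toNNReal) fun x y => ?_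
  rw [edist_dist, edist_dist, ENNReal.ofReal_rpow_of_nonneg dist_nonneg α.coe_nonneg]
  change _ ≤ ENNReal.ofReal A * _
  rw [← ENNReal.ofReal_mul hA, Subtype.dist_eq, dist_eq_norm, dist_eq_norm]
  exact ENNReal.ofReal_le_ofReal (h x x.2 y y.2)

lemma norm_sub_le_toReal_holderOn {F : Type*} [NormedAddCommGroup F] {α : ℝ≥0} {s : Set Plane}
    {f : Plane → F} (h : holderOn α s f ≠ ∞) {x y : Plane} (hx : x ∈ s) (hy : y ∈ s) :
    ‖f x - f y‖ ≤ (holderOn α s f).toReal * ‖x - y‖ ^ (α : ℝ) := by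
  have h1 := (eHolderNorm_ne_top.1 h).holderWith.dist_le ⟨x, hx⟩ ⟨y, hy⟩
  rwa [dist_eq_norm, Subtype.dist_eq, dist_eq_norm] at h1

/-- The potentials below are differentiated by bounding their Taylor remainder with a power larger
than one. The kernels are singular on the support, so the differentiated kernel has no locally
uniform integrable majorant in general. -/
lemma hasFDerivAt_of_norm_le_rpow {E F : Type*} [NormedAddCommGroup E] [NormedSpace ℝ E]
    [NormedAddCommGroup F] [NormedSpace ℝ F] {f : E → F} {L : E →L[ℝ] F} {x₀ : E} {C β : ℝ}
    (hβ : 0 < β)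
    (h : ∀ᶠ x in nhds x₀, ‖f x - f x₀ - L (x - x₀)‖ ≤ C * ‖x - x₀‖ ^ (1 + β)) :
    HasFDerivAt f L x₀ := by
  refine .of_isLittleO ?_
  have h1 : (fun x => f x - f x₀ - L (x - x₀)) =O[nhds x₀] fun x => ‖x - x₀‖ ^ (1 + β) :=
    Asymptotics.IsBigO.of_bound C (h.mono fun x hx => hx.trans_eq (by
      rw [Real.norm_of_nonneg (by positivity)]))
  refine h1.trans_isLittleO ?_
  have h2 : (fun x : E => ‖x - x₀‖ ^ (1 + β)) = fun x => ‖x - x₀‖ * ‖x - x₀‖ ^ β := by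
    ext x
    rw [Real.rpow_add' (norm_nonneg _) (by positivity), Real.rpow_one]
  rw [h2]
  have h3 : (fun x : E => ‖x - x₀‖ ^ β) =o[nhds x₀] fun _ => (1 : ℝ) := by
    rw [Asymptotics.isLittleO_one_iff]
    have : ContinuousAt (fun x : E => ‖x - x₀‖ ^ β) x₀ :=
      ContinuousAt.rpow_const (by fun_prop) (Or.inr hβ.le)
    simpa [ContinuousAt, Real.zero_rpow hβ.ne'] using this
  have h5 := (Asymptotics.isBigO_refl (fun x : E => ‖x - x₀‖) (nhds x₀)).mul_isLittleO h3
  simp only [mul_one] at h5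
  exact Asymptotics.isLittleO_norm_right.1 h5

/-- Estimates for a function on the plane with complex gradient `F`, whose real derivative is
`G`. -/
theorem estimates_of_complex_gradient {U : Set Plane} (hU : IsOpen U) {α : ℝ≥0} (hα : 0 < α)
    {u : Plane → ℝ} {F : ℂ → ℂ} {G : ℂ → ℂ →L[ℝ] ℂ}
    (hu : ∀ x ∈ U, HasFDerivAt u (reMulPlane (F (planeToComplex x))) x)
    (hF : ∀ x ∈ U, HasFDerivAt F (G (planeToComplex x)) (planeToComplex x))
    {A₀ A₁ A₂ A₃ : ℝ} (hA₁ : 0 ≤ A₁) (hA₃ : 0 ≤ A₃)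
    (h₀ : ∀ x ∈ U, ‖F (planeToComplex x)‖ ≤ A₀)
    (h₁ : ∀ x ∈ U, ∀ y ∈ U,
      ‖F (planeToComplex x) - F (planeToComplex y)‖ ≤ A₁ * ‖x - y‖ ^ (α : ℝ))
    (h₂ : ∀ x ∈ U, ‖G (planeToComplex x)‖ ≤ A₂)
    (h₃ : ∀ x ∈ U, ∀ y ∈ U,
      ‖G (planeToComplex x) - G (planeToComplex y)‖ ≤ A₃ * ‖x - y‖ ^ (α : ℝ)) :
    ContDiffOn ℝ 2 u U ∧
      supOn U (grad u) ≤ ENNReal.ofReal A₀ ∧ holderOn α U (grad u) ≤ ENNReal.ofReal A₁ ∧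
      supOn U (hess u) ≤ ENNReal.ofReal A₂ ∧ holderOn α U (hess u) ≤ ENNReal.ofReal A₃ := by
  have hgrad : ∀ x ∈ U, fderiv ℝ u x = reMulPlane (F (planeToComplex x)) :=
    fun x hx => (hu x hx).fderiv
  set ι : Plane →L[ℝ] ℂ := (planeToComplex.toContinuousLinearEquiv : Plane →L[ℝ] ℂ) with hι
  have hιn : ∀ v, ‖ι v‖ = ‖v‖ := fun v => planeToComplex.norm_map v
  let H : Plane → Plane →L[ℝ] Plane →L[ℝ] ℝ := fun x =>
    reMulPlane.comp ((G (planeToComplex x)).comp ι)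
  have hH : ∀ x ∈ U, HasFDerivAt (fderiv ℝ u) (H x) x := by
    intro x hx
    have h1 : HasFDerivAt (fun x : Plane => reMulPlane (F (ι x))) (H x) x :=
      reMulPlane.hasFDerivAt.comp x ((hF x hx).comp x ι.hasFDerivAt)
    refine h1.congr_of_eventuallyEq ?_
    filter_upwards [hU.mem_nhds hx] with y hy using hgrad y hy
  have hhess : ∀ x ∈ U, fderiv ℝ (fderiv ℝ u) x = H x := fun x hx => (hH x hx).fderiv
  have hHle : ∀ (A : ℂ →L[ℝ] ℂ), ‖reMulPlane.comp (A.comp ι)‖ ≤ ‖A‖ := by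
    intro A
    refine ContinuousLinearMap.opNorm_le_bound _ (norm_nonneg _) fun v => ?_
    refine (norm_reMulPlane_le _).trans ?_
    rw [← hιn v]
    exact A.le_opNorm _
  have hHsub : ∀ x y, ‖H x - H y‖ ≤ ‖G (planeToComplex x) - G (planeToComplex y)‖ := by
    intro x y
    refine le_trans (le_of_eq ?_) (hHle _)
    congr 1
    simp [H, ContinuousLinearMap.sub_comp, ContinuousLinearMap.comp_sub]
  -- The Hölder bound on `G` already gives continuity of the Hessian, hence the C² regularity.
  have hHc : ContinuousOn H U := by
    intro x hx
    have h0 : ContinuousAt (fun y : Plane => A₃ * ‖y - x‖ ^ (α : ℝ)) x :=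
      continuousAt_const.mul (ContinuousAt.rpow_const (by fun_prop) (Or.inr α.coe_nonneg))
    have h0' := h0.continuousWithinAt (s := U)
    rw [ContinuousWithinAt] at h0'
    refine (tendsto_iff_norm_sub_tendsto_zero (E := Plane →L[ℝ] Plane →L[ℝ] ℝ)).2 ?_
    simp only [sub_self, norm_zero, Real.zero_rpow (NNReal.coe_pos.2 hα).ne', mul_zero] at h0'
    refine squeeze_zero' (.of_forall fun y => norm_nonneg (H y - H x)) ?_ h0'
    filter_upwards [self_mem_nhdsWithin] with y hy
    exact (hHsub y x).trans (h₃ y hy x hx)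
  refine ⟨?_, ?_, ?_, ?_, ?_⟩
  · rw [show (2 : WithTop ℕ∞) = 1 + 1 from one_add_one_eq_two.symm,
      contDiffOn_succ_iff_fderiv_of_isOpen hU]
    refine ⟨fun x hx => (hu x hx).differentiableAt.differentiableWithinAt, by simp, ?_⟩
    rw [← zero_add (1 : WithTop ℕ∞), contDiffOn_succ_iff_fderiv_of_isOpen hU]
    refine ⟨fun x hx => (hH x hx).differentiableAt.differentiableWithinAt, by simp, ?_⟩
    exact contDiffOn_zero.2 (hHc.congr fun x hx => hhess x hx)
  · refine supOn_le fun x hx => ?_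
    rw [grad, hgrad x hx]
    exact (norm_reMulPlane_le _).trans (h₀ x hx)
  · refine holderOn_le hA₁ fun x hx y hy => ?_
    rw [grad, hgrad x hx, hgrad y hy, ← map_sub]
    exact (norm_reMulPlane_le _).trans (h₁ x hx y hy)
  · refine supOn_le fun x hx => ?_
    rw [hess, hhess x hx]
    exact (hHle _).trans (h₂ x hx)
  · refine holderOn_le hA₃ fun x hx y hy => ?_
    rw [hess, hhess x hx, hhess y hy]
    exact (hHsub x y).trans (h₃ x hx y hy)

/-! ### Pointwise bounds for the logarithmic and Cauchy kernels. -/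

/-- Interpolation between a Lipschitz bound and a trivial bound. -/
lemma min_le_mul_rpow {t β : ℝ} (ht : 0 ≤ t) (hβ₀ : 0 ≤ β) (hβ₁ : β ≤ 1) :
    min t 2 ≤ 2 * t ^ β := by
  rcases le_total t 1 with h | h
  · calc min t 2 ≤ t := min_le_left _ _
      _ = t ^ (1 : ℝ) := (Real.rpow_one t).symm
      _ ≤ t ^ β := Real.rpow_le_rpow_of_exponent_ge' ht h hβ₀ hβ₁
      _ ≤ 2 * t ^ β := by linarith [Real.rpow_nonneg ht β]
  · have := Real.one_le_rpow h hβ₀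
    exact (min_le_right _ _).trans (by linarith)

lemma min_rpow_neg_le {a b s : ℝ} (ha : 0 < a) (hb : 0 < b) :
    (min a b) ^ (-s) ≤ a ^ (-s) + b ^ (-s) := by
  have h1 := Real.rpow_nonneg ha.le (-s)
  have h2 := Real.rpow_nonneg hb.le (-s)
  rcases min_choice a b with h | h <;> rw [h] <;> linarith

/-- Replacing both bases by their minimum separates the two singularities, so each can be integrated
on its own. -/
lemma rpow_neg_mul_rpow_neg_le {a b p q : ℝ} (ha : 0 < a) (hb : 0 < b) (hp : 0 ≤ p)
    (hq : 0 ≤ q) : a ^ (-p) * b ^ (-q) ≤ a ^ (-(p + q)) + b ^ (-(p + q)) := by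
  have hm : 0 < min a b := lt_min ha hb
  refine le_trans ?_ (min_rpow_neg_le ha hb)
  rw [neg_add, Real.rpow_add hm]
  exact mul_le_mul (Real.rpow_le_rpow_of_nonpos hm (min_le_left _ _) (by linarith))
    (Real.rpow_le_rpow_of_nonpos hm (min_le_right _ _) (by linarith))
    (Real.rpow_nonneg hb.le _) (Real.rpow_nonneg hm.le _)

lemma inv_mul_min_le {a b r β : ℝ} (ha : 0 < a) (hb : 0 < b) (hr : 0 ≤ r) (hβ₀ : 0 ≤ β)
    (hβ₁ : β ≤ 1) :
    (min a b)⁻¹ * min (r / min a b) 2 ≤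
      2 * r ^ β * (a ^ (-(1 + β)) + b ^ (-(1 + β))) := by
  have hm : 0 < min a b := lt_min ha hb
  calc (min a b)⁻¹ * min (r / min a b) 2 ≤ (min a b)⁻¹ * (2 * (r / min a b) ^ β) := by
        gcongr
        exact min_le_mul_rpow (by positivity) hβ₀ hβ₁
    _ = 2 * r ^ β * (min a b) ^ (-(1 + β)) := by
        rw [Real.div_rpow hr hm.le, neg_add, Real.rpow_add hm, Real.rpow_neg_one,
          Real.rpow_neg hm.le]
        ring
    _ ≤ _ := by
        gcongr
        exact min_rpow_neg_le ha hb

/-- Hölder bound for the Cauchy kernel. -/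
lemma norm_inv_sub_inv_le {a b : ℂ} (ha : a ≠ 0) (hb : b ≠ 0) {β : ℝ} (hβ₀ : 0 ≤ β)
    (hβ₁ : β ≤ 1) :
    ‖a⁻¹ - b⁻¹‖ ≤ 2 * ‖a - b‖ ^ β * (‖a‖ ^ (-(1 + β)) + ‖b‖ ^ (-(1 + β))) := by
  have ha' := norm_pos_iff.2 ha
  have hb' := norm_pos_iff.2 hb
  refine le_trans ?_ (inv_mul_min_le ha' hb' (norm_nonneg _) hβ₀ hβ₁)
  have hm : 0 < min ‖a‖ ‖b‖ := lt_min ha' hb'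
  have hia : ‖a‖⁻¹ ≤ (min ‖a‖ ‖b‖)⁻¹ := inv_anti₀ hm (min_le_left _ _)
  have hib : ‖b‖⁻¹ ≤ (min ‖a‖ ‖b‖)⁻¹ := inv_anti₀ hm (min_le_right _ _)
  rw [mul_min_of_nonneg _ _ (by positivity)]
  refine le_min ?_ ?_
  · rw [inv_sub_inv ha hb, norm_div, norm_mul, norm_sub_rev b a]
    calc ‖a - b‖ / (‖a‖ * ‖b‖) = ‖a‖⁻¹ * (‖a - b‖ * ‖b‖⁻¹) := by
          field_simp
      _ ≤ (min ‖a‖ ‖b‖)⁻¹ * (‖a - b‖ * (min ‖a‖ ‖b‖)⁻¹) := by gcongr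
      _ = _ := by rw [div_eq_mul_inv]
  · calc ‖a⁻¹ - b⁻¹‖ ≤ ‖a⁻¹‖ + ‖b⁻¹‖ := norm_sub_le _ _
      _ = ‖a‖⁻¹ + ‖b‖⁻¹ := by rw [norm_inv, norm_inv]
      _ ≤ _ := by linarith

/-- With t = (b - a)/a this is log s ≤ s - 1 at s = |1 + t|² = 1 + 2 Re t + |t|², halved. It is
one-sided; exchanging a and b supplies the other side. -/
lemma log_norm_sub_log_norm_le {a b : ℂ} (ha : a ≠ 0) (hb : b ≠ 0) :
    Real.log ‖b‖ - Real.log ‖a‖ ≤ ((b - a) / a).re + ‖(b - a) / a‖ ^ 2 / 2 := by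
  have ha' := norm_pos_iff.2 ha
  have hb' := norm_pos_iff.2 hb
  have h1 : Real.log ((‖b‖ / ‖a‖) ^ 2) ≤ (‖b‖ / ‖a‖) ^ 2 - 1 :=
    Real.log_le_sub_one_of_pos (by positivity)
  rw [Real.log_pow, Real.log_div hb'.ne' ha'.ne'] at h1
  have h2 : (‖b‖ / ‖a‖) ^ 2 = 1 + 2 * ((b - a) / a).re + ‖(b - a) / a‖ ^ 2 := by
    rw [← norm_div, show b / a = 1 + (b - a) / a by field_simp; ring, Complex.sq_norm,
      Complex.sq_norm]
    generalize (b - a) / a = t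
    rw [Complex.normSq_add]
    simp only [map_one, one_mul, Complex.conj_re]
    ring
  push_cast at h1
  linarith

/-- The first-order Taylor remainder of `log ‖·‖`, with a Hölder loss. -/
lemma abs_log_norm_sub_log_norm_sub_re_le {a b : ℂ} (ha : a ≠ 0) (hb : b ≠ 0) {β : ℝ}
    (hβ₀ : 0 ≤ β) (hβ₁ : β ≤ 1) :
    |Real.log ‖b‖ - Real.log ‖a‖ - ((b - a) / a).re| ≤
      4 * ‖b - a‖ ^ (1 + β) * (‖a‖ ^ (-(1 + β)) + ‖b‖ ^ (-(1 + β))) := by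
  have ha' := norm_pos_iff.2 ha
  have hb' := norm_pos_iff.2 hb
  have hm : 0 < min ‖a‖ ‖b‖ := lt_min ha' hb'
  have hia : ‖a‖⁻¹ ≤ (min ‖a‖ ‖b‖)⁻¹ := inv_anti₀ hm (min_le_left _ _)
  have hib : ‖b‖⁻¹ ≤ (min ‖a‖ ‖b‖)⁻¹ := inv_anti₀ hm (min_le_right _ _)
  set r := ‖b - a‖ with hr
  set q := r / min ‖a‖ ‖b‖ with hq
  have hq0 : 0 ≤ q := by positivity
  set t := (b - a) / a with ht
  set s := (b - a) / b with hs
  have htq : ‖t‖ ≤ q := by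
    rw [ht, norm_div, hq, div_eq_mul_inv, div_eq_mul_inv]; gcongr
  have hsq : ‖s‖ ≤ q := by
    rw [hs, norm_div, hq, div_eq_mul_inv, div_eq_mul_inv]; gcongr
  have h1 := log_norm_sub_log_norm_le ha hb
  have h2 := log_norm_sub_log_norm_le hb ha
  rw [← ht] at h1
  rw [show (a - b) / b = -s by rw [hs]; ring, norm_neg, Complex.neg_re] at h2
  -- The inequality with a and b exchanged involves Re s instead of Re t. As t - s = t s, the
  -- replacement costs only a quadratic error.
  have h3 : ‖t - s‖ ≤ q ^ 2 := by
    have : t - s = t * s := by rw [ht, hs]; field_simp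
    rw [this, norm_mul, sq]
    gcongr
  have h4 := (abs_le.1 ((Complex.abs_re_le_norm (t - s)).trans h3))
  rw [Complex.sub_re] at h4
  have h5 : ‖t‖ ^ 2 ≤ q ^ 2 := by gcongr
  have h6 : ‖s‖ ^ 2 ≤ q ^ 2 := by gcongr
  have h7 : |Real.log ‖b‖ - Real.log ‖a‖ - t.re| ≤ 2 * q ^ 2 := by
    rw [abs_le]; constructor <;> nlinarith
  -- The linear bound, better than the quadratic one `h7` when q is large; their minimum is then
  -- interpolated.
  have h8 : |Real.log ‖b‖ - Real.log ‖a‖ - t.re| ≤ 2 * (q * 2) := by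
    have h9 : Real.log ‖b‖ - Real.log ‖a‖ ≤ q := by
      rw [← Real.log_div hb'.ne' ha'.ne']
      refine (Real.log_le_sub_one_of_pos (by positivity)).trans (le_trans ?_ htq)
      rw [ht, norm_div, div_sub_one ha'.ne']
      gcongr
      exact norm_sub_norm_le b a
    have h10 : Real.log ‖a‖ - Real.log ‖b‖ ≤ q := by
      rw [← Real.log_div ha'.ne' hb'.ne']
      refine (Real.log_le_sub_one_of_pos (by positivity)).trans (le_trans ?_ hsq)
      rw [hs, norm_div, div_sub_one hb'.ne', norm_sub_rev b a]
      gcongr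
      exact norm_sub_norm_le a b
    have h11 := abs_le.1 ((Complex.abs_re_le_norm t).trans htq)
    rw [abs_le]; constructor <;> linarith
  have h12 : |Real.log ‖b‖ - Real.log ‖a‖ - t.re| ≤ 2 * r * ((min ‖a‖ ‖b‖)⁻¹ * min q 2) := by
    have : 2 * r * ((min ‖a‖ ‖b‖)⁻¹ * min q 2) = 2 * (q * min q 2) := by
      rw [hq, div_eq_mul_inv]; ring
    rw [this, mul_min_of_nonneg _ _ hq0, mul_min_of_nonneg _ _ (by norm_num)]
    exact le_min (by linarith) h8
  refine h12.trans ?_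
  have h13 := inv_mul_min_le ha' hb' (norm_nonneg (b - a)) hβ₀ hβ₁
  calc 2 * r * ((min ‖a‖ ‖b‖)⁻¹ * min q 2)
      ≤ 2 * r * (2 * r ^ β * (‖a‖ ^ (-(1 + β)) + ‖b‖ ^ (-(1 + β)))) := by gcongr
    _ = _ := by
      rw [Real.rpow_add' (norm_nonneg _) (by positivity), Real.rpow_one]; ring

/-! ### Differentiation of logarithmic and Cauchy potentials. -/

/-- The logarithmic potential has complex gradient the Cauchy potential. -/
theorem hasFDerivAt_log_potential {Y : Type*} [MeasurableSpace Y] {μ : Measure Y} {h : Y → ℝ}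
    {p : Y → ℂ} {z₀ : ℂ} {β C : ℝ} (hβ₀ : 0 < β) (hβ₁ : β ≤ 1)
    (hlog : ∀ᶠ z in nhds z₀, Integrable (fun y => h y * Real.log ‖z - p y‖) μ)
    (hinv : Integrable (fun y => (h y : ℂ) * (z₀ - p y)⁻¹) μ)
    (hne : ∀ᶠ z in nhds z₀, ∀ᵐ y ∂μ, z ≠ p y)
    (hint : ∀ᶠ z in nhds z₀, Integrable (fun y => |h y| * ‖z - p y‖ ^ (-(1 + β))) μ)
    (hC : ∀ᶠ z in nhds z₀, ∫ y, |h y| * ‖z - p y‖ ^ (-(1 + β)) ∂μ ≤ C) :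
    HasFDerivAt (fun z : ℂ => ∫ y, h y * Real.log ‖z - p y‖ ∂μ)
      (reMul (∫ y, (h y : ℂ) * (z₀ - p y)⁻¹ ∂μ)) z₀ := by
  refine hasFDerivAt_of_norm_le_rpow (C := 8 * C) hβ₀ ?_
  filter_upwards [hlog, hne, hint, hC] with z hz1 hz2 hz3 hz4
  have hL : reMul (∫ y, (h y : ℂ) * (z₀ - p y)⁻¹ ∂μ) (z - z₀) =
      ∫ y, h y * ((z - z₀) / (z₀ - p y)).re ∂μ := by
    rw [reMul_apply, ← integral_mul_const, ← Complex.reCLM_apply,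
      ← ContinuousLinearMap.integral_comp_comm _ (hinv.mul_const _)]
    refine integral_congr_ae (.of_forall fun y => ?_)
    simp only [Complex.reCLM_apply]
    rw [mul_assoc, Complex.re_ofReal_mul]
    congr 2
    rw [div_eq_mul_inv, mul_comm]
  have hI : Integrable (fun y => h y * ((z - z₀) / (z₀ - p y)).re) μ := by
    have := (hinv.mul_const (z - z₀)).re
    refine this.congr (.of_forall fun y => ?_)
    change ((h y : ℂ) * (z₀ - p y)⁻¹ * (z - z₀)).re = _
    rw [mul_assoc, Complex.re_ofReal_mul]
    congr 2
    rw [div_eq_mul_inv, mul_comm]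
  have hI' : Integrable (fun y => h y * Real.log ‖z - p y‖ - h y * Real.log ‖z₀ - p y‖) μ :=
    hz1.sub hlog.self_of_nhds
  rw [hL, ← integral_sub hz1 hlog.self_of_nhds, ← integral_sub hI' hI]
  have hI2 : Integrable (fun y => |h y| * ‖z₀ - p y‖ ^ (-(1 + β)) +
      |h y| * ‖z - p y‖ ^ (-(1 + β))) μ := hint.self_of_nhds.add hz3
  refine (norm_integral_le_of_norm_le (hI2.const_mul (4 * ‖z - z₀‖ ^ (1 + β))) ?_).trans ?_
  · filter_upwards [hz2, hne.self_of_nhds] with y hy1 hy2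
    have := abs_log_norm_sub_log_norm_sub_re_le (sub_ne_zero.2 hy2) (sub_ne_zero.2 hy1) hβ₀.le hβ₁
    rw [sub_sub_sub_cancel_right] at this
    rw [← mul_sub, ← mul_sub, norm_mul, Real.norm_eq_abs, Real.norm_eq_abs]
    calc _ ≤ |h y| * _ := mul_le_mul_of_nonneg_left this (abs_nonneg _)
      _ = _ := by ring
  · rw [integral_const_mul, integral_add hint.self_of_nhds hz3]
    have := hC.self_of_nhds
    calc _ ≤ 4 * ‖z - z₀‖ ^ (1 + β) * (C + C) := by gcongr
      _ = _ := by ring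

/-- The Cauchy potential is complex differentiable wherever the second-order remainder of the
kernel is integrable with a Hölder gain. -/
theorem hasFDerivAt_cauchy_potential {Y : Type*} [MeasurableSpace Y] {μ : Measure Y} {h : Y → ℂ}
    {p : Y → ℂ} {z₀ : ℂ} {β C : ℝ} (hβ₀ : 0 < β)
    (hinv : ∀ᶠ z in nhds z₀, Integrable (fun y => h y * (z - p y)⁻¹) μ)
    (hinv2 : Integrable (fun y => h y * ((z₀ - p y) ^ 2)⁻¹) μ)
    (hne : ∀ᶠ z in nhds z₀, ∀ᵐ y ∂μ, z ≠ p y)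
    {k : ℂ → Y → ℝ} (hk : ∀ᶠ z in nhds z₀, Integrable (k z) μ)
    (hle : ∀ᶠ z in nhds z₀, ∀ᵐ y ∂μ,
      ‖z - z₀‖ ^ 2 * (‖h y‖ / (‖z₀ - p y‖ ^ 2 * ‖z - p y‖)) ≤ ‖z - z₀‖ ^ (1 + β) * k z y)
    (hC : ∀ᶠ z in nhds z₀, ∫ y, k z y ∂μ ≤ C) :
    HasFDerivAt (fun z : ℂ => ∫ y, h y * (z - p y)⁻¹ ∂μ)
      (ContinuousLinearMap.mul ℝ ℂ (-∫ y, h y * ((z₀ - p y) ^ 2)⁻¹ ∂μ)) z₀ := by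
  refine hasFDerivAt_of_norm_le_rpow (C := C) hβ₀ ?_
  filter_upwards [hinv, hne, hk, hle, hC] with z hz1 hz2 hz3 hz4 hz5
  have hI : Integrable (fun y => h y * (z - p y)⁻¹ - h y * (z₀ - p y)⁻¹) μ :=
    hz1.sub hinv.self_of_nhds
  rw [ContinuousLinearMap.mul_apply', neg_mul, sub_neg_eq_add, ← integral_mul_const,
    ← integral_sub hz1 hinv.self_of_nhds,
    ← integral_add hI (hinv2.mul_const _)]
  refine (norm_integral_le_of_norm_le (hz3.const_mul (‖z - z₀‖ ^ (1 + β))) ?_).trans ?_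
  · filter_upwards [hz2, hne.self_of_nhds, hz4] with y hy1 hy2 hy3
    refine le_trans (le_of_eq ?_) hy3
    have h1 := sub_ne_zero.2 hy1
    have h2 := sub_ne_zero.2 hy2
    -- The second-order remainder of 1/(z - p) is an exact product.
    have : h y * (z - p y)⁻¹ - h y * (z₀ - p y)⁻¹ + h y * ((z₀ - p y) ^ 2)⁻¹ * (z - z₀) =
        (z - z₀) ^ 2 * (h y / ((z₀ - p y) ^ 2 * (z - p y))) := by
      field_simp
      ring
    rw [this, norm_mul, norm_div, norm_mul, norm_pow, norm_pow]
  · rw [integral_const_mul, mul_comm]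
    exact mul_le_mul_of_nonneg_right hz5 (by positivity)

/-! ### Potentials whose poles stay away from the evaluation point. -/

section Nonsingular

variable {Y : Type*} [MeasurableSpace Y] {μ : Measure Y} {h : Y → ℂ}
  {p : Y → ℂ} {z z₀ : ℂ} {M δ : ℝ}

lemma eventually_half_le_norm_sub (hδ : 0 < δ) (hz : ∀ᵐ y ∂μ, δ ≤ ‖z₀ - p y‖) :
    ∀ᶠ z in nhds z₀, ∀ᵐ y ∂μ, δ / 2 ≤ ‖z - p y‖ := by
  filter_upwards [Metric.ball_mem_nhds z₀ (half_pos hδ)] with z hz'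
  filter_upwards [hz] with y hy
  rw [mem_ball, dist_eq_norm] at hz'
  have : ‖z₀ - p y‖ ≤ ‖z - z₀‖ + ‖z - p y‖ := by
    rw [norm_sub_rev z z₀]
    exact norm_sub_le_norm_sub_add_norm_sub z₀ z (p y)
  linarith

lemma ne_of_le_norm_sub (hδ : 0 < δ) (hz : ∀ᵐ y ∂μ, δ ≤ ‖z - p y‖) : ∀ᵐ y ∂μ, z ≠ p y := by
  filter_upwards [hz] with y hy h
  rw [h, sub_self, norm_zero] at hy
  linarith

variable [IsFiniteMeasure μ]

lemma norm_mul_inv_pow_le {h a : ℂ} (hδ : 0 < δ) (hM : ‖h‖ ≤ M) (ha : δ ≤ ‖a‖) (n : ℕ) :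
    ‖h * (a ^ n)⁻¹‖ ≤ M * (δ ^ n)⁻¹ := by
  have := (norm_nonneg h).trans hM
  rw [norm_mul, norm_inv, norm_pow]
  gcongr

lemma integrable_cauchy_potential (hh : AEStronglyMeasurable h μ) (hM : ∀ᵐ y ∂μ, ‖h y‖ ≤ M)
    (hp : AEMeasurable p μ) (hδ : 0 < δ) (hz : ∀ᵐ y ∂μ, δ ≤ ‖z - p y‖) (n : ℕ) :
    Integrable (fun y => h y * ((z - p y) ^ n)⁻¹) μ := by
  refine Integrable.of_bound (C := M * (δ ^ n)⁻¹) (hh.mul ?_) ?_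
  · exact ((hp.const_sub z).pow_const n).inv.aestronglyMeasurable
  · filter_upwards [hM, hz] with y hy1 hy2 using norm_mul_inv_pow_le hδ hy1 hy2 n

lemma norm_cauchy_potential_le (hM : ∀ᵐ y ∂μ, ‖h y‖ ≤ M) (hδ : 0 < δ)
    (hz : ∀ᵐ y ∂μ, δ ≤ ‖z - p y‖) (n : ℕ) :
    ‖∫ y, h y * ((z - p y) ^ n)⁻¹ ∂μ‖ ≤ M * (δ ^ n)⁻¹ * μ.real univ := by
  refine norm_integral_le_of_norm_le_const ?_
  filter_upwards [hM, hz] with y hy1 hy2 using norm_mul_inv_pow_le hδ hy1 hy2 n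

lemma norm_inv_sub_inv_le_of_le {a b : ℂ} (hδ : 0 < δ) (ha : δ ≤ ‖a‖) (hb : δ ≤ ‖b‖) :
    ‖a⁻¹ - b⁻¹‖ ≤ ‖a - b‖ * (δ ^ 2)⁻¹ := by
  have ha' : a ≠ 0 := norm_pos_iff.1 (hδ.trans_le ha)
  have hb' : b ≠ 0 := norm_pos_iff.1 (hδ.trans_le hb)
  rw [inv_sub_inv ha' hb', norm_div, norm_mul, norm_sub_rev, div_eq_mul_inv, sq]
  gcongr

lemma norm_inv_sq_sub_inv_sq_le_of_le {a b : ℂ} (hδ : 0 < δ) (ha : δ ≤ ‖a‖) (hb : δ ≤ ‖b‖) :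
    ‖(a ^ 2)⁻¹ - (b ^ 2)⁻¹‖ ≤ 2 * ‖a - b‖ * (δ ^ 3)⁻¹ := by
  have h1 := norm_inv_sub_inv_le_of_le hδ ha hb
  have h2 : ‖a⁻¹‖ ≤ δ⁻¹ := by rw [norm_inv]; gcongr
  have h3 : ‖b⁻¹‖ ≤ δ⁻¹ := by rw [norm_inv]; gcongr
  rw [show (a ^ 2)⁻¹ - (b ^ 2)⁻¹ = (a⁻¹ - b⁻¹) * (a⁻¹ + b⁻¹) by
    rw [← inv_pow, ← inv_pow]; ring, norm_mul]
  calc _ ≤ ‖a - b‖ * (δ ^ 2)⁻¹ * (δ⁻¹ + δ⁻¹) := by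
        gcongr
        exact (norm_add_le _ _).trans (add_le_add h2 h3)
    _ = _ := by field_simp; ring

lemma norm_cauchy_potential_sub_le (hh : AEStronglyMeasurable h μ) (hM : ∀ᵐ y ∂μ, ‖h y‖ ≤ M)
    (hp : AEMeasurable p μ) (hδ : 0 < δ) (hz : ∀ᵐ y ∂μ, δ ≤ ‖z - p y‖)
    (hz₀ : ∀ᵐ y ∂μ, δ ≤ ‖z₀ - p y‖) :
    ‖(∫ y, h y * (z - p y)⁻¹ ∂μ) - ∫ y, h y * (z₀ - p y)⁻¹ ∂μ‖ ≤
      M * (‖z - z₀‖ * (δ ^ 2)⁻¹) * μ.real univ := by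
  have h1 := integrable_cauchy_potential hh hM hp hδ hz 1
  have h2 := integrable_cauchy_potential hh hM hp hδ hz₀ 1
  simp only [pow_one] at h1 h2
  rw [← integral_sub h1 h2]
  refine norm_integral_le_of_norm_le_const ?_
  filter_upwards [hM, hz, hz₀] with y hy1 hy2 hy3
  rw [← mul_sub, norm_mul]
  have := norm_inv_sub_inv_le_of_le hδ hy2 hy3
  rw [sub_sub_sub_cancel_right] at this
  have := (norm_nonneg _).trans hy1
  gcongr

lemma norm_cauchy_potential_sq_sub_le (hh : AEStronglyMeasurable h μ)
    (hM : ∀ᵐ y ∂μ, ‖h y‖ ≤ M) (hp : AEMeasurable p μ) (hδ : 0 < δ)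
    (hz : ∀ᵐ y ∂μ, δ ≤ ‖z - p y‖) (hz₀ : ∀ᵐ y ∂μ, δ ≤ ‖z₀ - p y‖) :
    ‖(∫ y, h y * ((z - p y) ^ 2)⁻¹ ∂μ) - ∫ y, h y * ((z₀ - p y) ^ 2)⁻¹ ∂μ‖ ≤
      M * (2 * ‖z - z₀‖ * (δ ^ 3)⁻¹) * μ.real univ := by
  have h1 := integrable_cauchy_potential hh hM hp hδ hz 2
  have h2 := integrable_cauchy_potential hh hM hp hδ hz₀ 2
  rw [← integral_sub h1 h2]
  refine norm_integral_le_of_norm_le_const ?_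
  filter_upwards [hM, hz, hz₀] with y hy1 hy2 hy3
  rw [← mul_sub, norm_mul]
  have := norm_inv_sq_sub_inv_sq_le_of_le hδ hy2 hy3
  rw [sub_sub_sub_cancel_right] at this
  have := (norm_nonneg _).trans hy1
  gcongr

theorem hasFDerivAt_cauchy_potential_of_le (hh : AEStronglyMeasurable h μ)
    (hM : ∀ᵐ y ∂μ, ‖h y‖ ≤ M) (hp : AEMeasurable p μ) (hδ : 0 < δ)
    (hz : ∀ᵐ y ∂μ, δ ≤ ‖z₀ - p y‖) :
    HasFDerivAt (fun z : ℂ => ∫ y, h y * (z - p y)⁻¹ ∂μ)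
      (ContinuousLinearMap.mul ℝ ℂ (-∫ y, h y * ((z₀ - p y) ^ 2)⁻¹ ∂μ)) z₀ := by
  have hev := eventually_half_le_norm_sub hδ hz
  refine hasFDerivAt_cauchy_potential (β := 1) (k := fun _ _ => M / (δ ^ 2 * (δ / 2)))
    (C := μ.real univ * (M / (δ ^ 2 * (δ / 2)))) one_pos ?_
    (integrable_cauchy_potential hh hM hp hδ hz 2) ?_ ?_ ?_ ?_
  · filter_upwards [hev] with z hz'
    simpa using integrable_cauchy_potential hh hM hp (half_pos hδ) hz' 1
  · filter_upwards [hev] with z hz' using ne_of_le_norm_sub (half_pos hδ) hz'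
  · exact .of_forall fun z => integrable_const _
  · filter_upwards [hev] with z hz'
    filter_upwards [hM, hz, hz'] with y hy1 hy2 hy3
    rw [one_add_one_eq_two, Real.rpow_two]
    have := (norm_nonneg _).trans hy1
    gcongr
  · exact .of_forall fun z => by simp

lemma integrable_log_potential {h : Y → ℝ} {B : ℝ} (hh : AEStronglyMeasurable h μ)
    (hM : ∀ᵐ y ∂μ, ‖h y‖ ≤ M) (hp : AEMeasurable p μ) (hB : ∀ᵐ y ∂μ, ‖p y‖ ≤ B) (hδ : 0 < δ)
    (hz : ∀ᵐ y ∂μ, δ ≤ ‖z - p y‖) :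
    Integrable (fun y => h y * Real.log ‖z - p y‖) μ := by
  refine Integrable.of_bound (C := M * (|Real.log δ| + (‖z‖ + B))) (hh.mul ?_) ?_
  · exact ((hp.const_sub z).norm.log).aestronglyMeasurable
  · filter_upwards [hM, hz, hB] with y hy1 hy2 hy3
    have h0 := (norm_nonneg _).trans hy1
    have h1 := Real.log_le_log hδ hy2
    have h2 := Real.log_le_self (norm_nonneg (z - p y))
    have h3 := norm_sub_le z (p y)
    rw [norm_mul, Real.norm_eq_abs (Real.log _)]
    gcongr
    have h4 := neg_abs_le (Real.log δ)
    have h5 := abs_nonneg (Real.log δ)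
    have h6 := norm_nonneg (z - p y)
    rw [abs_le]
    constructor <;> linarith

theorem hasFDerivAt_log_potential_of_le {h : Y → ℝ} {B : ℝ} (hh : AEStronglyMeasurable h μ)
    (hM : ∀ᵐ y ∂μ, ‖h y‖ ≤ M) (hp : AEMeasurable p μ) (hB : ∀ᵐ y ∂μ, ‖p y‖ ≤ B) (hδ : 0 < δ)
    (hz : ∀ᵐ y ∂μ, δ ≤ ‖z₀ - p y‖) :
    HasFDerivAt (fun z : ℂ => ∫ y, h y * Real.log ‖z - p y‖ ∂μ)
      (reMul (∫ y, (h y : ℂ) * (z₀ - p y)⁻¹ ∂μ)) z₀ := by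
  have hev := eventually_half_le_norm_sub hδ hz
  have hM' : ∀ᵐ y ∂μ, ‖(h y : ℂ)‖ ≤ M := by simpa using hM
  have hh' : AEStronglyMeasurable (fun y => (h y : ℂ)) μ :=
    Complex.continuous_ofReal.comp_aestronglyMeasurable hh
  have hb : ∀ᶠ z in nhds z₀, ∀ᵐ y ∂μ,
      ‖|h y| * ‖z - p y‖ ^ (-(1 + 1) : ℝ)‖ ≤ M * (δ / 2) ^ (-(1 + 1) : ℝ) := by
    filter_upwards [hev] with z hz'
    filter_upwards [hM, hz'] with y hy1 hy2
    have h0 := (norm_nonneg _).trans hy1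
    have h1 : 0 ≤ ‖z - p y‖ ^ (-(1 + 1) : ℝ) := by positivity
    rw [norm_mul, norm_abs_eq_norm, Real.norm_of_nonneg h1]
    refine mul_le_mul hy1 (Real.rpow_le_rpow_of_nonpos (half_pos hδ) hy2 (by norm_num))
      (by positivity) h0
  refine hasFDerivAt_log_potential (β := 1) (C := M * (δ / 2) ^ (-(1 + 1) : ℝ) * μ.real univ)
    one_pos le_rfl ?_ ?_ ?_ ?_ ?_
  · filter_upwards [hev] with z hz' using integrable_log_potential hh hM hp hB (half_pos hδ) hz'
  · simpa using integrable_cauchy_potential hh' hM' hp hδ hz 1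
  · filter_upwards [hev] with z hz' using ne_of_le_norm_sub (half_pos hδ) hz'
  · filter_upwards [hb] with z hz'
    refine Integrable.of_bound (hh.norm.mul ?_) _ hz'
    exact ((hp.const_sub z).norm.pow_const _).aestronglyMeasurable
  · filter_upwards [hb] with z hz'
    exact (le_abs_self _).trans (norm_integral_le_of_norm_le_const hz')

end Nonsingular

/-! ### The Cauchy transform outside the unit circle. -/

/-- A map outside the unit disc whose derivative grows at most like a power of the distance to the
disc is Hölder continuous. -/
theorem holder_of_norm_fderiv_le_rpow {F : ℂ → ℂ} {F' : ℂ → ℂ →L[ℝ] ℂ} {α A N : ℝ}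
    (hα₀ : 0 < α) (hα₁ : α < 1) (hA : 0 ≤ A) (hN : 0 ≤ N)
    (hF : ∀ z, 1 < ‖z‖ → HasFDerivAt F (F' z) z)
    (hF' : ∀ z, 1 < ‖z‖ → ‖F' z‖ ≤ A * (‖z‖ - 1) ^ (α - 1))
    (hFN : ∀ z, 2 ≤ ‖z‖ → ‖F z‖ ≤ N) :
    (∀ z, 1 < ‖z‖ → ‖F z‖ ≤ A / α + N) ∧
    ∀ z w, 1 < ‖z‖ → 1 < ‖w‖ →
      ‖F z - F w‖ ≤ (A * (4 / α + 2) + 8 * (A / α + N)) * ‖z - w‖ ^ α := by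
  -- Moving outwards by s, the integral of A (δ + t)^(α-1) is (A/α)((δ + s)^α - δ^α), at most (A/α)
  -- s^α whatever δ is.
  have hrad : ∀ z : ℂ, 1 < ‖z‖ → ∀ s : ℝ, 0 ≤ s →
      ‖F (z + s * (z / ‖z‖)) - F z‖ ≤ A / α * s ^ α := by
    intro z hz s hs
    set δ := ‖z‖ - 1 with hδ
    have hδ0 : 0 < δ := sub_pos.2 hz
    have hz0 : ‖z‖ ≠ 0 := by linarith
    set v : ℂ := z / ‖z‖ with hv
    have hvn : ‖v‖ = 1 := by
      rw [hv, norm_div, Complex.norm_real, norm_norm, div_self hz0]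
    have hnorm : ∀ t : ℝ, 0 ≤ t → ‖z + t * v‖ = 1 + (δ + t) := by
      intro t ht
      have : z + t * v = ((‖z‖ + t : ℝ) : ℂ) * v := by
        rw [hv]; push_cast
        have : (‖z‖ : ℂ) ≠ 0 := by exact_mod_cast hz0
        field_simp
      rw [this, norm_mul, hvn, Complex.norm_real, Real.norm_of_nonneg (by positivity), hδ]
      ring
    have hd : ∀ t : ℝ, 0 ≤ t →
        HasDerivAt (fun t : ℝ => F (z + t * v) - F z) (F' (z + t * v) v) t := by
      intro t ht
      have h1 : HasDerivAt (fun t : ℝ => z + (t : ℂ) * v) v t := by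
        simpa using ((Complex.ofRealCLM.hasDerivAt (x := t)).mul_const v).const_add z
      exact ((hF _ (by rw [hnorm t ht]; linarith)).comp_hasDerivAt t h1).sub_const _
    have key := image_norm_le_of_norm_deriv_right_le_deriv_boundary'
      (f := fun t : ℝ => F (z + t * v) - F z) (a := 0) (b := s)
      (f' := fun t : ℝ => F' (z + t * v) v)
      (B := fun t => A / α * ((δ + t) ^ α - δ ^ α)) (B' := fun t => A * (δ + t) ^ (α - 1))
      (fun t ht => (hd t ht.1).continuousAt.continuousWithinAt)
      (fun t ht => (hd t ht.1).hasDerivWithinAt) (by simp) ?_ ?_ ?_ (right_mem_Icc.2 hs)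
    · refine key.trans ?_
      have h1 := Real.rpow_add_le_add_rpow hδ0.le hs hα₀.le hα₁.le
      gcongr
      linarith
    · intro t ht
      have : δ + t ≠ 0 := by linarith [ht.1]
      exact ((continuousAt_const.mul (((continuousAt_const.add continuousAt_id).rpow_const
        (Or.inl this)).sub continuousAt_const))).continuousWithinAt
    · intro t ht
      have : δ + t ≠ 0 := by linarith [ht.1]
      have h1 : HasDerivAt (fun t => δ + t) 1 t := (hasDerivAt_id t).const_add δ
      have h2 := ((h1.rpow_const (p := α) (Or.inl this)).sub_const (δ ^ α)).const_mul (A / α)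
      refine (h2.congr_deriv ?_).hasDerivWithinAt
      field_simp
    · intro t ht
      have h1 := hF' (z + t * v) (by rw [hnorm t ht.1]; linarith [ht.1])
      rw [hnorm t ht.1, add_sub_cancel_left] at h1
      refine ((F' (z + t * v)).le_opNorm v).trans ?_
      rwa [hvn, mul_one]
  -- A radial step of length 1 reaches the region where `N` bounds F.
  have hbd : ∀ z, 1 < ‖z‖ → ‖F z‖ ≤ A / α + N := by
    intro z hz
    have h1 := hrad z hz 1 zero_le_one
    have hz0 : (‖z‖ : ℂ) ≠ 0 := by
      have : ‖z‖ ≠ 0 := by linarith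
      exact_mod_cast this
    have h2 := hFN (z + (1 : ℝ) * (z / ‖z‖)) (by
      have : z + (1 : ℝ) * (z / ‖z‖) = ((‖z‖ + 1 : ℝ) : ℂ) * (z / ‖z‖) := by
        push_cast; field_simp
      rw [this, norm_mul, Complex.norm_real, Real.norm_of_nonneg (by positivity), norm_div,
        Complex.norm_real, norm_norm, div_self (by linarith)]
      linarith)
    rw [Real.one_rpow, mul_one] at h1
    have h3 := norm_sub_le (F (z + (1 : ℝ) * (z / ‖z‖))) (F (z + (1 : ℝ) * (z / ‖z‖)) - F z)
    rw [sub_sub_cancel] at h3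
    linarith
  refine ⟨hbd, fun z w hz hw => ?_⟩
  set r := ‖z - w‖ with hr
  have hr0 : 0 ≤ r := norm_nonneg _
  have hA' : 0 ≤ A / α := by positivity
  rcases le_or_gt r (1 / 4) with hr4 | hr4
  · rcases hr0.eq_or_lt with hr00 | hrpos
    · rw [eq_comm, hr, norm_eq_zero, sub_eq_zero] at hr00
      rw [hr00, sub_self, norm_zero]
      positivity
    -- Both points are pushed outwards by 2r and compared there. The two radial legs give 4A/α, the
    -- segment between the new points gives 2A.
    set z' : ℂ := z + (2 * r : ℝ) * (z / ‖z‖) with hz'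
    set w' : ℂ := w + (2 * r : ℝ) * (w / ‖w‖) with hw'
    have e1 := hrad z hz (2 * r) (by positivity)
    have e2 := hrad w hw (2 * r) (by positivity)
    have e3 : (2 * r) ^ α ≤ 2 * r ^ α := by
      rw [Real.mul_rpow zero_le_two hr0]
      gcongr
      calc (2 : ℝ) ^ α ≤ 2 ^ (1 : ℝ) := Real.rpow_le_rpow_of_exponent_le one_le_two hα₁.le
        _ = 2 := Real.rpow_one 2
    have hnorm : ∀ x : ℂ, 1 < ‖x‖ → ‖x + (2 * r : ℝ) * (x / ‖x‖)‖ = ‖x‖ + 2 * r := by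
      intro x hx
      have hx0 : (‖x‖ : ℂ) ≠ 0 := by
        have : ‖x‖ ≠ 0 := by linarith
        exact_mod_cast this
      have : x + (2 * r : ℝ) * (x / ‖x‖) = ((‖x‖ + 2 * r : ℝ) : ℂ) * (x / ‖x‖) := by
        push_cast; field_simp
      rw [this, norm_mul, Complex.norm_real, Real.norm_of_nonneg (by positivity), norm_div,
        Complex.norm_real, norm_norm, div_self (by linarith), mul_one]
    have hunit : ‖z / ‖z‖ - w / ‖w‖‖ ≤ 2 * r := by
      have hz0 : (‖z‖ : ℂ) ≠ 0 := by
        have : ‖z‖ ≠ 0 := by linarith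
        exact_mod_cast this
      have hw0 : (‖w‖ : ℂ) ≠ 0 := by
        have : ‖w‖ ≠ 0 := by linarith
        exact_mod_cast this
      have : z / ‖z‖ - w / ‖w‖ = (z - w) / ‖z‖ + (w / ‖w‖) * (((‖w‖ - ‖z‖ : ℝ) : ℂ) / ‖z‖) := by
        push_cast
        field_simp
        ring
      rw [this]
      refine (norm_add_le _ _).trans ?_
      rw [norm_mul, norm_div, norm_div, norm_div, Complex.norm_real, Complex.norm_real,
        Complex.norm_real, norm_norm, norm_norm, div_self (by linarith), one_mul, ← hr, two_mul,
        Real.norm_eq_abs]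
      have h1 : |‖w‖ - ‖z‖| ≤ r := by
        rw [hr, norm_sub_rev]; exact abs_norm_sub_norm_le _ _
      exact add_le_add (div_le_self hr0 hz.le)
        ((div_le_self (abs_nonneg _) hz.le).trans h1)
    -- The distance is at most r + 4r², which is where r ≤ 1/4 enters.
    have hdist : ‖z' - w'‖ ≤ 2 * r := by
      have : z' - w' = (z - w) + (2 * r : ℝ) * (z / ‖z‖ - w / ‖w‖) := by
        rw [hz', hw']; ring
      rw [this]
      refine (norm_add_le _ _).trans ?_
      rw [norm_mul, Complex.norm_real, Real.norm_of_nonneg (by positivity)]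
      nlinarith
    -- Every point of the segment is within r of an endpoint, and the endpoints have norm above 1 +
    -- 2r.
    have hseg : ∀ x ∈ segment ℝ z' w', 1 + r ≤ ‖x‖ := by
      intro x hx
      have h1 : dist z' x + dist x w' = dist z' w' := dist_add_dist_of_mem_segment hx
      rw [dist_eq_norm, dist_eq_norm, dist_eq_norm] at h1
      have h2 := norm_sub_norm_le z' x
      have h3 := norm_sub_norm_le w' x
      rw [norm_sub_rev w' x] at h3
      have h4 := hnorm z hz
      have h5 := hnorm w hw
      rw [← hz'] at h4
      rw [← hw'] at h5
      linarith
    have e4 : ‖F w' - F z'‖ ≤ A * r ^ (α - 1) * ‖w' - z'‖ := by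
      refine (convex_segment z' w').norm_image_sub_le_of_norm_hasFDerivWithin_le (f' := F')
        (fun x hx => (hF x (by linarith [hseg x hx])).hasFDerivWithinAt) (fun x hx => ?_)
        (left_mem_segment ℝ z' w') (right_mem_segment ℝ z' w')
      have := hseg x hx
      refine (hF' x (by linarith)).trans ?_
      exact mul_le_mul_of_nonneg_left
        (Real.rpow_le_rpow_of_nonpos hrpos (by linarith) (by linarith)) hA
    have e5 : A * r ^ (α - 1) * ‖w' - z'‖ ≤ 2 * A * r ^ α := by
      rw [norm_sub_rev]
      calc _ ≤ A * r ^ (α - 1) * (2 * r) := by gcongr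
        _ = 2 * A * (r ^ (α - 1) * r) := by ring
        _ = _ := by rw [Real.rpow_sub_one hrpos.ne', div_mul_cancel₀ _ hrpos.ne']
    have e6 : ‖F z - F w‖ ≤ ‖F z' - F z‖ + ‖F w' - F z'‖ + ‖F w' - F w‖ := by
      have : F z - F w = -(F z' - F z) - (F w' - F z') + (F w' - F w) := by ring
      rw [this]
      refine (norm_add_le _ _).trans ?_
      gcongr
      refine (norm_sub_le _ _).trans ?_
      rw [norm_neg]
    have e7 : A / α * (2 * r) ^ α ≤ A / α * (2 * r ^ α) := by gcongr
    have e8 : (A * (4 / α + 2) + 8 * (A / α + N)) * r ^ α =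
        2 * (A / α * (2 * r ^ α)) + 2 * A * r ^ α + 8 * (A / α + N) * r ^ α := by ring
    have e9 : 0 ≤ 8 * (A / α + N) * r ^ α := by positivity
    linarith
  · have h1 : (1 : ℝ) / 4 ≤ r ^ α := by
      rcases le_total r 1 with h | h
      · calc (1 : ℝ) / 4 ≤ r := hr4.le
          _ = r ^ (1 : ℝ) := (Real.rpow_one r).symm
          _ ≤ r ^ α := Real.rpow_le_rpow_of_exponent_ge' hr0 h hα₀.le hα₁.le
      · linarith [Real.one_le_rpow h hα₀.le]
    have h2 := norm_sub_le (F z) (F w)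
    have h3 := hbd z hz
    have h4 := hbd w hw
    have h5 : 0 ≤ A * (4 / α + 2) * r ^ α := by positivity
    have h6 : 8 * (A / α + N) * (1 / 4) ≤ 8 * (A / α + N) * r ^ α := by gcongr
    linarith

/-- The chord is 2 sin(|θ - φ|/2), and Jordan's inequality bounds the sine from below. -/
lemma norm_circleMap_sub_circleMap_le {θ φ : ℝ} (h : |θ - φ| ≤ Real.pi) :
    2 / Real.pi * |θ - φ| ≤ ‖circleMap 0 1 θ - circleMap 0 1 φ‖ := by
  have h1 : circleMap 0 1 θ - circleMap 0 1 φ =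
      circleMap 0 1 φ * (Complex.exp (Complex.I * (θ - φ : ℝ)) - 1) := by
    rw [mul_sub, mul_one, circleMap_zero, circleMap_zero, Complex.ofReal_one, one_mul, one_mul,
      ← Complex.exp_add]
    congr 2
    push_cast
    ring
  rw [h1, norm_mul, norm_circleMap_zero, abs_one, one_mul, Complex.norm_exp_I_mul_ofReal_sub_one,
    norm_mul, Real.norm_two, Real.norm_eq_abs]
  have h2 : |Real.sin ((θ - φ) / 2)| = Real.sin (|θ - φ| / 2) := by
    rcases abs_cases (θ - φ) with ⟨h3, h4⟩ | ⟨h3, h4⟩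
    · rw [h3, abs_of_nonneg]
      rw [h3] at h
      exact Real.sin_nonneg_of_nonneg_of_le_pi (by linarith) (by linarith [Real.pi_pos])
    · rw [h3, neg_div, Real.sin_neg, abs_of_nonpos]
      rw [h3] at h
      exact Real.sin_nonpos_of_nonpos_of_neg_pi_le (by linarith) (by linarith [Real.pi_pos])
  rw [h2]
  have h3 := Real.mul_le_sin (x := |θ - φ| / 2) (by positivity) (by linarith)
  have h4 : 2 / Real.pi * |θ - φ| = 2 * (2 / Real.pi * (|θ - φ| / 2)) := by ring
  linarith

lemma integral_add_rpow_le {δ α b : ℝ} (hδ : 0 < δ) (hα₁ : α < 1) (hb : 0 ≤ b) :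
    ∫ t in (0 : ℝ)..b, (δ + t) ^ (α - 2) ≤ δ ^ (α - 1) / (1 - α) := by
  rw [intervalIntegral.integral_comp_add_left (fun x => x ^ (α - 2)), integral_rpow]
  · rw [add_zero, show α - 2 + 1 = -(1 - α) by ring, div_neg, ← neg_div, neg_sub,
      show α - 1 = -(1 - α) by ring]
    have : 0 < 1 - α := by linarith
    gcongr
    linarith [Real.rpow_nonneg (show 0 ≤ δ + b by linarith) (-(1 - α))]
  · right
    refine ⟨by linarith, ?_⟩
    rw [uIcc_of_le (by linarith), mem_Icc]
    intro h
    linarith [h.1]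

lemma norm_integral_le_of_norm_le_add_rpow {f : ℝ → ℂ} {δ α A b : ℝ} (hδ : 0 < δ) (hα₁ : α < 1)
    (hA : 0 ≤ A) (hb : 0 ≤ b) (hf : ∀ t ∈ Ioc 0 b, ‖f t‖ ≤ A * (δ + t) ^ (α - 2)) :
    ‖∫ t in (0 : ℝ)..b, f t‖ ≤ A * (δ ^ (α - 1) / (1 - α)) := by
  refine (intervalIntegral.norm_integral_le_of_norm_le hb (.of_forall hf) ?_).trans ?_
  · refine ContinuousOn.intervalIntegrable fun t ht => ?_
    rw [uIcc_of_le hb] at ht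
    have : δ + t ≠ 0 := by linarith [ht.1]
    exact ((continuousAt_const.mul ((continuousAt_const.add continuousAt_id).rpow_const
      (Or.inl this)))).continuousWithinAt
  · rw [intervalIntegral.integral_const_mul]
    gcongr
    exact integral_add_rpow_le hδ hα₁ hb

lemma integral_circleMap_eq {f : ℂ → ℂ} {r : ℝ} (hf : DiffContOnCl ℂ f (ball 0 |r|)) :
    ∫ θ in (0 : ℝ)..2 * Real.pi, f (circleMap 0 r θ) = 2 * Real.pi * f 0 := by
  have h1 := hf.circleAverage
  rw [Real.circleAverage_def] at h1
  rw [← h1, Complex.real_smul]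
  have : (Real.pi : ℂ) ≠ 0 := by exact_mod_cast Real.pi_ne_zero
  push_cast
  field_simp

/-- As z is outside the circle, w ↦ (z - w)^(-n) is holomorphic inside, and the mean value property
applies. -/
lemma integral_sub_circleMap_inv_pow {z : ℂ} {r : ℝ} (hz : |r| < ‖z‖) (n : ℕ) :
    ∫ θ in (0 : ℝ)..2 * Real.pi, ((z - circleMap 0 r θ) ^ n)⁻¹ = 2 * Real.pi * (z ^ n)⁻¹ := by
  have hne : ∀ w ∈ closedBall (0 : ℂ) |r|, (z - w) ^ n ≠ 0 := by
    intro w hw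
    refine pow_ne_zero n (sub_ne_zero.2 fun h => ?_)
    rw [mem_closedBall, dist_zero_right, ← h] at hw
    linarith
  have := integral_circleMap_eq (f := fun w : ℂ => ((z - w) ^ n)⁻¹) (r := r) ?_
  · simpa using this
  · refine DifferentiableOn.diffContOnCl fun w hw => ?_
    have h1 : DifferentiableAt ℂ (fun w : ℂ => (z - w) ^ n) w := by fun_prop
    exact (h1.inv (hne w (closure_ball_subset_closedBall hw))).differentiableWithinAt

/-- The Cauchy transform on the unit circle. -/
noncomputable def circleCauchy (h : ℝ → ℂ) (z : ℂ) : ℂ :=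
  ∫ θ in (0 : ℝ)..2 * Real.pi, h θ * (z - circleMap 0 1 θ)⁻¹

lemma sub_one_le_norm_sub_circleMap (z : ℂ) (θ : ℝ) : ‖z‖ - 1 ≤ ‖z - circleMap 0 1 θ‖ := by
  have := norm_sub_norm_le z (circleMap 0 1 θ)
  rwa [norm_circleMap_zero, abs_one] at this

lemma hasFDerivAt_circleCauchy {h : ℝ → ℂ} {M : ℝ} (hc : Continuous h) (hM : ∀ θ, ‖h θ‖ ≤ M)
    {z : ℂ} (hz : 1 < ‖z‖) :
    HasFDerivAt (circleCauchy h) (ContinuousLinearMap.mul ℝ ℂ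
      (-∫ θ in (0 : ℝ)..2 * Real.pi, h θ * ((z - circleMap 0 1 θ) ^ 2)⁻¹)) z := by
  have := hasFDerivAt_cauchy_potential_of_le (μ := volume.restrict (Ioc 0 (2 * Real.pi)))
    (h := h) (p := circleMap 0 1) (z₀ := z) (M := M) (δ := ‖z‖ - 1)
    hc.aestronglyMeasurable (.of_forall hM) (continuous_circleMap 0 1).measurable.aemeasurable
    (sub_pos.2 hz) (.of_forall fun θ => sub_one_le_norm_sub_circleMap z θ)
  have e : circleCauchy h = fun z => ∫ θ in Ioc 0 (2 * Real.pi), h θ * (z - circleMap 0 1 θ)⁻¹ := by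
    ext z
    rw [circleCauchy, intervalIntegral.integral_of_le Real.two_pi_pos.le]
  rw [e, intervalIntegral.integral_of_le Real.two_pi_pos.le]
  exact this

lemma norm_circleCauchy_le {h : ℝ → ℂ} {M : ℝ} (hM : ∀ θ, ‖h θ‖ ≤ M) {z : ℂ} (hz : 2 ≤ ‖z‖) :
    ‖circleCauchy h z‖ ≤ 2 * Real.pi * M := by
  have := norm_cauchy_potential_le (μ := volume.restrict (Ioc 0 (2 * Real.pi)))
    (h := h) (p := circleMap 0 1) (z := z) (M := M) (δ := 1) (.of_forall hM) one_pos
    (.of_forall fun θ => by linarith [sub_one_le_norm_sub_circleMap z θ]) 1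
  simp only [pow_one, inv_one, mul_one, measureReal_restrict_apply_univ,
    Real.volume_real_Ioc_of_le Real.two_pi_pos.le, sub_zero] at this
  rw [circleCauchy, intervalIntegral.integral_of_le Real.two_pi_pos.le, mul_comm _ M]
  exact this

/-- The point at angle θ₀ is the point of the circle nearest to z, so the triangle inequality loses
only a factor 2. -/
lemma norm_sub_circleMap_ge {z : ℂ} {θ₀ θ : ℝ} (hz : 1 < ‖z‖)
    (hz₀ : z = ‖z‖ * circleMap 0 1 θ₀) :
    ‖circleMap 0 1 θ - circleMap 0 1 θ₀‖ ≤ 2 * ‖z - circleMap 0 1 θ‖ := by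
  have h1 : ‖z - circleMap 0 1 θ₀‖ = ‖z‖ - 1 := by
    have : z - circleMap 0 1 θ₀ = ((‖z‖ - 1 : ℝ) : ℂ) * circleMap 0 1 θ₀ := by
      conv_lhs => rw [hz₀]
      push_cast; ring
    rw [this, norm_mul, norm_circleMap_zero, abs_one, mul_one, Complex.norm_real,
      Real.norm_of_nonneg (by linarith)]
  have h2 := sub_one_le_norm_sub_circleMap z θ
  have h3 : circleMap 0 1 θ - circleMap 0 1 θ₀ =
      (z - circleMap 0 1 θ₀) - (z - circleMap 0 1 θ) := by ring
  rw [h3]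
  exact (norm_sub_le _ _).trans (by linarith)

lemma circleMap_holder_integrand_le {h : ℝ → ℂ} {K α : ℝ} (hα₀ : 0 < α) (hα₁ : α < 1)
    (hK : 0 ≤ K)
    (hh : ∀ θ φ, ‖h θ - h φ‖ ≤ K * ‖circleMap 0 1 θ - circleMap 0 1 φ‖ ^ α)
    {z : ℂ} {θ₀ θ t : ℝ} (hz : 1 < ‖z‖) (hz₀ : z = ‖z‖ * circleMap 0 1 θ₀) (ht : 0 ≤ t)
    (hθt : |θ - θ₀| = t) (htπ : t ≤ Real.pi) :
    ‖(h θ - h θ₀) * ((z - circleMap 0 1 θ) ^ 2)⁻¹‖ ≤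
      8 * Real.pi ^ 2 * K * (‖z‖ - 1 + t) ^ (α - 2) := by
  set D := ‖z - circleMap 0 1 θ‖ with hD
  set δ := ‖z‖ - 1 with hδ
  have hδ0 : 0 < δ := sub_pos.2 hz
  have h1 : δ ≤ D := sub_one_le_norm_sub_circleMap z θ
  have hD0 : 0 < D := hδ0.trans_le h1
  have h2 := norm_sub_circleMap_ge (θ := θ) hz hz₀
  have h3 := norm_circleMap_sub_circleMap_le (θ := θ) (φ := θ₀) (by rw [hθt]; exact htπ)
  have hπ := Real.pi_pos
  have hπ1 : 1 ≤ Real.pi := by linarith [Real.two_le_pi]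
  -- From δ ≤ D and t ≤ π D one gets δ + t ≤ (1 + π) D ≤ 2π D.
  have h4 : (δ + t) / (2 * Real.pi) ≤ D := by
    rw [div_le_iff₀ (by positivity)]
    rw [hθt, div_mul_eq_mul_div, div_le_iff₀ hπ] at h3
    nlinarith
  rw [norm_mul, norm_inv, norm_pow]
  calc ‖h θ - h θ₀‖ * (D ^ 2)⁻¹
      ≤ K * (2 * D) ^ α * (D ^ 2)⁻¹ := by
        gcongr
        exact (hh θ θ₀).trans (by gcongr)
    _ = 2 ^ α * K * D ^ (α - 2) := by
        rw [Real.mul_rpow zero_le_two hD0.le, Real.rpow_sub hD0, Real.rpow_two]; ring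
    _ ≤ 2 * K * ((δ + t) / (2 * Real.pi)) ^ (α - 2) := by
        have e1 : (2 : ℝ) ^ α ≤ 2 := by
          calc (2 : ℝ) ^ α ≤ 2 ^ (1 : ℝ) := Real.rpow_le_rpow_of_exponent_le one_le_two hα₁.le
            _ = 2 := Real.rpow_one 2
        have e2 := Real.rpow_le_rpow_of_nonpos (z := α - 2) (by positivity) h4 (by linarith)
        gcongr
    _ = 2 * K * (2 * Real.pi) ^ (2 - α) * (δ + t) ^ (α - 2) := by
        rw [Real.div_rpow (by positivity) (by positivity),
          show (2 * Real.pi) ^ (2 - α) = ((2 * Real.pi) ^ (α - 2))⁻¹ by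
            rw [← Real.rpow_neg (by positivity), neg_sub]]
        ring
    _ ≤ 2 * K * (2 * Real.pi) ^ (2 : ℝ) * (δ + t) ^ (α - 2) := by
        gcongr
        · linarith
        · linarith
    _ = _ := by rw [Real.rpow_two]; ring

/-- Without cancellation the integral would only be O(1/(|z| - 1)). Subtracting h(θ₀), with θ₀ the
argument of z, gains the Hölder power, and the constant removed is integrated exactly. -/
theorem norm_integral_circle_sq_le {h : ℝ → ℂ} {M K α : ℝ} (hα₀ : 0 < α) (hα₁ : α < 1)
    (hK : 0 ≤ K) (hc : Continuous h) (hM : ∀ θ, ‖h θ‖ ≤ M)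
    (hh : ∀ θ φ, ‖h θ - h φ‖ ≤ K * ‖circleMap 0 1 θ - circleMap 0 1 φ‖ ^ α)
    {z : ℂ} (hz : 1 < ‖z‖) :
    ‖∫ θ in (0 : ℝ)..2 * Real.pi, h θ * ((z - circleMap 0 1 θ) ^ 2)⁻¹‖ ≤
      (16 * Real.pi ^ 2 / (1 - α) * K + 2 * Real.pi * M) * (‖z‖ - 1) ^ (α - 1) := by
  have hM0 : 0 ≤ M := (norm_nonneg _).trans (hM 0)
  set θ₀ := z.arg with hθ₀
  have hz₀ : z = ‖z‖ * circleMap 0 1 θ₀ := by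
    rw [circleMap_zero, Complex.ofReal_one, one_mul, Complex.norm_mul_exp_arg_mul_I]
  set δ := ‖z‖ - 1 with hδ
  have hδ0 : 0 < δ := sub_pos.2 hz
  have hne : ∀ θ, (z - circleMap 0 1 θ) ^ 2 ≠ 0 := fun θ => pow_ne_zero _ (norm_pos_iff.1
    (hδ0.trans_le (sub_one_le_norm_sub_circleMap z θ)))
  have hcv : Continuous fun θ => ((z - circleMap 0 1 θ) ^ 2)⁻¹ :=
    ((continuous_const.sub (continuous_circleMap 0 1)).pow 2).inv₀ hne
  set f : ℝ → ℂ := fun θ => (h θ - h θ₀) * ((z - circleMap 0 1 θ) ^ 2)⁻¹ with hf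
  have hfc : Continuous f := (hc.sub continuous_const).mul hcv
  -- The Hölder condition is in terms of chords, so it forces h to be 2π-periodic.
  have hper : Function.Periodic f (2 * Real.pi) := by
    intro θ
    have h1 := hh (θ + 2 * Real.pi) θ
    rw [periodic_circleMap 0 1 θ, sub_self, norm_zero, Real.zero_rpow hα₀.ne', mul_zero] at h1
    have h2 : h (θ + 2 * Real.pi) = h θ := sub_eq_zero.1 (norm_le_zero_iff.1 h1)
    simp only [hf, h2, periodic_circleMap 0 1 θ]
  -- By periodicity the integral is centred at θ₀ and halved, so that |θ - θ₀| ≤ π on each half.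
  have hsplit : ∫ θ in (0 : ℝ)..2 * Real.pi, h θ * ((z - circleMap 0 1 θ) ^ 2)⁻¹ =
      (∫ t in (0 : ℝ)..Real.pi, f (θ₀ - t)) + (∫ t in (0 : ℝ)..Real.pi, f (θ₀ + t)) +
        h θ₀ * (2 * Real.pi * (z ^ 2)⁻¹) := by
    rw [intervalIntegral.integral_comp_sub_left f, intervalIntegral.integral_comp_add_left f,
      sub_zero, add_zero, intervalIntegral.integral_add_adjacent_intervals
        (hfc.intervalIntegrable _ _) (hfc.intervalIntegrable _ _)]
    have h1 := hper.intervalIntegral_add_eq (θ₀ - Real.pi) 0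
    rw [show θ₀ - Real.pi + 2 * Real.pi = θ₀ + Real.pi by ring, zero_add] at h1
    have hcv' : Continuous fun θ => h θ₀ * ((z - circleMap 0 1 θ) ^ 2)⁻¹ :=
      continuous_const.mul hcv
    rw [h1, ← integral_sub_circleMap_inv_pow (r := 1) (by rwa [abs_one]) 2,
      ← intervalIntegral.integral_const_mul, ← intervalIntegral.integral_add
        (hfc.intervalIntegrable _ _) (hcv'.intervalIntegrable _ _)]
    refine intervalIntegral.integral_congr fun θ _ => ?_
    simp only [hf]
    ring
  have hb1 := norm_integral_le_of_norm_le_add_rpow (f := fun t => f (θ₀ - t)) (δ := δ) (α := α)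
    (A := 8 * Real.pi ^ 2 * K) (b := Real.pi) hδ0 hα₁ (by positivity) Real.pi_pos.le
    (fun t ht => circleMap_holder_integrand_le hα₀ hα₁ hK hh hz hz₀ ht.1.le
      (by rw [sub_sub_cancel_left, abs_neg, abs_of_pos ht.1]) ht.2)
  have hb2 := norm_integral_le_of_norm_le_add_rpow (f := fun t => f (θ₀ + t)) (δ := δ) (α := α)
    (A := 8 * Real.pi ^ 2 * K) (b := Real.pi) hδ0 hα₁ (by positivity) Real.pi_pos.le
    (fun t ht => circleMap_holder_integrand_le hα₀ hα₁ hK hh hz hz₀ ht.1.le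
      (by rw [add_sub_cancel_left, abs_of_pos ht.1]) ht.2)
  -- For δ ≤ 1 the right side is at least 1 and the left at most 1; for δ ≥ 1 one uses |z|² ≥ δ.
  have hb3 : (‖z‖ ^ 2)⁻¹ ≤ δ ^ (α - 1) := by
    rcases le_total δ 1 with h1 | h1
    · refine le_trans ?_ (Real.one_le_rpow_of_pos_of_le_one_of_nonpos hδ0 h1 (by linarith))
      exact inv_le_one_of_one_le₀ (by nlinarith)
    · calc (‖z‖ ^ 2)⁻¹ ≤ δ⁻¹ := by
            refine inv_anti₀ hδ0 ?_
            nlinarith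
        _ = δ ^ (-1 : ℝ) := (Real.rpow_neg_one δ).symm
        _ ≤ _ := Real.rpow_le_rpow_of_exponent_le h1 (by linarith)
  have hb4 : ‖h θ₀ * (2 * Real.pi * (z ^ 2)⁻¹)‖ ≤ M * (2 * Real.pi * δ ^ (α - 1)) := by
    rw [norm_mul, norm_mul, norm_mul, norm_inv, norm_pow, Complex.norm_real,
      Real.norm_of_nonneg Real.pi_pos.le, Complex.norm_two]
    have := hM θ₀
    have := Real.pi_pos
    gcongr
  rw [hsplit]
  refine (norm_add₃_le).trans ?_
  have e1 : (16 * Real.pi ^ 2 / (1 - α) * K + 2 * Real.pi * M) * δ ^ (α - 1) =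
      8 * Real.pi ^ 2 * K * (δ ^ (α - 1) / (1 - α)) + 8 * Real.pi ^ 2 * K * (δ ^ (α - 1) / (1 - α))
        + M * (2 * Real.pi * δ ^ (α - 1)) := by ring
  rw [e1]
  exact add_le_add (add_le_add hb1 hb2) hb4

/-- Uniform and Hölder bounds for the Cauchy transform outside the unit circle. -/
theorem exists_circleCauchy_bound {α : ℝ} (hα₀ : 0 < α) (hα₁ : α < 1) :
    ∃ C : ℝ, 0 < C ∧ ∀ (h : ℝ → ℂ) (M K : ℝ), 0 ≤ K → Continuous h → (∀ θ, ‖h θ‖ ≤ M) →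
      (∀ θ φ, ‖h θ - h φ‖ ≤ K * ‖circleMap 0 1 θ - circleMap 0 1 φ‖ ^ α) →
      (∀ z, 1 < ‖z‖ → ‖circleCauchy h z‖ ≤ C * (M + K)) ∧
      ∀ z w, 1 < ‖z‖ → 1 < ‖w‖ →
        ‖circleCauchy h z - circleCauchy h w‖ ≤ C * (M + K) * ‖z - w‖ ^ α := by
  have h1α : 0 < 1 - α := by linarith
  have hπ := Real.pi_pos
  set A := 16 * Real.pi ^ 2 / (1 - α) + 2 * Real.pi with hA
  have hA0 : 0 < A := by positivity
  refine ⟨A * (4 / α + 2) + 8 * (A / α + 2 * Real.pi), by positivity, ?_⟩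
  intro h M K hK hc hM hh
  have hM0 : 0 ≤ M := (norm_nonneg _).trans (hM 0)
  have := holder_of_norm_fderiv_le_rpow (F := circleCauchy h) (F' := fun z =>
      ContinuousLinearMap.mul ℝ ℂ
        (-∫ θ in (0 : ℝ)..2 * Real.pi, h θ * ((z - circleMap 0 1 θ) ^ 2)⁻¹))
      (A := A * (M + K)) (N := 2 * Real.pi * (M + K)) hα₀ hα₁ (by positivity) (by positivity)
      (fun z hz => hasFDerivAt_circleCauchy hc hM hz) (fun z hz => ?_) (fun z hz => ?_)
  · refine ⟨fun z hz => (this.1 z hz).trans ?_, fun z w hz hw => (this.2 z w hz hw).trans_eq ?_⟩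
    · have e : A * (M + K) / α + 2 * Real.pi * (M + K) = (A / α + 2 * Real.pi) * (M + K) := by
        ring
      rw [e]
      have e1 : 0 ≤ A * (4 / α + 2) := by positivity
      have e2 : 0 ≤ A / α := by positivity
      refine mul_le_mul_of_nonneg_right ?_ (by positivity)
      linarith
    · ring
  · refine (ContinuousLinearMap.opNorm_mul_apply_le ℝ ℂ _).trans ?_
    rw [norm_neg]
    refine (norm_integral_circle_sq_le hα₀ hα₁ hK hc hM hh hz).trans ?_
    have : 0 ≤ ‖z‖ - 1 := by linarith
    gcongr
    have e1 : 0 ≤ 16 * Real.pi ^ 2 / (1 - α) * M := by positivity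
    have e2 : 0 ≤ 2 * Real.pi * K := by positivity
    rw [hA]
    linarith
  · refine (norm_circleCauchy_le hM hz).trans ?_
    gcongr
    linarith

/-- Integration by parts in the derivative of the Cauchy transform. -/
theorem integral_circle_sq_eq_circleCauchy {k k' : ℝ → ℂ} (hk : ∀ θ, HasDerivAt k (k' θ) θ)
    (hk' : Continuous k') (hper : k (2 * Real.pi) = k 0) {z : ℂ} (hz : 1 < ‖z‖) :
    -∫ θ in (0 : ℝ)..2 * Real.pi, k θ * ((z - circleMap 0 1 θ) ^ 2)⁻¹ =
      -Complex.I * circleCauchy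
        (fun θ => (k' θ - Complex.I * k θ) * (circleMap 0 1 θ)⁻¹) z := by
  have hkc : Continuous k := continuous_iff_continuousAt.2 fun θ => (hk θ).continuousAt
  have he : ∀ θ, circleMap 0 1 θ ≠ 0 := fun θ => circleMap_ne_center one_ne_zero
  have hd : ∀ θ, z - circleMap 0 1 θ ≠ 0 := fun θ => norm_pos_iff.1
    ((sub_pos.2 hz).trans_le (sub_one_le_norm_sub_circleMap z θ))
  have hec := continuous_circleMap 0 1
  have hc1 : Continuous fun θ => k θ * ((z - circleMap 0 1 θ) ^ 2)⁻¹ :=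
    hkc.mul (((continuous_const.sub hec).pow 2).inv₀ fun θ => pow_ne_zero _ (hd θ))
  have hc2 : Continuous fun θ => (k' θ - Complex.I * k θ) * (circleMap 0 1 θ)⁻¹ *
      (z - circleMap 0 1 θ)⁻¹ :=
    ((hk'.sub (continuous_const.mul hkc)).mul (hec.inv₀ he)).mul
      ((continuous_const.sub hec).inv₀ hd)
  -- The derivative of (z - e^(iθ))⁻¹ in θ is i e^(iθ) (z - e^(iθ))⁻². The factor e^(-iθ) in the
  -- primitive cancels the e^(iθ), and its own derivative produces the term -i k.
  have hP : ∀ θ, HasDerivAt (fun θ => k θ * (circleMap 0 1 θ)⁻¹ * (z - circleMap 0 1 θ)⁻¹)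
      ((k' θ - Complex.I * k θ) * (circleMap 0 1 θ)⁻¹ * (z - circleMap 0 1 θ)⁻¹ +
        Complex.I * (k θ * ((z - circleMap 0 1 θ) ^ 2)⁻¹)) θ := by
    intro θ
    have h1 := hasDerivAt_circleMap 0 1 θ
    have h2 := h1.fun_inv (he θ)
    have h3 := (h1.const_sub z).fun_inv (hd θ)
    refine (((hk θ).mul h2).mul h3).congr_deriv ?_
    have := he θ
    have := hd θ
    simp only [Pi.mul_apply]
    field_simp
    ring
  have hc3 : Continuous fun θ => Complex.I * (k θ * ((z - circleMap 0 1 θ) ^ 2)⁻¹) :=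
    continuous_const.mul hc1
  have h0 := intervalIntegral.integral_eq_sub_of_hasDerivAt (a := 0) (b := 2 * Real.pi)
    (fun θ _ => hP θ) ((hc2.add hc3).intervalIntegrable _ _)
  have hp := periodic_circleMap 0 1 0
  rw [zero_add] at hp
  rw [hper, hp, sub_self, intervalIntegral.integral_add (hc2.intervalIntegrable _ _)
    (hc3.intervalIntegrable _ _), intervalIntegral.integral_const_mul] at h0
  rw [circleCauchy]
  linear_combination (Complex.I) * h0 - (∫ θ in (0 : ℝ)..2 * Real.pi,
    k θ * ((z - circleMap 0 1 θ) ^ 2)⁻¹) * Complex.I_sq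

/-! ### The circle in complex coordinates and the kernel on it. -/

lemma planeToComplex_apply (x : Plane) : planeToComplex x = ⟨x 0, x 1⟩ := by
  apply Complex.ext <;> simp [planeToComplex, Complex.orthonormalBasisOneI_repr_symm_apply]

lemma planeToComplex_circlePoint (R θ : ℝ) : planeToComplex (circlePoint R θ) = circleMap 0 R θ := by
  rw [planeToComplex_apply, circleMap_zero, Complex.exp_mul_I]
  apply Complex.ext <;>
    simp [circlePoint, Complex.cos_ofReal_re, Complex.sin_ofReal_re, Complex.cos_ofReal_im,
      Complex.sin_ofReal_im]

lemma norm_planeToComplex_sub (x y : Plane) :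
    ‖planeToComplex x - planeToComplex y‖ = ‖x - y‖ := by
  rw [← map_sub, planeToComplex.norm_map]

lemma rotate_circlePoint (R θ φ : ℝ) : rotate φ (circlePoint R θ) = circlePoint R (θ + φ) := by
  ext i
  fin_cases i <;> simp [rotate, circlePoint, Real.cos_add, Real.sin_add] <;> ring

lemma norm_circlePoint {R : ℝ} (hR : 0 ≤ R) (θ : ℝ) : ‖circlePoint R θ‖ = R := by
  rw [← planeToComplex.norm_map, planeToComplex_circlePoint, norm_circleMap_zero,
    abs_of_nonneg hR]

lemma circlePoint_mem_sphere {R : ℝ} (hR : 0 ≤ R) (θ : ℝ) :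
    circlePoint R θ ∈ sphere (0 : Plane) R := by
  rw [mem_sphere, dist_zero_right, norm_circlePoint hR]

lemma circleMap_eq_mul (R θ : ℝ) : circleMap 0 R θ = R * circleMap 0 1 θ := by
  rw [circleMap_zero, circleMap_zero, Complex.ofReal_one, one_mul]

lemma norm_circlePoint_sub {R : ℝ} (hR : 0 ≤ R) (θ φ : ℝ) :
    ‖circlePoint R θ - circlePoint R φ‖ = R * ‖circleMap 0 1 θ - circleMap 0 1 φ‖ := by
  rw [← norm_planeToComplex_sub, planeToComplex_circlePoint, planeToComplex_circlePoint,
    circleMap_eq_mul R, circleMap_eq_mul R, ← mul_sub, norm_mul, Complex.norm_real,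
    Real.norm_of_nonneg hR]

lemma eq_circlePoint_arg {R : ℝ} {y : Plane} (hy : y ∈ sphere (0 : Plane) R) :
    y = circlePoint R (planeToComplex y).arg := by
  apply planeToComplex.injective
  rw [planeToComplex_circlePoint, circleMap_zero]
  conv_lhs => rw [← Complex.norm_mul_exp_arg_mul_I (planeToComplex y)]
  rw [planeToComplex.norm_map, ← dist_zero_right, mem_sphere.1 hy]

/-- Inverting both points of the pair (y*, x) gives the symmetry of the reflected distance. It makes
the reflected term of the kernel a logarithm in x with a pole depending only on y. -/
lemma norm_sub_inversion {R : ℝ} (hR : R ≠ 0) {x y : Plane} (hx : x ≠ 0) (hy : y ≠ 0) :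
    ‖y - EuclideanGeometry.inversion 0 R x‖ =
      ‖y‖ / ‖x‖ * ‖x - EuclideanGeometry.inversion 0 R y‖ := by
  have hx' := norm_pos_iff.2 hx
  have hy' := norm_pos_iff.2 hy
  have hiy : EuclideanGeometry.inversion 0 R y ≠ 0 := by
    rw [Ne, EuclideanGeometry.inversion_eq_center hR]; exact hy
  have h1 := EuclideanGeometry.dist_inversion_inversion (c := (0 : Plane)) hiy hx R
  rw [EuclideanGeometry.inversion_inversion _ hR, EuclideanGeometry.dist_inversion_center,
    dist_zero_right, dist_zero_right, dist_eq_norm, dist_eq_norm] at h1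
  rw [h1, norm_sub_rev x]
  field_simp

/-- Points of the circle are fixed by the inversion, so the two logarithms of the kernel merge and
the coefficient doubles to 1/π. -/
lemma greenN_circlePoint {R : ℝ} (hR : 0 < R) {x : Plane} (hx : R < ‖x‖) (θ : ℝ) :
    greenN R x (circlePoint R θ) =
      -(1 / Real.pi) * Real.log ‖planeToComplex x - circleMap 0 R θ‖ +
        (1 / (2 * Real.pi) * (Real.log ‖x‖ - Real.log R) + 1 / (4 * Real.pi)) := by
  have hn := norm_circlePoint hR.le θ
  have hx0 : x ≠ 0 := norm_pos_iff.1 (hR.trans hx)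
  have hy0 : circlePoint R θ ≠ 0 := norm_pos_iff.1 (by rw [hn]; exact hR)
  have hxn : ‖x‖ ≠ 0 := norm_ne_zero_iff.2 hx0
  have hinv : EuclideanGeometry.inversion 0 R (circlePoint R θ) = circlePoint R θ :=
    EuclideanGeometry.inversion_of_mem_sphere (circlePoint_mem_sphere hR.le θ)
  have hd : ‖x - circlePoint R θ‖ ≠ 0 := by
    rw [norm_ne_zero_iff, sub_ne_zero]
    rintro rfl
    linarith
  rw [greenN, fundSol, corrector, norm_sub_inversion hR.ne' hx0 hy0, hinv, hn,
    Real.log_mul (div_ne_zero hR.ne' hxn) hd, Real.log_div hR.ne' hxn, ← planeToComplex_circlePoint,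
    norm_planeToComplex_sub, norm_sub_rev (circlePoint R θ) x]
  have := Real.pi_ne_zero
  field_simp
  ring

/-- This is the potential of a Dirac mass at 0. -/
lemma hasFDerivAt_log_norm {z : ℂ} (hz : z ≠ 0) :
    HasFDerivAt (fun z : ℂ => Real.log ‖z‖) (reMul z⁻¹) z := by
  have := hasFDerivAt_log_potential_of_le (μ := Measure.dirac ()) (h := fun _ => 1)
    (p := fun _ => 0) (z₀ := z) (M := 1) (B := 0) (δ := ‖z‖) aestronglyMeasurable_const
    (.of_forall fun _ => by simp) aemeasurable_const (.of_forall fun _ => by simp)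
    (norm_pos_iff.2 hz) (.of_forall fun _ => by simp)
  simpa using this

lemma isOpen_annulus (r s : ℝ) : IsOpen (annulus r s) :=
  (isOpen_lt continuous_const continuous_norm).inter (isOpen_lt continuous_norm continuous_const)

lemma continuous_circlePoint (R : ℝ) : Continuous (circlePoint R) := by
  have : circlePoint R = fun θ => planeToComplex.symm (circleMap 0 R θ) := by
    ext1 θ
    rw [← planeToComplex_circlePoint, planeToComplex.symm_apply_apply]
  rw [this]
  exact planeToComplex.symm.continuous.comp (continuous_circleMap 0 R)

/-! ### The single layer as a Cauchy transform. -/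

section SingleLayer

variable {R : ℝ} {γ : ℝ → ℝ}

/-- The density on the unit circle whose Cauchy transform is the complex gradient of the single
layer potential. -/
noncomputable def layerDensity (γ : ℝ → ℝ) (θ : ℝ) : ℂ :=
  ((-(1 / Real.pi) * γ θ + (∫ θ in (0 : ℝ)..2 * Real.pi, γ θ) / (4 * Real.pi ^ 2) : ℝ) : ℂ)

lemma norm_div_ofReal (hR : 0 < R) (z : ℂ) : ‖z / R‖ = ‖z‖ / R := by
  rw [norm_div, Complex.norm_real, Real.norm_of_nonneg hR.le]

lemma one_lt_norm_div (hR : 0 < R) {z : ℂ} (hz : R < ‖z‖) : 1 < ‖z / R‖ := by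
  rwa [norm_div_ofReal hR, one_lt_div hR]

/-- The constant term of `layerDensity` accounts for the log|x| part of the kernel: with m the
integral of γ, that part has gradient R m/(2π z), and 1/z is itself the Cauchy transform of a
constant outside the circle. -/
lemma circleCauchy_layerDensity (hR : 0 < R) (hγ : Continuous γ) {z : ℂ} (hz : R < ‖z‖) :
    circleCauchy (layerDensity γ) (z / R) =
      (∫ θ in (0 : ℝ)..2 * Real.pi, ((-(R / Real.pi) * γ θ : ℝ) : ℂ) * (z - circleMap 0 R θ)⁻¹) +
        ((R * (∫ θ in (0 : ℝ)..2 * Real.pi, γ θ) / (2 * Real.pi) : ℝ) : ℂ) * z⁻¹ := by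
  have hz' := one_lt_norm_div hR hz
  have hRc : (R : ℂ) ≠ 0 := by exact_mod_cast hR.ne'
  have hπ : (Real.pi : ℂ) ≠ 0 := by exact_mod_cast Real.pi_ne_zero
  have hz0 : z ≠ 0 := norm_pos_iff.1 (hR.trans hz)
  have hd : ∀ θ, z / R - circleMap 0 1 θ ≠ 0 := fun θ => norm_pos_iff.1
    ((sub_pos.2 hz').trans_le (sub_one_le_norm_sub_circleMap _ θ))
  have he : ∀ θ, (z / R - circleMap 0 1 θ)⁻¹ = R * (z - circleMap 0 R θ)⁻¹ := by
    intro θ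
    have : z - circleMap 0 R θ = R * (z / R - circleMap 0 1 θ) := by
      rw [circleMap_eq_mul R]
      field_simp
    rw [this, mul_inv]
    field_simp
  have hc : Continuous fun θ => (z / R - circleMap 0 1 θ)⁻¹ :=
    (continuous_const.sub (continuous_circleMap 0 1)).inv₀ hd
  have hc1 : Continuous fun θ => ((-(R / Real.pi) * γ θ : ℝ) : ℂ) * (z - circleMap 0 R θ)⁻¹ := by
    have : (fun θ => ((-(R / Real.pi) * γ θ : ℝ) : ℂ) * (z - circleMap 0 R θ)⁻¹) =
        fun θ => ((-(1 / Real.pi) * γ θ : ℝ) : ℂ) * (z / R - circleMap 0 1 θ)⁻¹ := by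
      ext θ
      rw [he θ]
      push_cast
      ring
    rw [this]
    exact (Complex.continuous_ofReal.comp (continuous_const.mul hγ)).mul hc
  set m := ∫ θ in (0 : ℝ)..2 * Real.pi, γ θ with hm
  have hsplit : ∀ θ, layerDensity γ θ * (z / R - circleMap 0 1 θ)⁻¹ =
      ((-(R / Real.pi) * γ θ : ℝ) : ℂ) * (z - circleMap 0 R θ)⁻¹ +
        (m / (4 * Real.pi ^ 2) : ℂ) * (z / R - circleMap 0 1 θ)⁻¹ := by
    intro θ
    rw [layerDensity, ← hm, he θ]
    push_cast
    ring
  have hc2 : Continuous fun θ => (m / (4 * Real.pi ^ 2) : ℂ) * (z / R - circleMap 0 1 θ)⁻¹ :=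
    continuous_const.mul hc
  rw [circleCauchy]
  simp_rw [hsplit]
  have h1 := integral_sub_circleMap_inv_pow (z := z / R) (r := 1) (by rwa [abs_one]) 1
  simp only [pow_one] at h1
  rw [intervalIntegral.integral_add (hc1.intervalIntegrable _ _) (hc2.intervalIntegrable _ _),
    intervalIntegral.integral_const_mul, h1]
  congr 1
  push_cast
  field_simp
  ring

lemma hasFDerivAt_singleLayer {g : Plane → ℝ} (hR : 0 < R)
    (hγ : Continuous fun θ => g (circlePoint R θ)) {x : Plane} (hx : R < ‖x‖) :
    HasFDerivAt (singleLayer R g) (reMulPlane (circleCauchy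
      (layerDensity fun θ => g (circlePoint R θ)) (planeToComplex x / R))) x := by
  set γ := fun θ => g (circlePoint R θ) with hγdef
  set m := ∫ θ in (0 : ℝ)..2 * Real.pi, γ θ with hm
  have hz : R < ‖planeToComplex x‖ := by rwa [planeToComplex.norm_map]
  obtain ⟨M, hM⟩ : ∃ M, ∀ θ ∈ Icc 0 (2 * Real.pi), ‖-(R / Real.pi) * γ θ‖ ≤ M :=
    isCompact_Icc.exists_bound_of_continuousOn (continuous_const.mul hγ).continuousOn
  have hdist : ∀ (z : ℂ) (θ : ℝ), ‖z‖ - R ≤ ‖z - circleMap 0 R θ‖ := by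
    intro z θ
    have := norm_sub_norm_le z (circleMap 0 R θ)
    rwa [norm_circleMap_zero, abs_of_pos hR] at this
  have h1 := hasFDerivAt_log_potential_of_le (μ := volume.restrict (Ioc 0 (2 * Real.pi)))
    (h := fun θ => -(R / Real.pi) * γ θ) (p := circleMap 0 R) (z₀ := planeToComplex x) (M := M)
    (B := R) (δ := ‖planeToComplex x‖ - R) (continuous_const.mul hγ).aestronglyMeasurable
    ((ae_restrict_mem measurableSet_Ioc).mono fun θ hθ => hM θ ⟨hθ.1.le, hθ.2⟩)
    (continuous_circleMap 0 R).measurable.aemeasurable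
    (.of_forall fun θ => by rw [norm_circleMap_zero, abs_of_pos hR])
    (sub_pos.2 hz) (.of_forall fun θ => hdist _ θ)
  have h2 := (hasFDerivAt_log_norm (norm_pos_iff.1 (hR.trans hz))).const_mul
    (R * m / (2 * Real.pi))
  have h3 := (h1.add h2).add_const (R * m * (1 / (4 * Real.pi) - Real.log R / (2 * Real.pi)))
  simp only [← intervalIntegral.integral_of_le Real.two_pi_pos.le] at h3
  have hlin : ∀ (r : ℝ) (w : ℂ), r • reMul w = reMul ((r : ℂ) * w) := by
    intro r w
    rw [← map_smul, Complex.real_smul]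
  rw [hlin, ← map_add, ← circleCauchy_layerDensity hR hγ hz] at h3
  have h4 := h3.comp x (planeToComplex.toContinuousLinearEquiv : Plane →L[ℝ] ℂ).hasFDerivAt
  refine HasFDerivAt.congr_of_eventuallyEq h4 ?_
  filter_upwards [(isOpen_lt continuous_const continuous_norm).mem_nhds hx] with y hy
  have hy' : R < ‖y‖ := hy
  rw [singleLayer]
  have hpos : ∀ θ, 0 < ‖planeToComplex y - circleMap 0 R θ‖ := fun θ =>
    (sub_pos.2 (by rwa [planeToComplex.norm_map])).trans_le (hdist _ θ)
  have hc1 : Continuous fun θ => -(R / Real.pi) * γ θ *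
      Real.log ‖planeToComplex y - circleMap 0 R θ‖ :=
    (continuous_const.mul hγ).mul ((continuous_const.sub
      (continuous_circleMap 0 R)).norm.log fun θ => (hpos θ).ne')
  set κ := R * (1 / (2 * Real.pi) * (Real.log ‖y‖ - Real.log R) + 1 / (4 * Real.pi)) with hκ
  have hc2 : Continuous fun θ => κ * γ θ := continuous_const.mul hγ
  have e : ∀ θ, g (circlePoint R θ) * greenN R y (circlePoint R θ) * R =
      -(R / Real.pi) * γ θ * Real.log ‖planeToComplex y - circleMap 0 R θ‖ + κ * γ θ := by
    intro θ
    rw [greenN_circlePoint hR hy']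
    simp only [hγdef, hκ]
    ring
  simp_rw [e]
  rw [intervalIntegral.integral_add (hc1.intervalIntegrable _ _) (hc2.intervalIntegrable _ _),
    intervalIntegral.integral_const_mul, ← hm]
  have hn : ‖planeToComplex y‖ = ‖y‖ := planeToComplex.norm_map y
  simp only [Function.comp, Pi.add_apply, hn]
  rw [hκ]
  ring

lemma intervalIntegrable_singleLayer {g : Plane → ℝ} (hR : 0 < R)
    (hγ : Continuous fun θ => g (circlePoint R θ)) {x : Plane} (hx : R < ‖x‖) :
    IntervalIntegrable (fun θ => g (circlePoint R θ) * greenN R x (circlePoint R θ) * R)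
      volume 0 (2 * Real.pi) := by
  refine Continuous.intervalIntegrable ?_ _ _
  simp_rw [greenN_circlePoint hR hx]
  refine (hγ.mul ((continuous_const.mul ((continuous_const.sub
    (continuous_circleMap 0 R)).norm.log fun θ => ?_)).add continuous_const)).mul continuous_const
  have := norm_sub_norm_le (planeToComplex x) (circleMap 0 R θ)
  rw [norm_circleMap_zero, abs_of_pos hR, planeToComplex.norm_map] at this
  exact (show 0 < ‖planeToComplex x - circleMap 0 R θ‖ by linarith).ne'

end SingleLayer

/-! ### Regularity of functions on the circle. -/

section CircleFunctions

variable {α : ℝ≥0} {R : ℝ} {g : Plane → ℝ}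

lemma hasDerivAt_comp_circlePoint (hR : 0 < R) (hg : IsC1HolderOnCircle α R g) (θ : ℝ) :
    HasDerivAt (fun θ => g (circlePoint R θ)) (R * tangentialDeriv R g (circlePoint R θ)) θ := by
  have h1 : HasDerivAt (fun s : ℝ => g (rotate (s / R) (circlePoint R θ)))
      (tangentialDeriv R g (circlePoint R θ)) (R * (θ - θ)) := by
    rw [sub_self, mul_zero]
    exact (hg.1 _ (circlePoint_mem_sphere hR.le θ)).hasDerivAt
  have h2 : HasDerivAt (fun φ : ℝ => R * (φ - θ)) R θ := by
    simpa using ((hasDerivAt_id θ).sub_const θ).const_mul R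
  have h3 := h1.comp θ h2
  have e : ((fun s : ℝ => g (rotate (s / R) (circlePoint R θ))) ∘ fun φ : ℝ => R * (φ - θ)) =
      fun φ => g (circlePoint R φ) := by
    ext φ
    simp only [Function.comp]
    rw [rotate_circlePoint, mul_div_cancel_left₀ _ hR.ne', add_sub_cancel]
  rw [e, mul_comm] at h3
  exact h3

lemma continuous_comp_circlePoint (hR : 0 < R) (hg : IsC1HolderOnCircle α R g) :
    Continuous fun θ => g (circlePoint R θ) :=
  continuous_iff_continuousAt.2 fun θ => (hasDerivAt_comp_circlePoint hR hg θ).continuousAt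

lemma continuous_of_holderOn_sphere (hα : 0 < α) (hR : 0 < R) {f : Plane → ℝ}
    (hf : holderOn α (sphere (0 : Plane) R) f ≠ ∞) : Continuous fun θ => f (circlePoint R θ) := by
  have h1 : Continuous ((sphere (0 : Plane) R).domRestrict f) :=
    (eHolderNorm_ne_top.1 hf).holderWith.continuous hα
  exact h1.comp ((continuous_circlePoint R).subtype_mk fun θ => circlePoint_mem_sphere hR.le θ)

lemma supOn_sphere_ne_top {f : Plane → ℝ} (hf : Continuous fun θ => f (circlePoint R θ)) :
    supOn (sphere (0 : Plane) R) f ≠ ∞ := by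
  obtain ⟨B, hB⟩ := (isCompact_Icc (a := -Real.pi) (b := Real.pi)).exists_bound_of_continuousOn
    hf.continuousOn
  refine ne_top_of_le_ne_top ENNReal.ofReal_ne_top (supOn_le (A := B) fun y hy => ?_)
  rw [eq_circlePoint_arg hy]
  exact hB _ ⟨(Complex.neg_pi_lt_arg _).le, Complex.arg_le_pi _⟩

/-- Angles within π of each other are what the lower bound on chords requires. -/
lemma exists_circlePoint_eq {y : Plane} (hy : y ∈ sphere (0 : Plane) R) (θ : ℝ) :
    ∃ φ, |φ - θ| ≤ Real.pi ∧ y = circlePoint R φ := by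
  refine ⟨toIocMod Real.two_pi_pos (θ - Real.pi) (planeToComplex y).arg, ?_, ?_⟩
  · have := toIocMod_mem_Ioc Real.two_pi_pos (θ - Real.pi) (planeToComplex y).arg
    rw [abs_le]
    constructor <;> linarith [this.1, this.2]
  · apply planeToComplex.injective
    rw [planeToComplex_circlePoint, toIocMod, (periodic_circleMap 0 R).sub_zsmul_eq,
      ← planeToComplex_circlePoint, ← eq_circlePoint_arg hy]

/-- A bounded derivative makes g Lipschitz in arc length. Arcs are at most π/2 times chords, and
chords are at most 2R, so Lipschitz implies Hölder. The finiteness lets the seminorm of g be treated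
as a real number. -/
lemma holderOn_sphere_ne_top (hα1 : α < 1) (hR : 0 < R) (hg : IsC1HolderOnCircle α R g)
    (hα : 0 < α) : holderOn α (sphere (0 : Plane) R) g ≠ ∞ := by
  have hM := supOn_sphere_ne_top (continuous_of_holderOn_sphere hα hR hg.2)
  set M := (supOn (sphere (0 : Plane) R) (tangentialDeriv R g)).toReal
  have hM0 : 0 ≤ M := ENNReal.toReal_nonneg
  have hα1' : (α : ℝ) < 1 := by exact_mod_cast hα1
  have hπ := Real.pi_pos
  refine ne_top_of_le_ne_top ENNReal.ofReal_ne_top (holderOn_le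
    (A := M * (Real.pi / 2) * (2 * R) ^ (1 - (α : ℝ))) (by positivity) fun x hx y hy => ?_)
  obtain ⟨φ, hφ, rfl⟩ := exists_circlePoint_eq hy (planeToComplex x).arg
  set θ := (planeToComplex x).arg
  rw [eq_circlePoint_arg hx]
  have h1 : ‖g (circlePoint R θ) - g (circlePoint R φ)‖ ≤ R * M * ‖θ - φ‖ := by
    refine (convex_univ (𝕜 := ℝ) (E := ℝ)).norm_image_sub_le_of_norm_hasDerivWithin_le
      (fun θ _ => (hasDerivAt_comp_circlePoint hR hg θ).hasDerivWithinAt) (fun θ _ => ?_)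
      (mem_univ _) (mem_univ _)
    rw [norm_mul, Real.norm_of_nonneg hR.le]
    gcongr
    exact norm_le_toReal_supOn hM (circlePoint_mem_sphere hR.le θ)
  have h2 := norm_circleMap_sub_circleMap_le hφ
  have h3 := norm_circlePoint_sub hR.le θ φ
  set r := ‖circlePoint R θ - circlePoint R φ‖
  have hr0 : 0 ≤ r := norm_nonneg _
  have h4 : r ≤ 2 * R := by
    refine (norm_sub_le _ _).trans ?_
    rw [norm_circlePoint hR.le, norm_circlePoint hR.le, two_mul]
  rw [norm_sub_rev] at h2
  have h5 : R * ‖θ - φ‖ ≤ Real.pi / 2 * r := by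
    rw [h3, Real.norm_eq_abs, abs_sub_comm]
    calc R * |φ - θ| = Real.pi / 2 * (R * (2 / Real.pi * |φ - θ|)) := by field_simp
      _ ≤ _ := by gcongr
  calc _ ≤ R * M * ‖θ - φ‖ := h1
    _ = M * (R * ‖θ - φ‖) := by ring
    _ ≤ M * (Real.pi / 2 * r) := by gcongr
    _ = M * (Real.pi / 2) * (r ^ (1 - (α : ℝ)) * r ^ (α : ℝ)) := by
      rw [← Real.rpow_add' hr0 (by simp), sub_add_cancel, Real.rpow_one]
      ring
    _ ≤ M * (Real.pi / 2) * ((2 * R) ^ (1 - (α : ℝ)) * r ^ (α : ℝ)) := by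
      have : 0 ≤ 1 - (α : ℝ) := by linarith
      gcongr
    _ = _ := by ring

lemma norm_comp_circlePoint_sub_le (hR : 0 < R) {f : Plane → ℝ}
    (hf : holderOn α (sphere (0 : Plane) R) f ≠ ∞) (θ φ : ℝ) :
    ‖f (circlePoint R θ) - f (circlePoint R φ)‖ ≤
      R ^ (α : ℝ) * (holderOn α (sphere (0 : Plane) R) f).toReal *
        ‖circleMap 0 1 θ - circleMap 0 1 φ‖ ^ (α : ℝ) := by
  refine (norm_sub_le_toReal_holderOn hf (circlePoint_mem_sphere hR.le θ)
    (circlePoint_mem_sphere hR.le φ)).trans_eq ?_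
  rw [norm_circlePoint_sub hR.le, Real.mul_rpow hR.le (norm_nonneg _)]
  ring

end CircleFunctions

/-! ### Bounds for the two densities on the circle. -/

section Density

variable {γ γ' : ℝ → ℝ} {M K α : ℝ}

lemma norm_layerDensity_le (hM : ∀ θ, ‖γ θ‖ ≤ M) (θ : ℝ) : ‖layerDensity γ θ‖ ≤ M := by
  have hM0 := (norm_nonneg _).trans (hM 0)
  have h1 : ‖∫ θ in (0 : ℝ)..2 * Real.pi, γ θ‖ ≤ M * |2 * Real.pi - 0| :=
    intervalIntegral.norm_integral_le_of_norm_le_const fun θ _ => hM θ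
  rw [sub_zero, abs_of_pos Real.two_pi_pos] at h1
  have hπ := Real.pi_pos
  have hπ2 := Real.two_le_pi
  rw [layerDensity, Complex.norm_real]
  refine (norm_add_le _ _).trans ?_
  rw [norm_mul, norm_div, norm_neg, Real.norm_of_nonneg (by positivity : 0 ≤ 1 / Real.pi),
    Real.norm_of_nonneg (by positivity : 0 ≤ 4 * Real.pi ^ 2)]
  calc _ ≤ 1 / Real.pi * M + M * (2 * Real.pi) / (4 * Real.pi ^ 2) := by
        gcongr
        exact hM θ
    -- The constant is 1/π from γ plus 1/(2π) from its integral, and 3 < 2π.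
    _ = M * (3 / (2 * Real.pi)) := by field_simp; ring
    _ ≤ M * 1 := by
        gcongr
        rw [div_le_one (by positivity)]
        linarith
    _ = M := mul_one M

lemma norm_ofReal_neg_inv_pi_mul_le {r B : ℝ} (h : ‖r‖ ≤ B) :
    ‖((-(1 / Real.pi) * r : ℝ) : ℂ)‖ ≤ B := by
  have hπ := Real.pi_pos
  have hπ2 := Real.two_le_pi
  rw [Complex.norm_real, norm_mul, norm_neg, Real.norm_of_nonneg (by positivity)]
  have : 1 / Real.pi ≤ 1 := by rw [div_le_one hπ]; linarith
  nlinarith [norm_nonneg r]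

lemma norm_layerDensity_sub_le
    (hK : ∀ θ φ, ‖γ θ - γ φ‖ ≤ K * ‖circleMap 0 1 θ - circleMap 0 1 φ‖ ^ α) (θ φ : ℝ) :
    ‖layerDensity γ θ - layerDensity γ φ‖ ≤ K * ‖circleMap 0 1 θ - circleMap 0 1 φ‖ ^ α := by
  have : layerDensity γ θ - layerDensity γ φ = ((-(1 / Real.pi) * (γ θ - γ φ) : ℝ) : ℂ) := by
    rw [layerDensity, layerDensity]
    push_cast
    ring
  rw [this]
  exact norm_ofReal_neg_inv_pi_mul_le (hK θ φ)

lemma hasDerivAt_layerDensity (hγ : ∀ θ, HasDerivAt γ (γ' θ) θ) (θ : ℝ) :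
    HasDerivAt (layerDensity γ) ((-(1 / Real.pi) * γ' θ : ℝ) : ℂ) θ :=
  (((hγ θ).const_mul _).add_const _).ofReal_comp

lemma norm_circleMap_inv_sub_inv (θ φ : ℝ) :
    ‖(circleMap 0 1 θ)⁻¹ - (circleMap 0 1 φ)⁻¹‖ = ‖circleMap 0 1 θ - circleMap 0 1 φ‖ := by
  rw [inv_sub_inv (circleMap_ne_center one_ne_zero) (circleMap_ne_center one_ne_zero), norm_div,
    norm_mul, norm_circleMap_zero, norm_circleMap_zero, abs_one, mul_one, div_one, norm_sub_rev]

/-- The density whose Cauchy transform is the derivative of the Cauchy transform of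
`layerDensity γ`, up to a factor. -/
noncomputable def layerDensity' (γ γ' : ℝ → ℝ) (θ : ℝ) : ℂ :=
  (((-(1 / Real.pi) * γ' θ : ℝ) : ℂ) - Complex.I * layerDensity γ θ) * (circleMap 0 1 θ)⁻¹

variable {M' K' : ℝ}

lemma norm_layerDensity'_aux_le (hM : ∀ θ, ‖γ θ‖ ≤ M) (hM' : ∀ θ, ‖γ' θ‖ ≤ M') (θ : ℝ) :
    ‖((-(1 / Real.pi) * γ' θ : ℝ) : ℂ) - Complex.I * layerDensity γ θ‖ ≤ M' + M := by
  refine (norm_sub_le _ _).trans (add_le_add (norm_ofReal_neg_inv_pi_mul_le (hM' θ)) ?_)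
  rw [norm_mul, Complex.norm_I, one_mul]
  exact norm_layerDensity_le hM θ

lemma norm_layerDensity'_le (hM : ∀ θ, ‖γ θ‖ ≤ M) (hM' : ∀ θ, ‖γ' θ‖ ≤ M') (θ : ℝ) :
    ‖layerDensity' γ γ' θ‖ ≤ M' + M := by
  rw [layerDensity', norm_mul, norm_inv, norm_circleMap_zero, abs_one, inv_one, mul_one]
  exact norm_layerDensity'_aux_le hM hM' θ

lemma norm_layerDensity'_sub_le (hα₀ : 0 ≤ α) (hα₁ : α ≤ 1) (hM : ∀ θ, ‖γ θ‖ ≤ M)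
    (hM' : ∀ θ, ‖γ' θ‖ ≤ M')
    (hK : ∀ θ φ, ‖γ θ - γ φ‖ ≤ K * ‖circleMap 0 1 θ - circleMap 0 1 φ‖ ^ α)
    (hK' : ∀ θ φ, ‖γ' θ - γ' φ‖ ≤ K' * ‖circleMap 0 1 θ - circleMap 0 1 φ‖ ^ α) (θ φ : ℝ) :
    ‖layerDensity' γ γ' θ - layerDensity' γ γ' φ‖ ≤
      (K' + K + 2 * (M' + M)) * ‖circleMap 0 1 θ - circleMap 0 1 φ‖ ^ α := by
  have hMM : 0 ≤ M' + M := (norm_nonneg _).trans (norm_layerDensity'_aux_le hM hM' 0)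
  set t := ‖circleMap 0 1 θ - circleMap 0 1 φ‖ with ht
  have ht2 : t ≤ 2 := by
    refine (norm_sub_le _ _).trans ?_
    rw [norm_circleMap_zero, norm_circleMap_zero, abs_one]
    norm_num
  -- The factor e^(-iθ) is an isometry for chords; since chords are at most 2, it is also α-Hölder
  -- with constant 2.
  have htα : t ≤ 2 * t ^ α := by
    have := min_le_mul_rpow (norm_nonneg (circleMap 0 1 θ - circleMap 0 1 φ)) hα₀ hα₁
    rwa [← ht, min_eq_left ht2] at this
  have e : layerDensity' γ γ' θ - layerDensity' γ γ' φ =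
      (((-(1 / Real.pi) * (γ' θ - γ' φ) : ℝ) : ℂ) -
        Complex.I * (layerDensity γ θ - layerDensity γ φ)) * (circleMap 0 1 θ)⁻¹ +
      (((-(1 / Real.pi) * γ' φ : ℝ) : ℂ) - Complex.I * layerDensity γ φ) *
        ((circleMap 0 1 θ)⁻¹ - (circleMap 0 1 φ)⁻¹) := by
    rw [layerDensity', layerDensity']
    push_cast
    ring
  rw [e]
  refine (norm_add_le _ _).trans ?_
  rw [norm_mul, norm_mul, norm_circleMap_inv_sub_inv, norm_inv, norm_circleMap_zero, abs_one,
    inv_one, mul_one, ← ht, add_mul, add_mul]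
  refine add_le_add ((norm_sub_le _ _).trans (add_le_add
    (norm_ofReal_neg_inv_pi_mul_le (hK' θ φ)) ?_)) ?_
  · rw [norm_mul, Complex.norm_I, one_mul]
    exact norm_layerDensity_sub_le hK θ φ
  · calc _ ≤ (M' + M) * (2 * t ^ α) := by
          gcongr
          exact norm_layerDensity'_aux_le hM hM' φ
      _ = _ := by ring

end Density

/-- Estimates for the single-layer potential. -/
theorem exists_singleLayer_estimates (α : ℝ≥0) (hα0 : 0 < α) (hα1 : α < 1) :
    ∃ C : ℝ, 0 < C ∧ ∀ R s : ℝ, 0 < R → ∀ g : Plane → ℝ, IsC1HolderOnCircle α R g →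
      ContDiffOn ℝ 2 (singleLayer R g) (annulus R s) ∧
      supOn (annulus R s) (grad (singleLayer R g)) ≤
        ENNReal.ofReal C * (supOn (sphere 0 R) g
          + ENNReal.ofReal (R ^ (α : ℝ)) * holderOn α (sphere 0 R) g) ∧
      holderOn α (annulus R s) (grad (singleLayer R g)) ≤
        ENNReal.ofReal C * (ENNReal.ofReal (R ^ (-(α : ℝ))) * supOn (sphere 0 R) g
          + holderOn α (sphere 0 R) g) ∧
      supOn (annulus R s) (hess (singleLayer R g)) ≤
        ENNReal.ofReal C * (ENNReal.ofReal R⁻¹ * supOn (sphere 0 R) g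
          + ENNReal.ofReal (R ^ ((α : ℝ) - 1)) * holderOn α (sphere 0 R) g
          + supOn (sphere 0 R) (tangentialDeriv R g)
          + ENNReal.ofReal (R ^ (α : ℝ)) * holderOn α (sphere 0 R) (tangentialDeriv R g)) ∧
      holderOn α (annulus R s) (hess (singleLayer R g)) ≤
        ENNReal.ofReal C * (ENNReal.ofReal (R ^ (-1 - (α : ℝ))) * supOn (sphere 0 R) g
          + ENNReal.ofReal R⁻¹ * holderOn α (sphere 0 R) g
          + ENNReal.ofReal (R ^ (-(α : ℝ))) * supOn (sphere 0 R) (tangentialDeriv R g)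
          + holderOn α (sphere 0 R) (tangentialDeriv R g)) := by
  have hα0' : (0 : ℝ) < α := hα0
  have hα1' : (α : ℝ) < 1 := hα1
  obtain ⟨C, hC, hCb⟩ := exists_circleCauchy_bound hα0' hα1'
  -- The factor 3 comes from the density of the second derivative: its sup bound and its Hölder
  -- bound together contain R M' + M three times.
  refine ⟨3 * C, by positivity, fun R s hR g hg => ?_⟩
  have hγ := continuous_comp_circlePoint hR hg
  have hτ := continuous_of_holderOn_sphere hα0 hR hg.2
  have hMt := supOn_sphere_ne_top hγ
  have hM't := supOn_sphere_ne_top hτ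
  have hKt := holderOn_sphere_ne_top hα1 hR hg hα0
  have hK't := hg.2
  obtain ⟨M, hM⟩ : ∃ M, M = (supOn (sphere (0 : Plane) R) g).toReal := ⟨_, rfl⟩
  obtain ⟨M', hM'⟩ : ∃ M, M = (supOn (sphere (0 : Plane) R) (tangentialDeriv R g)).toReal :=
    ⟨_, rfl⟩
  obtain ⟨K, hK⟩ : ∃ K, K = (holderOn α (sphere (0 : Plane) R) g).toReal := ⟨_, rfl⟩
  obtain ⟨K', hK'⟩ : ∃ K, K = (holderOn α (sphere (0 : Plane) R) (tangentialDeriv R g)).toReal :=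
    ⟨_, rfl⟩
  have hM0 : 0 ≤ M := hM ▸ ENNReal.toReal_nonneg
  have hM'0 : 0 ≤ M' := hM' ▸ ENNReal.toReal_nonneg
  have hK0 : 0 ≤ K := hK ▸ ENNReal.toReal_nonneg
  have hK'0 : 0 ≤ K' := hK' ▸ ENNReal.toReal_nonneg
  -- All four quantities are finite, so the claims become inequalities between real numbers.
  rw [← ENNReal.ofReal_toReal hMt, ← ENNReal.ofReal_toReal hM't, ← ENNReal.ofReal_toReal hKt,
    ← ENNReal.ofReal_toReal hK't, ← hM, ← hM', ← hK, ← hK']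
  set γ := fun θ => g (circlePoint R θ) with hγdef
  set γ' := fun θ => R * tangentialDeriv R g (circlePoint R θ) with hγ'def
  have bM : ∀ θ, ‖γ θ‖ ≤ M := fun θ => by
    rw [hM]
    exact norm_le_toReal_supOn hMt (circlePoint_mem_sphere hR.le θ)
  have bM' : ∀ θ, ‖γ' θ‖ ≤ R * M' := fun θ => by
    rw [hM', norm_mul, Real.norm_of_nonneg hR.le]
    gcongr
    exact norm_le_toReal_supOn hM't (circlePoint_mem_sphere hR.le θ)
  have bK : ∀ θ φ, ‖γ θ - γ φ‖ ≤
      R ^ (α : ℝ) * K * ‖circleMap 0 1 θ - circleMap 0 1 φ‖ ^ (α : ℝ) := fun θ φ => by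
    rw [hK]
    exact norm_comp_circlePoint_sub_le hR hKt θ φ
  have bK' : ∀ θ φ, ‖γ' θ - γ' φ‖ ≤
      R * (R ^ (α : ℝ) * K') * ‖circleMap 0 1 θ - circleMap 0 1 φ‖ ^ (α : ℝ) := fun θ φ => by
    rw [hK', ← mul_sub, norm_mul, Real.norm_of_nonneg hR.le, mul_assoc]
    gcongr
    exact norm_comp_circlePoint_sub_le hR hK't θ φ
  have hd := hasDerivAt_layerDensity (γ := γ) (γ' := γ') (hasDerivAt_comp_circlePoint hR hg)
  have hkc : Continuous (layerDensity γ) :=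
    continuous_iff_continuousAt.2 fun θ => (hd θ).continuousAt
  have hk'c : Continuous fun θ => ((-(1 / Real.pi) * γ' θ : ℝ) : ℂ) :=
    Complex.continuous_ofReal.comp (continuous_const.mul (continuous_const.mul hτ))
  have hhc : Continuous (layerDensity' γ γ') :=
    (hk'c.sub (continuous_const.mul hkc)).mul
      ((continuous_circleMap 0 1).inv₀ fun θ => circleMap_ne_center one_ne_zero)
  have hper : layerDensity γ (2 * Real.pi) = layerDensity γ 0 := by
    have : circlePoint R (2 * Real.pi) = circlePoint R 0 := by simp [circlePoint]
    simp only [layerDensity, hγdef, this]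
  obtain ⟨c0, c1⟩ := hCb (layerDensity γ) M (R ^ (α : ℝ) * K) (by positivity) hkc
    (norm_layerDensity_le bM) (norm_layerDensity_sub_le bK)
  obtain ⟨c2, c3⟩ := hCb (layerDensity' γ γ') (R * M' + M)
    (R * (R ^ (α : ℝ) * K') + R ^ (α : ℝ) * K + 2 * (R * M' + M)) (by positivity) hhc
    (norm_layerDensity'_le bM bM') (norm_layerDensity'_sub_le hα0'.le hα1'.le bM bM' bK bK')
  set N := R * M' + M + (R * (R ^ (α : ℝ) * K') + R ^ (α : ℝ) * K + 2 * (R * M' + M)) with hN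
  have hN0 : 0 ≤ N := by positivity
  have hRα : 0 < R ^ (α : ℝ) := by positivity
  have hmem : ∀ x ∈ annulus R s, R < ‖planeToComplex x‖ := fun x hx => by
    rw [planeToComplex.norm_map]
    exact hx.1
  have hone : ∀ x ∈ annulus R s, 1 < ‖planeToComplex x / R‖ := fun x hx =>
    one_lt_norm_div hR (hmem x hx)
  have hRc : (R : ℂ) ≠ 0 := by exact_mod_cast hR.ne'
  have hscale : ∀ x y : Plane, ‖planeToComplex x / R - planeToComplex y / R‖ ^ (α : ℝ) =
      R ^ (-(α : ℝ)) * ‖x - y‖ ^ (α : ℝ) := fun x y => by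
    rw [← sub_div, norm_div_ofReal hR, norm_planeToComplex_sub,
      Real.div_rpow (norm_nonneg _) hR.le, Real.rpow_neg hR.le, div_eq_inv_mul]
  have hmulI : ∀ w : ℂ, ‖(R : ℂ)⁻¹ * (-Complex.I * w)‖ = R⁻¹ * ‖w‖ := fun w => by
    rw [norm_mul, norm_mul, norm_inv, Complex.norm_real, Real.norm_of_nonneg hR.le, norm_neg,
      Complex.norm_I, one_mul]
  -- Passing to z/R, each Hölder constant acquires R^(-α) and the derivative acquires R⁻¹; the
  -- derivative in θ is R times the arc-length derivative.
  obtain ⟨r0, r1, r2, r3, r4⟩ := estimates_of_complex_gradient (isOpen_annulus R s) hα0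
    (u := singleLayer R g) (F := fun z => circleCauchy (layerDensity γ) (z / R))
    (G := fun z => ContinuousLinearMap.mul ℝ ℂ
      ((R : ℂ)⁻¹ * (-Complex.I * circleCauchy (layerDensity' γ γ') (z / R))))
    (A₀ := C * (M + R ^ (α : ℝ) * K)) (A₁ := C * (M + R ^ (α : ℝ) * K) * R ^ (-(α : ℝ)))
    (A₂ := R⁻¹ * (C * N)) (A₃ := R⁻¹ * (C * N) * R ^ (-(α : ℝ)))
    (fun x hx => hasFDerivAt_singleLayer hR hγ hx.1)
    (fun x hx => by
      have h1 := hasFDerivAt_circleCauchy hkc (norm_layerDensity_le bM) (hone x hx)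
      rw [integral_circle_sq_eq_circleCauchy hd hk'c hper (hone x hx)] at h1
      have h2 : HasFDerivAt (fun z : ℂ => z / R) (ContinuousLinearMap.mul ℝ ℂ (R : ℂ)⁻¹)
          (planeToComplex x) := by
        refine (ContinuousLinearMap.mul ℝ ℂ (R : ℂ)⁻¹).hasFDerivAt.congr_of_eventuallyEq
          (.of_forall fun z => ?_)
        simp [div_eq_inv_mul]
      refine (h1.comp (planeToComplex x) h2).congr_fderiv ?_
      refine ContinuousLinearMap.ext fun v => ?_
      change -Complex.I * circleCauchy (layerDensity' γ γ') (planeToComplex x / R) *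
        ((R : ℂ)⁻¹ * v) = (R : ℂ)⁻¹ * (-Complex.I *
          circleCauchy (layerDensity' γ γ') (planeToComplex x / R)) * v
      ring)
    (by positivity) (by positivity) (fun x hx => c0 _ (hone x hx))
    (fun x hx y hy => (c1 _ _ (hone x hx) (hone y hy)).trans_eq (by rw [hscale]; ring))
    (fun x hx => by
      refine (ContinuousLinearMap.opNorm_mul_apply_le ℝ ℂ _).trans ?_
      rw [hmulI]
      gcongr
      exact c2 _ (hone x hx))
    (fun x hx y hy => by
      rw [← map_sub, ← mul_sub, ← mul_sub]
      refine (ContinuousLinearMap.opNorm_mul_apply_le ℝ ℂ _).trans ?_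
      rw [hmulI]
      calc _ ≤ R⁻¹ * (C * N * ‖planeToComplex x / R - planeToComplex y / R‖ ^ (α : ℝ)) := by
            gcongr
            exact c3 _ _ (hone x hx) (hone y hy)
        _ = _ := by rw [hscale]; ring)
  have hNle : N ≤ 3 * (M + R ^ (α : ℝ) * K + R * M' + R * (R ^ (α : ℝ) * K')) := by
    have e1 : 0 ≤ R ^ (α : ℝ) * K := by positivity
    have e2 : 0 ≤ R * (R ^ (α : ℝ) * K') := by positivity
    rw [hN]
    linarith
  have hRm : R ^ (-(α : ℝ)) = (R ^ (α : ℝ))⁻¹ := Real.rpow_neg hR.le _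
  have hR1 : R ^ ((α : ℝ) - 1) = R ^ (α : ℝ) / R := Real.rpow_sub_one hR.ne' _
  have hR2 : R ^ (-1 - (α : ℝ)) = R⁻¹ * (R ^ (α : ℝ))⁻¹ := by
    rw [Real.rpow_sub hR, Real.rpow_neg_one, div_eq_mul_inv]
  refine ⟨r0, r1.trans ?_, r2.trans ?_, r3.trans ?_, r4.trans ?_⟩
  · rw [← ENNReal.ofReal_mul (by positivity), ← ENNReal.ofReal_add (by positivity) (by positivity),
      ← ENNReal.ofReal_mul (by positivity)]
    refine ENNReal.ofReal_le_ofReal ?_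
    have : 0 ≤ C * (M + R ^ (α : ℝ) * K) := by positivity
    linarith
  · rw [← ENNReal.ofReal_mul (by positivity), ← ENNReal.ofReal_add (by positivity) (by positivity),
      ← ENNReal.ofReal_mul (by positivity)]
    refine ENNReal.ofReal_le_ofReal ?_
    have : 0 ≤ C * (R ^ (-(α : ℝ)) * M + K) := by positivity
    have e : C * (M + R ^ (α : ℝ) * K) * R ^ (-(α : ℝ)) = C * (R ^ (-(α : ℝ)) * M + K) := by
      rw [hRm]; field_simp
    linarith
  · rw [← ENNReal.ofReal_mul (by positivity), ← ENNReal.ofReal_mul (by positivity),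
      ← ENNReal.ofReal_mul (by positivity), ← ENNReal.ofReal_add (by positivity) (by positivity),
      ← ENNReal.ofReal_add (by positivity) (by positivity),
      ← ENNReal.ofReal_add (by positivity) (by positivity), ← ENNReal.ofReal_mul (by positivity)]
    refine ENNReal.ofReal_le_ofReal ?_
    calc R⁻¹ * (C * N)
        ≤ R⁻¹ * (C * (3 * (M + R ^ (α : ℝ) * K + R * M' + R * (R ^ (α : ℝ) * K')))) := by gcongr
      _ = _ := by rw [hR1]; field_simp
  · rw [← ENNReal.ofReal_mul (by positivity), ← ENNReal.ofReal_mul (by positivity),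
      ← ENNReal.ofReal_mul (by positivity), ← ENNReal.ofReal_add (by positivity) (by positivity),
      ← ENNReal.ofReal_add (by positivity) (by positivity),
      ← ENNReal.ofReal_add (by positivity) (by positivity), ← ENNReal.ofReal_mul (by positivity)]
    refine ENNReal.ofReal_le_ofReal ?_
    calc R⁻¹ * (C * N) * R ^ (-(α : ℝ))
        ≤ R⁻¹ * (C * (3 * (M + R ^ (α : ℝ) * K + R * M' + R * (R ^ (α : ℝ) * K')))) *
          R ^ (-(α : ℝ)) := by gcongr
      _ = _ := by rw [hR2, hRm]; field_simp

/-! ### Integrals of powers of the distance, and the Cauchy transform of a disc. -/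

lemma indicator_ball_rpow (z : ℂ) (ρ s : ℝ) :
    (ball z ρ).indicator (fun w => ‖z - w‖ ^ s) =
      fun w => (Iio ρ).indicator (fun t : ℝ => t ^ s) ‖z - w‖ := by
  ext w
  have : w ∈ ball z ρ ↔ ‖z - w‖ ∈ Iio ρ := by
    rw [mem_ball, dist_eq_norm, norm_sub_rev, mem_Iio]
  by_cases h : w ∈ ball z ρ
  · rw [indicator_of_mem h, indicator_of_mem (this.1 h)]
  · rw [indicator_of_notMem h, indicator_of_notMem (this.not.1 h)]

lemma indicator_compl_ball_rpow (z : ℂ) (ρ s : ℝ) :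
    (ball z ρ)ᶜ.indicator (fun w => ‖z - w‖ ^ s) =
      fun w => (Ici ρ).indicator (fun t : ℝ => t ^ s) ‖z - w‖ := by
  ext w
  have : w ∈ (ball z ρ)ᶜ ↔ ‖z - w‖ ∈ Ici ρ := by
    rw [mem_compl_iff, mem_ball, dist_eq_norm, norm_sub_rev, mem_Ici, not_lt]
  by_cases h : w ∈ (ball z ρ)ᶜ
  · rw [indicator_of_mem h, indicator_of_mem (this.1 h)]
  · rw [indicator_of_notMem h, indicator_of_notMem (this.not.1 h)]

lemma integral_complex_norm (f : ℝ → ℝ) :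
    ∫ w : ℂ, f ‖w‖ = 2 * Real.pi * ∫ y in Ioi (0 : ℝ), y * f y := by
  rw [integral_fun_norm_addHaar, Complex.finrank_real_complex]
  have : volume.real (ball (0 : ℂ) 1) = Real.pi := by
    simp [Measure.real, Complex.volume_ball]
  rw [this]
  simp only [nsmul_eq_mul, smul_eq_mul, Nat.add_one_sub_one, pow_one]
  push_cast
  ring

lemma mul_indicator_rpow {I : Set ℝ} {s : ℝ} {y : ℝ} (hy : y ∈ Ioi (0 : ℝ)) :
    y * I.indicator (fun t : ℝ => t ^ s) y = I.indicator (fun t : ℝ => t ^ (1 + s)) y := by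
  by_cases h : y ∈ I
  · rw [indicator_of_mem h, indicator_of_mem h, Real.rpow_add hy, Real.rpow_one]
  · rw [indicator_of_notMem h, indicator_of_notMem h, mul_zero]

lemma integrable_complex_norm_indicator {I : Set ℝ} (hI : MeasurableSet I) {s : ℝ}
    (h : IntegrableOn (fun t : ℝ => t ^ (1 + s)) (Ioi 0 ∩ I)) :
    Integrable (fun w : ℂ => I.indicator (fun t : ℝ => t ^ s) ‖w‖) := by
  rw [integrable_fun_norm_addHaar, Complex.finrank_real_complex]
  have h1 : IntegrableOn (I.indicator fun t : ℝ => t ^ (1 + s)) (Ioi 0) := by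
    rwa [integrableOn_indicator_iff hI, inter_comm]
  refine h1.congr_fun (fun y hy => ?_) measurableSet_Ioi
  simp only [Nat.add_one_sub_one, pow_one, smul_eq_mul]
  exact (mul_indicator_rpow hy).symm

lemma integrableOn_ball_rpow {s : ℝ} (hs : s < 2) (z : ℂ) (ρ : ℝ) :
    IntegrableOn (fun w => ‖z - w‖ ^ (-s)) (ball z ρ) := by
  rw [← integrable_indicator_iff measurableSet_ball, indicator_ball_rpow]
  refine Integrable.comp_sub_left (f := fun w : ℂ => (Iio ρ).indicator (fun t : ℝ => t ^ (-s)) ‖w‖)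
    (integrable_complex_norm_indicator measurableSet_Iio ?_) z
  rw [Ioi_inter_Iio]
  exact ((intervalIntegral.intervalIntegrable_rpow' (a := 0) (b := ρ) (r := 1 + -s)
    (by linarith)).1).mono_set Ioo_subset_Ioc_self

lemma integral_ball_rpow {s : ℝ} (hs : s < 2) (z : ℂ) {ρ : ℝ} (hρ : 0 < ρ) :
    ∫ w in ball z ρ, ‖z - w‖ ^ (-s) = 2 * Real.pi * (ρ ^ (2 - s) / (2 - s)) := by
  rw [← integral_indicator measurableSet_ball, indicator_ball_rpow,
    integral_sub_left_eq_self (fun w : ℂ => (Iio ρ).indicator (fun t : ℝ => t ^ (-s)) ‖w‖),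
    integral_complex_norm]
  congr 1
  rw [setIntegral_congr_fun measurableSet_Ioi fun y hy => mul_indicator_rpow hy,
    setIntegral_indicator measurableSet_Iio, Ioi_inter_Iio, ← integral_Ioc_eq_integral_Ioo,
    ← intervalIntegral.integral_of_le hρ.le, integral_rpow (Or.inl (by linarith)),
    show 1 + -s + 1 = 2 - s by ring, Real.zero_rpow (by linarith), sub_zero]

lemma integrableOn_compl_ball_rpow {s : ℝ} (hs : 2 < s) (z : ℂ) {ρ : ℝ} (hρ : 0 < ρ) :
    IntegrableOn (fun w => ‖z - w‖ ^ (-s)) (ball z ρ)ᶜ := by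
  rw [← integrable_indicator_iff measurableSet_ball.compl, indicator_compl_ball_rpow]
  refine Integrable.comp_sub_left (f := fun w : ℂ => (Ici ρ).indicator (fun t : ℝ => t ^ (-s)) ‖w‖)
    (integrable_complex_norm_indicator measurableSet_Ici ?_) z
  refine IntegrableOn.mono_set ?_ inter_subset_right
  rw [integrableOn_Ici_iff_integrableOn_Ioi]
  exact integrableOn_Ioi_rpow_of_lt (by linarith) hρ

lemma integral_compl_ball_rpow {s : ℝ} (hs : 2 < s) (z : ℂ) {ρ : ℝ} (hρ : 0 < ρ) :
    ∫ w in (ball z ρ)ᶜ, ‖z - w‖ ^ (-s) = 2 * Real.pi * (ρ ^ (2 - s) / (s - 2)) := by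
  rw [← integral_indicator measurableSet_ball.compl, indicator_compl_ball_rpow,
    integral_sub_left_eq_self (fun w : ℂ => (Ici ρ).indicator (fun t : ℝ => t ^ (-s)) ‖w‖),
    integral_complex_norm]
  congr 1
  have : Ioi (0 : ℝ) ∩ Ici ρ = Ici ρ := inter_eq_right.2 fun x hx => hρ.trans_le hx
  rw [setIntegral_congr_fun measurableSet_Ioi fun y hy => mul_indicator_rpow hy,
    setIntegral_indicator measurableSet_Ici, this, integral_Ici_eq_integral_Ioi,
    integral_Ioi_rpow_of_lt (by linarith) hρ, show 1 + -s + 1 = 2 - s by ring]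
  rw [show s - 2 = -(2 - s) by ring, div_neg, neg_div]

lemma ball_zero_subset_ball {z : ℂ} {ρ : ℝ} (hz : z ∈ ball (0 : ℂ) ρ) :
    ball (0 : ℂ) ρ ⊆ ball z (2 * ρ) := by
  intro w hw
  rw [mem_ball] at *
  have := dist_triangle_right w z 0
  linarith

lemma integrableOn_ball_zero_rpow {s : ℝ} (hs : s < 2) {z : ℂ} {ρ : ℝ} (hz : z ∈ ball (0 : ℂ) ρ) :
    IntegrableOn (fun w => ‖z - w‖ ^ (-s)) (ball 0 ρ) :=
  (integrableOn_ball_rpow hs z (2 * ρ)).mono_set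
    (ball_zero_subset_ball hz)

/-- Enlarging the disc to one of radius 2ρ centred at z makes the integrand radial; the doubling
costs 2^(2-s) ≤ 4. -/
lemma integral_ball_zero_rpow_le {s : ℝ} (hs₀ : 0 ≤ s) (hs : s < 2) {z : ℂ} {ρ : ℝ}
    (hz : z ∈ ball (0 : ℂ) ρ) :
    ∫ w in ball (0 : ℂ) ρ, ‖z - w‖ ^ (-s) ≤ 8 * Real.pi / (2 - s) * ρ ^ (2 - s) := by
  have hρ := pos_of_mem_ball hz
  have hs2 : 0 < 2 - s := by linarith
  have hπ := Real.pi_pos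
  refine (setIntegral_mono_set (integrableOn_ball_rpow hs z (2 * ρ))
    (.of_forall fun w => by positivity) (ball_zero_subset_ball hz).eventuallyLE).trans ?_
  rw [integral_ball_rpow hs z (by positivity), Real.mul_rpow zero_le_two hρ.le]
  have h1 : (2 : ℝ) ^ (2 - s) ≤ 4 := by
    calc (2 : ℝ) ^ (2 - s) ≤ 2 ^ (2 : ℝ) :=
          Real.rpow_le_rpow_of_exponent_le one_le_two (by linarith)
      _ = 4 := by rw [Real.rpow_two]; norm_num
  calc _ ≤ 2 * Real.pi * (4 * ρ ^ (2 - s) / (2 - s)) := by gcongr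
    _ = _ := by ring

/-- A shell theorem: a uniform circle exerts no force inside. With w = e^(iθ), reversing the angle
turns the integrand into the boundary values of a function holomorphic in the disc and vanishing at
0. -/
lemma integral_sub_circleMap_inv_of_norm_lt {z : ℂ} {s : ℝ} (hz : ‖z‖ < s) :
    ∫ θ in (0 : ℝ)..2 * Real.pi, (z - circleMap 0 s θ)⁻¹ = 0 := by
  have hs : 0 < s := (norm_nonneg z).trans_lt hz
  have hsc : (s : ℂ) ≠ 0 := by exact_mod_cast hs.ne'
  set G : ℂ → ℂ := fun w => -(s : ℂ)⁻¹ * w * (1 - z / s * w)⁻¹ with hG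
  have hne : ∀ w ∈ closedBall (0 : ℂ) |1|, 1 - z / s * w ≠ 0 := by
    intro w hw h
    rw [mem_closedBall, dist_zero_right, abs_one] at hw
    have h1 : ‖z / s * w‖ < 1 := by
      rw [norm_mul, norm_div_ofReal hs]
      have : ‖z‖ / s < 1 := by rwa [div_lt_one hs]
      nlinarith [norm_nonneg w, div_nonneg (norm_nonneg z) hs.le]
    rw [← sub_eq_zero.1 h, norm_one] at h1
    exact lt_irrefl _ h1
  have h1 := integral_circleMap_eq (f := G) (r := 1) (by
    refine DifferentiableOn.diffContOnCl fun w hw => ?_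
    have h1 : DifferentiableAt ℂ (fun w : ℂ => 1 - z / s * w) w := by fun_prop
    have h2 : DifferentiableAt ℂ (fun w : ℂ => -(s : ℂ)⁻¹ * w) w := by fun_prop
    exact (h2.mul (h1.inv (hne w (closure_ball_subset_closedBall hw)))).differentiableWithinAt)
  have h2 : G 0 = 0 := by simp [hG]
  rw [h2, mul_zero] at h1
  refine Eq.trans ?_ h1
  have h3 := intervalIntegral.integral_comp_sub_left (a := 0) (b := 2 * Real.pi)
    (fun θ => (z - circleMap 0 s θ)⁻¹) (2 * Real.pi)
  rw [sub_self, sub_zero] at h3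
  rw [← h3]
  refine intervalIntegral.integral_congr fun θ _ => ?_
  have h4 : circleMap 0 1 (2 * Real.pi - θ) = (circleMap 0 1 θ)⁻¹ := by
    rw [show 2 * Real.pi - θ = -θ + 2 * Real.pi by ring, periodic_circleMap 0 1 (-θ),
      circleMap_zero, circleMap_zero, Complex.ofReal_one, one_mul, one_mul, ← Complex.exp_neg]
    push_cast
    ring_nf
  have h5 : circleMap 0 1 θ ≠ 0 := circleMap_ne_center one_ne_zero
  have h6 := hne (circleMap 0 1 θ) (by
    rw [mem_closedBall, dist_zero_right, norm_circleMap_zero])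
  simp only [hG]
  rw [circleMap_eq_mul s, h4]
  have h7 : z - s * (circleMap 0 1 θ)⁻¹ =
      -(s : ℂ) * (circleMap 0 1 θ)⁻¹ * (1 - z / s * circleMap 0 1 θ) := by
    field_simp
    ring
  rw [h7, mul_inv, mul_inv, inv_inv, inv_neg]

lemma polarCoord_symm_eq_circleMap (p : ℝ × ℝ) :
    Complex.polarCoord.symm p = circleMap 0 p.1 p.2 := by
  rw [Complex.polarCoord_symm_apply, circleMap_zero, Complex.exp_mul_I]
  push_cast
  ring

lemma integrable_polar {f : ℂ → ℂ} (hf : Measurable f) (hfi : Integrable f) :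
    IntegrableOn (fun p : ℝ × ℝ => p.1 • f (circleMap 0 p.1 p.2)) (Ioi 0 ×ˢ Ioo (-Real.pi) Real.pi) := by
  have hm : Measurable fun p : ℝ × ℝ => circleMap 0 p.1 p.2 := by
    refine Continuous.measurable ?_
    simp only [circleMap_zero]
    fun_prop
  refine ⟨(measurable_fst.smul (hf.comp hm)).aestronglyMeasurable, ?_⟩
  have h1 := Complex.lintegral_comp_polarCoord_symm (fun w => ‖f w‖ₑ)
  rw [polarCoord_target] at h1
  have h2 : ∫⁻ p in Ioi (0 : ℝ) ×ˢ Ioo (-Real.pi) Real.pi, ‖p.1 • f (circleMap 0 p.1 p.2)‖ₑ =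
      ∫⁻ w, ‖f w‖ₑ := by
    rw [← h1]
    refine setLIntegral_congr_fun (measurableSet_Ioi.prod measurableSet_Ioo) fun p hp => ?_
    rw [enorm_smul, polarCoord_symm_eq_circleMap, Real.enorm_of_nonneg (le_of_lt hp.1), smul_eq_mul]
  rw [HasFiniteIntegral, h2]
  exact hfi.2

/-- The Cauchy transform of the indicator function of a disc, inside the disc. -/
theorem integral_ball_inv {z : ℂ} {ρ : ℝ} (hz : z ∈ ball (0 : ℂ) ρ) :
    ∫ w in ball (0 : ℂ) ρ, (z - w)⁻¹ = Real.pi * (starRingEnd ℂ) z := by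
  have hzρ : ‖z‖ < ρ := by rwa [mem_ball, dist_zero_right] at hz
  set f : ℂ → ℂ := (ball (0 : ℂ) ρ).indicator fun w => (z - w)⁻¹ with hf
  have hfm : Measurable f := ((measurable_const.sub measurable_id).inv).indicator measurableSet_ball
  have hfi : Integrable f := by
    rw [hf, integrable_indicator_iff measurableSet_ball]
    refine (integrableOn_ball_zero_rpow (s := 1) one_lt_two hz).mono'
      ((measurable_const.sub measurable_id).inv).aestronglyMeasurable (.of_forall fun w => ?_)
    rw [norm_inv, Real.rpow_neg_one]
  rw [← integral_indicator measurableSet_ball, ← hf, ← Complex.integral_comp_polarCoord_symm,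
    polarCoord_target]
  simp_rw [polarCoord_symm_eq_circleMap]
  rw [Measure.volume_eq_prod, setIntegral_prod _ (integrable_polar hfm hfi)]
  -- Circles of radius s < |z| contribute 2π s/z and larger ones contribute nothing; the radius s =
  -- |z| is discarded as a null set. Integrating in s leaves π|z|²/z, which is π times the conjugate
  -- of z.
  have hinner : ∀ᵐ s : ℝ, s ∈ Ioi (0 : ℝ) →
      ∫ θ in Ioo (-Real.pi) Real.pi, s • f (circleMap 0 s θ) =
        (Iio ‖z‖).indicator (fun s : ℝ => (s : ℂ) * (2 * Real.pi * z⁻¹)) s := by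
    filter_upwards [compl_mem_ae_iff.2 (measure_singleton ‖z‖)] with s hs hs0
    have hs0' : (0 : ℝ) < s := hs0
    have hnorm : ∀ θ, ‖circleMap 0 s θ‖ = s := fun θ => by
      rw [norm_circleMap_zero, abs_of_pos hs0']
    rw [integral_smul]
    by_cases hsρ : s < ρ
    · have h1 : ∀ θ, f (circleMap 0 s θ) = (z - circleMap 0 s θ)⁻¹ := fun θ =>
        indicator_of_mem (by rwa [mem_ball, dist_zero_right, hnorm]) _
      have h2 : ∫ θ in Ioo (-Real.pi) Real.pi, f (circleMap 0 s θ) =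
          ∫ θ in (0 : ℝ)..2 * Real.pi, (z - circleMap 0 s θ)⁻¹ := by
        rw [← integral_Ioc_eq_integral_Ioo, ← intervalIntegral.integral_of_le
          (by linarith [Real.pi_pos])]
        simp_rw [h1]
        have hp : Function.Periodic (fun θ => (z - circleMap 0 s θ)⁻¹) (2 * Real.pi) := fun θ => by
          simp only [periodic_circleMap 0 s θ]
        have := hp.intervalIntegral_add_eq (-Real.pi) 0
        rwa [zero_add, show -Real.pi + 2 * Real.pi = Real.pi by ring] at this
      rw [h2]
      rcases lt_or_gt_of_ne (show s ≠ ‖z‖ from hs) with h | h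
      · have h3 := integral_sub_circleMap_inv_pow (z := z) (r := s)
          (by rwa [abs_of_pos hs0']) 1
        simp only [pow_one] at h3
        rw [indicator_of_mem (by exact h), h3, Complex.real_smul]
      · rw [indicator_of_notMem (by rw [mem_Iio, not_lt]; exact h.le),
          integral_sub_circleMap_inv_of_norm_lt h, smul_zero]
    · have h1 : ∀ θ, f (circleMap 0 s θ) = 0 := fun θ =>
        indicator_of_notMem (by rwa [mem_ball, dist_zero_right, hnorm]) _
      simp_rw [h1]
      rw [indicator_of_notMem (by rw [mem_Iio]; intro h; exact hsρ (h.trans hzρ)), integral_zero,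
        smul_zero]
  rw [setIntegral_congr_ae measurableSet_Ioi hinner, setIntegral_indicator measurableSet_Iio,
    Ioi_inter_Iio, ← integral_Ioc_eq_integral_Ioo,
    ← intervalIntegral.integral_of_le (norm_nonneg z), intervalIntegral.integral_mul_const,
    intervalIntegral.integral_ofReal, integral_id]
  rcases eq_or_ne z 0 with rfl | h0
  · simp
  · have h1 : ((‖z‖ ^ 2 : ℝ) : ℂ) = z * (starRingEnd ℂ) z := by
      rw [Complex.mul_conj, Complex.normSq_eq_norm_sq]
    rw [show (‖z‖ ^ 2 - 0 ^ 2) / 2 = ‖z‖ ^ 2 / 2 by ring]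
    push_cast at h1 ⊢
    rw [h1]
    field_simp

/-! ### Newtonian potential estimates on a disc. -/

section Newton

variable {f : ℂ → ℝ} {ρ M K α : ℝ} {z z' : ℂ}

/-- The complex gradient of the logarithmic potential of `f` on the disc of radius `ρ`. -/
noncomputable def newtonGrad (ρ : ℝ) (f : ℂ → ℝ) (z : ℂ) : ℂ :=
  ∫ w in ball (0 : ℂ) ρ, (f w : ℂ) * (z - w)⁻¹

/-- The Beurling-type singular integral of `f` on the disc of radius `ρ`. -/
noncomputable def beurling (ρ : ℝ) (f : ℂ → ℝ) (z : ℂ) : ℂ :=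
  ∫ w in ball (0 : ℂ) ρ, ((f w - f z : ℝ) : ℂ) * ((z - w) ^ 2)⁻¹

lemma ae_ne (z : ℂ) (μ : Measure ℂ) [NullSingletonClass μ] : ∀ᵐ w ∂μ, z ≠ w := by
  filter_upwards [compl_mem_ae_iff.2 (measure_singleton (μ := μ) z)] with w hw h
  exact hw h.symm

lemma measurable_sub_inv_pow (z : ℂ) (n : ℕ) : Measurable fun w : ℂ => ((z - w) ^ n)⁻¹ := by
  fun_prop

lemma abs_log_le {t B : ℝ} (ht : 0 < t) (hB : t ≤ B) : |Real.log t| ≤ B + t ^ (-1 : ℝ) := by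
  have h1 := Real.log_le_self ht.le
  have h2 := Real.log_le_self (inv_pos.2 ht).le
  rw [Real.log_inv] at h2
  have h3 := inv_pos.2 ht
  rw [Real.rpow_neg_one, abs_le]
  constructor <;> linarith

lemma norm_sub_le_of_mem_ball (hz : z ∈ ball (0 : ℂ) ρ) (hz' : z' ∈ ball (0 : ℂ) ρ) :
    ‖z - z'‖ ≤ 2 * ρ := by
  rw [mem_ball, dist_zero_right] at hz hz'
  linarith [norm_sub_le z z']

lemma integrableOn_mul_rpow (hf : Continuous f) (hM : ∀ w, ‖f w‖ ≤ M) {s : ℝ} (hs : s < 2)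
    (hz : z ∈ ball (0 : ℂ) ρ) :
    IntegrableOn (fun w => |f w| * ‖z - w‖ ^ (-s)) (ball 0 ρ) := by
  refine (integrableOn_ball_zero_rpow hs hz).bdd_mul (c := M) hf.abs.aestronglyMeasurable
    (.of_forall fun w => ?_)
  rw [norm_abs_eq_norm]
  exact hM w

lemma integrableOn_mul_log (hf : Continuous f) (hM : ∀ w, ‖f w‖ ≤ M)
    (hz : z ∈ ball (0 : ℂ) ρ) :
    IntegrableOn (fun w => f w * Real.log ‖z - w‖) (ball 0 ρ) := by
  have h1 : IntegrableOn (fun w => Real.log ‖z - w‖) (ball 0 ρ) := by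
    have h2 : IntegrableOn (fun w => 2 * ρ + ‖z - w‖ ^ (-1 : ℝ)) (ball 0 ρ) :=
      (integrableOn_const measure_ball_lt_top.ne).add (integrableOn_ball_zero_rpow one_lt_two hz)
    refine h2.mono' (Measurable.aestronglyMeasurable ?_) ?_
    · exact (measurable_const.sub measurable_id).norm.log
    filter_upwards [ae_ne z _, ae_restrict_mem measurableSet_ball] with w hw hw'
    exact abs_log_le (norm_pos_iff.2 (sub_ne_zero.2 hw)) (norm_sub_le_of_mem_ball hz hw')
  exact h1.bdd_mul (c := M) hf.aestronglyMeasurable (.of_forall hM)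

lemma integrableOn_mul_inv (hf : Continuous f) (hM : ∀ w, ‖f w‖ ≤ M) (hz : z ∈ ball (0 : ℂ) ρ) :
    IntegrableOn (fun w => (f w : ℂ) * (z - w)⁻¹) (ball 0 ρ) := by
  refine (integrableOn_mul_rpow hf hM one_lt_two hz).mono' ?_ (.of_forall fun w => ?_)
  · exact ((Complex.continuous_ofReal.comp hf).measurable.mul
      (by simpa using measurable_sub_inv_pow z 1)).aestronglyMeasurable
  · rw [norm_mul, Complex.norm_real, norm_inv, Real.rpow_neg_one, Real.norm_eq_abs]

theorem hasFDerivAt_newton (hf : Continuous f) (hM : ∀ w, ‖f w‖ ≤ M) (hz : z ∈ ball (0 : ℂ) ρ) :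
    HasFDerivAt (fun z : ℂ => ∫ w in ball (0 : ℂ) ρ, f w * Real.log ‖z - w‖)
      (reMul (newtonGrad ρ f z)) z := by
  have hM0 : 0 ≤ M := (norm_nonneg _).trans (hM 0)
  have hev : ∀ᶠ z in nhds z, z ∈ ball (0 : ℂ) ρ := isOpen_ball.mem_nhds hz
  -- Boundedness of f suffices; β = 1/2 keeps the exponent 1 + β below 2, hence integrable.
  refine hasFDerivAt_log_potential (β := 1 / 2) (p := fun w => w)
    (C := M * (8 * Real.pi / (2 - (1 + 1 / 2)) * ρ ^ (2 - (1 + 1 / 2) : ℝ))) (by norm_num)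
    (by norm_num) (hev.mono fun z hz => integrableOn_mul_log hf hM hz)
    (integrableOn_mul_inv hf hM hz) (.of_forall fun z => ae_ne z _)
    (hev.mono fun z hz => integrableOn_mul_rpow hf hM (by norm_num) hz)
    (hev.mono fun z hz => ?_)
  calc _ ≤ ∫ w in ball (0 : ℂ) ρ, M * ‖z - w‖ ^ (-(1 + 1 / 2) : ℝ) := by
        refine integral_mono (integrableOn_mul_rpow hf hM (by norm_num) hz)
          ((integrableOn_ball_zero_rpow (by norm_num) hz).const_mul M) fun w => ?_
        simp only
        gcongr
        exact hM w
    _ ≤ _ := by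
        rw [integral_const_mul]
        gcongr
        exact integral_ball_zero_rpow_le (by norm_num) (by norm_num) hz

lemma norm_newtonGrad_le (hM : ∀ w, ‖f w‖ ≤ M) (hz : z ∈ ball (0 : ℂ) ρ) :
    ‖newtonGrad ρ f z‖ ≤ 8 * Real.pi * (ρ * M) := by
  have hM0 : 0 ≤ M := (norm_nonneg _).trans (hM 0)
  refine (norm_integral_le_of_norm_le
    ((integrableOn_ball_zero_rpow one_lt_two hz).const_mul M) (.of_forall fun w => ?_)).trans ?_
  · rw [norm_mul, Complex.norm_real, norm_inv, Real.rpow_neg_one]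
    gcongr
    exact hM w
  · rw [integral_const_mul]
    have := integral_ball_zero_rpow_le zero_le_one one_lt_two hz
    calc _ ≤ M * (8 * Real.pi / (2 - 1) * ρ ^ (2 - 1 : ℝ)) := by gcongr
      _ = _ := by
        rw [show (2 - 1 : ℝ) = 1 by norm_num, Real.rpow_one]
        ring

lemma norm_newtonGrad_sub_le (hα₀ : 0 < α) (hα₁ : α < 1) (hf : Continuous f)
    (hM : ∀ w, ‖f w‖ ≤ M) (hz : z ∈ ball (0 : ℂ) ρ) (hz' : z' ∈ ball (0 : ℂ) ρ) :
    ‖newtonGrad ρ f z - newtonGrad ρ f z'‖ ≤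
      32 * Real.pi / (1 - α) * (ρ ^ (1 - α) * M) * ‖z - z'‖ ^ α := by
  have hM0 : 0 ≤ M := (norm_nonneg _).trans (hM 0)
  have hs : 1 + α < 2 := by linarith
  rw [newtonGrad, newtonGrad, ← integral_sub (integrableOn_mul_inv hf hM hz)
    (integrableOn_mul_inv hf hM hz')]
  refine (norm_integral_le_of_norm_le
    (((integrableOn_ball_zero_rpow hs hz).add
      (integrableOn_ball_zero_rpow hs hz')).const_mul (M * (2 * ‖z - z'‖ ^ α))) ?_).trans ?_
  · filter_upwards [ae_ne z _, ae_ne z' _] with w hw hw'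
    rw [← mul_sub, norm_mul, Complex.norm_real, Pi.add_apply, mul_assoc]
    have := norm_inv_sub_inv_le (sub_ne_zero.2 hw) (sub_ne_zero.2 hw') hα₀.le hα₁.le
    rw [sub_sub_sub_cancel_right] at this
    gcongr
    exact hM w
  · rw [integral_const_mul]
    simp only [Pi.add_apply]
    rw [integral_add (integrableOn_ball_zero_rpow hs hz) (integrableOn_ball_zero_rpow hs hz')]
    have h1 := integral_ball_zero_rpow_le (by linarith) hs hz
    have h2 := integral_ball_zero_rpow_le (by linarith) hs hz'
    rw [show 2 - (1 + α) = 1 - α by ring] at h1 h2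
    calc _ ≤ M * (2 * ‖z - z'‖ ^ α) * (8 * Real.pi / (1 - α) * ρ ^ (1 - α) +
            8 * Real.pi / (1 - α) * ρ ^ (1 - α)) := by gcongr
      _ = _ := by ring

/-- Subtracting f(z) lowers the singularity from the non-integrable order 2 to 2 - α. -/
lemma norm_beurling_integrand_le (hK : ∀ w z, ‖f w - f z‖ ≤ K * ‖w - z‖ ^ α) {w : ℂ}
    (hzw : z ≠ w) :
    ‖((f w - f z : ℝ) : ℂ) * ((z - w) ^ 2)⁻¹‖ ≤ K * ‖z - w‖ ^ (-(2 - α)) := by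
  have h0 : 0 < ‖z - w‖ := norm_pos_iff.2 (sub_ne_zero.2 hzw)
  rw [norm_mul, Complex.norm_real, norm_inv, norm_pow, neg_sub, Real.rpow_sub h0, Real.rpow_two]
  have := hK w z
  rw [norm_sub_rev w z] at this
  calc _ ≤ K * ‖z - w‖ ^ α * (‖z - w‖ ^ 2)⁻¹ := by gcongr
    _ = _ := by ring

lemma integrableOn_beurling (hα₀ : 0 < α) (hf : Continuous f)
    (hK : ∀ w z, ‖f w - f z‖ ≤ K * ‖w - z‖ ^ α) {S : Set ℂ} {s : ℝ} (hS : S ⊆ ball z s) :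
    IntegrableOn (fun w => ((f w - f z : ℝ) : ℂ) * ((z - w) ^ 2)⁻¹) S := by
  refine IntegrableOn.mono_set (t := ball z s) ?_ hS
  refine ((integrableOn_ball_rpow (s := 2 - α) (by linarith) z s).const_mul K).mono' ?_ ?_
  · exact ((Complex.continuous_ofReal.comp (hf.sub continuous_const)).measurable.mul
      (measurable_sub_inv_pow z 2)).aestronglyMeasurable
  · filter_upwards [ae_ne z _] with w hw using norm_beurling_integrand_le hK hw

lemma norm_setIntegral_beurling_le (hα₀ : 0 < α) (hK0 : 0 ≤ K)
    (hK : ∀ w z, ‖f w - f z‖ ≤ K * ‖w - z‖ ^ α) {S : Set ℂ} {s : ℝ} (hs : 0 < s)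
    (hS : S ⊆ ball z s) :
    ‖∫ w in S, ((f w - f z : ℝ) : ℂ) * ((z - w) ^ 2)⁻¹‖ ≤ K * (2 * Real.pi * (s ^ α / α)) := by
  have hi := (integrableOn_ball_rpow (s := 2 - α) (by linarith) z s).const_mul K
  refine (norm_integral_le_of_norm_le (hi.mono_measure (Measure.restrict_mono hS le_rfl)) ?_).trans
    ?_
  · filter_upwards [ae_ne z _] with w hw using norm_beurling_integrand_le hK hw
  · refine (setIntegral_mono_set hi (.of_forall fun w => by positivity) hS.eventuallyLE).trans ?_
    rw [integral_const_mul, integral_ball_rpow (by linarith) z hs, sub_sub_cancel]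

lemma norm_beurling_le (hα₀ : 0 < α) (hα₁ : α < 1) (hK0 : 0 ≤ K)
    (hK : ∀ w z, ‖f w - f z‖ ≤ K * ‖w - z‖ ^ α) (hz : z ∈ ball (0 : ℂ) ρ) :
    ‖beurling ρ f z‖ ≤ 4 * Real.pi / α * (ρ ^ α * K) := by
  have hρ := pos_of_mem_ball hz
  refine (norm_setIntegral_beurling_le hα₀ hK0 hK (mul_pos two_pos hρ)
    (ball_zero_subset_ball hz)).trans ?_
  rw [Real.mul_rpow zero_le_two hρ.le]
  have h1 : (2 : ℝ) ^ α ≤ 2 := by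
    calc (2 : ℝ) ^ α ≤ 2 ^ (1 : ℝ) := Real.rpow_le_rpow_of_exponent_le one_le_two hα₁.le
      _ = 2 := Real.rpow_one 2
  have hπ := Real.pi_pos
  calc _ ≤ K * (2 * Real.pi * (2 * ρ ^ α / α)) := by gcongr
    _ = _ := by ring

/-- Bounds the Taylor remainder in `hasFDerivAt_newtonGrad`, with Hölder exponent α = 2β: half of it
becomes the gain r^β, the other half keeps the singularities at order 2 - β, which is integrable. -/
lemma sq_mul_div_le_rpow {a b r β : ℝ} (ha : 0 < a) (hb : 0 < b) (hr : 0 ≤ r) (hrab : r ≤ a + b)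
    (hβ₀ : 0 < β) (hβ₁ : β < 1) (hK0 : 0 ≤ K) :
    r ^ 2 * (K * a ^ (2 * β) / (a ^ 2 * b)) ≤
      r ^ (1 + β) * (2 * K * (a ^ (-(2 - β)) + b ^ (-(2 - β)))) := by
  -- Subadditivity distributes r^(1-β) between the two distances; the mixed products that arise are
  -- then split into single powers.
  have h1 : r ^ (1 - β) ≤ a ^ (1 - β) + b ^ (1 - β) :=
    (Real.rpow_le_rpow hr hrab (by linarith)).trans
      (Real.rpow_add_le_add_rpow ha.le hb.le (by linarith) (by linarith))
  have h2 := rpow_neg_mul_rpow_neg_le ha hb (p := 1 - β) (q := 1) (by linarith) zero_le_one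
  have h3 := rpow_neg_mul_rpow_neg_le ha hb (p := 2 - 2 * β) (q := β) (by linarith) hβ₀.le
  rw [show 1 - β + 1 = 2 - β by ring] at h2
  rw [show 2 - 2 * β + β = 2 - β by ring] at h3
  have h4 : r ^ 2 = r ^ (1 + β) * r ^ (1 - β) := by
    rw [← Real.rpow_add' hr (by norm_num), ← Real.rpow_two]
    norm_num
  have h5 : a ^ (2 * β) / (a ^ 2 * b) = a ^ (-(2 - 2 * β)) * b ^ (-1 : ℝ) := by
    rw [neg_sub, Real.rpow_sub ha, Real.rpow_two, Real.rpow_neg_one]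
    field_simp
  have h6 : a ^ (1 - β) * a ^ (-(2 - 2 * β)) = a ^ (-(1 - β)) := by
    rw [← Real.rpow_add ha]; ring_nf
  have h7 : b ^ (1 - β) * b ^ (-1 : ℝ) = b ^ (-β) := by
    rw [← Real.rpow_add hb]; ring_nf
  rw [h4, mul_div_assoc, h5]
  calc r ^ (1 + β) * r ^ (1 - β) * (K * (a ^ (-(2 - 2 * β)) * b ^ (-1 : ℝ)))
      ≤ r ^ (1 + β) * (a ^ (1 - β) + b ^ (1 - β)) *
          (K * (a ^ (-(2 - 2 * β)) * b ^ (-1 : ℝ))) := by gcongr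
    _ = r ^ (1 + β) * (K * (a ^ (1 - β) * a ^ (-(2 - 2 * β)) * b ^ (-1 : ℝ) +
          a ^ (-(2 - 2 * β)) * (b ^ (1 - β) * b ^ (-1 : ℝ)))) := by ring
    _ ≤ r ^ (1 + β) * (K * ((a ^ (-(2 - β)) + b ^ (-(2 - β))) +
          (a ^ (-(2 - β)) + b ^ (-(2 - β))))) := by
        rw [h6, h7]
        gcongr
    _ = _ := by ring

/-- The real derivative of the complex gradient of the logarithmic potential. -/
noncomputable def newtonHess (ρ : ℝ) (f : ℂ → ℝ) (z : ℂ) : ℂ →L[ℝ] ℂ :=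
  ContinuousLinearMap.mul ℝ ℂ (-beurling ρ f z) +
    (Real.pi * f z) • (Complex.conjCLE : ℂ →L[ℝ] ℂ)

/-- Write f = (f - f(z)) + f(z) with z frozen. The first density vanishes at z to Hölder order, so
the Cauchy potential can be differentiated there. The constant density has the explicit Cauchy
transform f(z) π x̄, the only part that is not complex linear. -/
theorem hasFDerivAt_newtonGrad (hα₀ : 0 < α) (hα₁ : α < 1) (hf : Continuous f)
    (hM : ∀ w, ‖f w‖ ≤ M) (hK0 : 0 ≤ K) (hK : ∀ w z, ‖f w - f z‖ ≤ K * ‖w - z‖ ^ α)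
    (hz : z ∈ ball (0 : ℂ) ρ) :
    HasFDerivAt (newtonGrad ρ f) (newtonHess ρ f z) z := by
  have hev : ∀ᶠ x in nhds z, x ∈ ball (0 : ℂ) ρ := isOpen_ball.mem_nhds hz
  set β := α / 2 with hβ
  have hs0 : 0 ≤ 2 - β := by linarith
  have hs : 2 - β < 2 := by linarith
  set f₁ : ℂ → ℝ := fun w => f w - f z with hf₁
  have hf₁c : Continuous f₁ := hf.sub continuous_const
  have hM₁ : ∀ w, ‖f₁ w‖ ≤ M + M := fun w => (norm_sub_le _ _).trans (add_le_add (hM w) (hM z))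
  have hkint : ∀ x ∈ ball (0 : ℂ) ρ, IntegrableOn
      (fun w => ‖z - w‖ ^ (-(2 - β)) + ‖x - w‖ ^ (-(2 - β))) (ball 0 ρ) := fun x hx =>
    (integrableOn_ball_zero_rpow hs hz).add (integrableOn_ball_zero_rpow hs hx)
  have h1 := hasFDerivAt_cauchy_potential (μ := volume.restrict (ball (0 : ℂ) ρ))
    (h := fun w => (f₁ w : ℂ)) (p := fun w => w) (z₀ := z) (β := β)
    (k := fun x w => 2 * K * (‖z - w‖ ^ (-(2 - β)) + ‖x - w‖ ^ (-(2 - β))))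
    (C := 2 * K * (8 * Real.pi / (2 - (2 - β)) * ρ ^ (2 - (2 - β)) +
      8 * Real.pi / (2 - (2 - β)) * ρ ^ (2 - (2 - β)))) (by positivity)
    (hev.mono fun x hx => integrableOn_mul_inv hf₁c hM₁ hx)
    (integrableOn_beurling hα₀ hf hK (ball_zero_subset_ball hz))
    (.of_forall fun x => ae_ne x _)
    (hev.mono fun x hx => (hkint x hx).const_mul (2 * K))
    (.of_forall fun x => ?_) (hev.mono fun x hx => ?_)
  · have h2 : HasFDerivAt (fun x : ℂ => (f z : ℂ) * (Real.pi * (starRingEnd ℂ) x))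
        ((Real.pi * f z) • (Complex.conjCLE : ℂ →L[ℝ] ℂ)) z := by
      have h3 := ((Real.pi * f z) • (Complex.conjCLE : ℂ →L[ℝ] ℂ)).hasFDerivAt (x := z)
      refine h3.congr_of_eventuallyEq (.of_forall fun x => ?_)
      simp
      ring
    refine (h1.add h2).congr_of_eventuallyEq ?_
    filter_upwards [hev] with x hx
    simp only [Pi.add_apply]
    have hinv : IntegrableOn (fun w => (f z : ℂ) * (x - w)⁻¹) (ball (0 : ℂ) ρ) :=
      integrableOn_mul_inv (f := fun _ => f z) continuous_const (fun _ => hM z) hx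
    rw [newtonGrad, ← integral_ball_inv hx, ← integral_const_mul,
      ← integral_add (integrableOn_mul_inv hf₁c hM₁ hx) hinv]
    congr 1
    ext w
    simp only [hf₁]
    push_cast
    ring
  · filter_upwards [ae_ne z _, ae_ne x _] with w hw hw'
    have ha : 0 < ‖z - w‖ := norm_pos_iff.2 (sub_ne_zero.2 hw)
    have hb : 0 < ‖x - w‖ := norm_pos_iff.2 (sub_ne_zero.2 hw')
    have hr : ‖x - z‖ ≤ ‖z - w‖ + ‖x - w‖ := by
      rw [norm_sub_rev z w, add_comm]
      exact norm_sub_le_norm_sub_add_norm_sub x w z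
    refine le_trans ?_ (sq_mul_div_le_rpow ha hb (norm_nonneg _) hr (by positivity)
      (by linarith) hK0)
    have := hK w z
    rw [norm_sub_rev w z] at this
    rw [show 2 * β = α by rw [hβ]; ring, Complex.norm_real]
    gcongr
  · have e1 := integral_ball_zero_rpow_le hs0 hs hz
    have e2 := integral_ball_zero_rpow_le hs0 hs hx
    rw [integral_const_mul, integral_add (integrableOn_ball_zero_rpow hs hz)
      (integrableOn_ball_zero_rpow hs hx)]
    gcongr

/-- The kernel `1 / w ^ 2` has mean zero on annuli. -/
lemma setIntegral_annulus_inv_sq (z : ℂ) (s t : ℝ) :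
    ∫ w in ball z s \ ball z t, ((z - w) ^ 2)⁻¹ = 0 := by
  set φ : ℂ → ℂ := (ball (0 : ℂ) s \ ball 0 t).indicator fun v => (v ^ 2)⁻¹ with hφ
  have hm : MeasurableSet (ball z s \ ball z t) := measurableSet_ball.diff measurableSet_ball
  have hmem : ∀ w R, w ∈ ball z R ↔ z - w ∈ ball (0 : ℂ) R := fun w R => by
    rw [mem_ball, mem_ball, dist_zero_right, dist_eq_norm, norm_sub_rev]
  have h1 : (ball z s \ ball z t).indicator (fun w => ((z - w) ^ 2)⁻¹) = fun w => φ (z - w) := by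
    ext w
    have h : w ∈ ball z s \ ball z t ↔ z - w ∈ ball (0 : ℂ) s \ ball 0 t := by
      rw [mem_sdiff, mem_sdiff, hmem, hmem]
    by_cases hw : w ∈ ball z s \ ball z t
    · rw [indicator_of_mem hw, hφ, indicator_of_mem (h.1 hw)]
    · rw [indicator_of_notMem hw, hφ, indicator_of_notMem (h.not.1 hw)]
  rw [← integral_indicator hm, h1, integral_sub_left_eq_self φ]
  -- Rotation by a right angle preserves the annulus and the measure but changes the sign of 1/v².
  have hI : Complex.I ∈ Submonoid.unitSphere ℂ := by simp [Submonoid.unitSphere]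
  have h2 := (rotation (⟨Complex.I, hI⟩ : Circle)).measurePreserving.integral_comp'
    (f := (rotation (⟨Complex.I, hI⟩ : Circle)).toHomeomorph.toMeasurableEquiv) φ
  have h3 : ∀ v, φ (Complex.I * v) = -φ v := by
    intro v
    have hmem' : ∀ R, Complex.I * v ∈ ball (0 : ℂ) R ↔ v ∈ ball (0 : ℂ) R := fun R => by
      rw [mem_ball, mem_ball, dist_zero_right, dist_zero_right, norm_mul, Complex.norm_I, one_mul]
    have h : Complex.I * v ∈ ball (0 : ℂ) s \ ball 0 t ↔ v ∈ ball (0 : ℂ) s \ ball 0 t := by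
      rw [mem_sdiff, mem_sdiff, hmem', hmem']
    by_cases hv : v ∈ ball (0 : ℂ) s \ ball 0 t
    · rw [hφ, indicator_of_mem hv, indicator_of_mem (h.2 hv), mul_pow, Complex.I_sq, neg_one_mul,
        inv_neg]
    · rw [hφ, indicator_of_notMem hv, indicator_of_notMem (h.not.2 hv), neg_zero]
  have h4 : ∫ v, φ (Complex.I * v) = ∫ v, φ v := h2
  simp_rw [h3] at h4
  rw [integral_neg] at h4
  exact self_eq_neg.1 h4.symm

/-- A bound independent of s: the annulus between radii s and ρ/4 integrates to zero, and outside it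
the kernel is at most 16/ρ² on an area of at most πρ². -/
lemma norm_setIntegral_inv_sq_le {s : ℝ} (hρ : 0 < ρ)
    (hz : z ∈ ball (0 : ℂ) (ρ / 2)) (hs₀ : 0 < s) (hs : s ≤ ρ / 4) :
    IntegrableOn (fun w => ((z - w) ^ 2)⁻¹) (ball 0 ρ \ ball z s) ∧
    ‖∫ w in ball (0 : ℂ) ρ \ ball z s, ((z - w) ^ 2)⁻¹‖ ≤ 16 * Real.pi := by
  have hsub : ball z (ρ / 4) ⊆ ball 0 ρ := by
    intro w hw
    rw [mem_ball] at *
    linarith [dist_triangle w z 0]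
  have hbound : ∀ t : ℝ, 0 < t → ∀ w ∈ (ball z t)ᶜ, ‖((z - w) ^ 2)⁻¹‖ ≤ (t ^ 2)⁻¹ := by
    intro t ht w hw
    rw [mem_compl_iff, mem_ball, dist_eq_norm, norm_sub_rev, not_lt] at hw
    rw [norm_inv, norm_pow]
    gcongr
  have hint : ∀ t : ℝ, 0 < t → IntegrableOn (fun w => ((z - w) ^ 2)⁻¹) (ball 0 ρ \ ball z t) := by
    intro t ht
    refine Measure.integrableOn_of_bounded (M := (t ^ 2)⁻¹)
      ((measure_mono sdiff_subset).trans_lt measure_ball_lt_top).ne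
      (measurable_sub_inv_pow z 2).aestronglyMeasurable ?_
    filter_upwards [ae_restrict_mem (measurableSet_ball.diff measurableSet_ball)] with w hw
    exact hbound t ht w hw.2
  refine ⟨hint s hs₀, ?_⟩
  have hu : ball (0 : ℂ) ρ \ ball z s = (ball 0 ρ \ ball z (ρ / 4)) ∪
      (ball z (ρ / 4) \ ball z s) := by
    ext w
    have h1 := @hsub w
    have h2 := @ball_subset_ball _ _ z _ _ hs w
    simp only [mem_sdiff, mem_union]
    tauto
  have hd : Disjoint (ball (0 : ℂ) ρ \ ball z (ρ / 4)) (ball z (ρ / 4) \ ball z s) :=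
    disjoint_sdiff_left.mono_right sdiff_subset
  have hi2 : IntegrableOn (fun w => ((z - w) ^ 2)⁻¹) (ball z (ρ / 4) \ ball z s) :=
    (hint s hs₀).mono_set (sdiff_subset_sdiff_left hsub)
  rw [hu, setIntegral_union hd (measurableSet_ball.diff measurableSet_ball)
    (hint _ (by positivity)) hi2, setIntegral_annulus_inv_sq, add_zero]
  refine (norm_setIntegral_le_of_norm_le_const (C := ((ρ / 4) ^ 2)⁻¹)
    ((measure_mono sdiff_subset).trans_lt measure_ball_lt_top)
    (fun w hw => hbound _ (by positivity) w hw.2)).trans ?_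
  have hv : volume.real (ball (0 : ℂ) ρ \ ball z (ρ / 4)) ≤ Real.pi * ρ ^ 2 := by
    refine (measureReal_mono sdiff_subset measure_ball_lt_top.ne).trans_eq ?_
    rw [Measure.real, Complex.volume_ball]
    simp [hρ.le, mul_comm]
  calc _ ≤ ((ρ / 4) ^ 2)⁻¹ * (Real.pi * ρ ^ 2) := by gcongr
    _ = _ := by field_simp; norm_num

/-- Far from both points their distances to w are comparable, so differencing the kernel gains one
power of decay and makes it integrable at infinity. -/
lemma norm_beurling_far_le {w : ℂ} (hα₀ : 0 < α) (hα₁ : α < 1) (hK0 : 0 ≤ K)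
    (hK : ∀ w z, ‖f w - f z‖ ≤ K * ‖w - z‖ ^ α) (hzz : 0 < ‖z - z'‖)
    (hw : 2 * ‖z - z'‖ ≤ ‖z - w‖) :
    ‖((f w - f z' : ℝ) : ℂ) * (((z - w) ^ 2)⁻¹ - ((z' - w) ^ 2)⁻¹)‖ ≤
      32 * K * ‖z - z'‖ * ‖z - w‖ ^ (-(3 - α)) := by
  set a := ‖z - w‖ with ha
  set r := ‖z - z'‖ with hr
  have ha0 : 0 < a := by linarith
  have h1 : a ≤ r + ‖z' - w‖ := norm_sub_le_norm_sub_add_norm_sub z z' w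
  have h2 : ‖z' - w‖ ≤ r + a := by
    rw [hr, norm_sub_rev z z']
    exact norm_sub_le_norm_sub_add_norm_sub z' z w
  have h3 := norm_inv_sq_sub_inv_sq_le_of_le (δ := a / 2) (a := z - w) (b := z' - w)
    (by positivity) (by linarith) (by linarith)
  rw [sub_sub_sub_cancel_right, ← hr] at h3
  have h4 := hK w z'
  rw [norm_sub_rev w z'] at h4
  have h5 : ‖z' - w‖ ^ α ≤ 2 * a ^ α := by
    calc ‖z' - w‖ ^ α ≤ (2 * a) ^ α := by gcongr; linarith
      _ = 2 ^ α * a ^ α := Real.mul_rpow zero_le_two ha0.le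
      _ ≤ 2 ^ (1 : ℝ) * a ^ α := by
        gcongr
        exact one_le_two
      _ = _ := by rw [Real.rpow_one]
  have h6 : a ^ (-(3 - α)) = a ^ α * (a ^ 3)⁻¹ := by
    rw [neg_sub, Real.rpow_sub ha0, div_eq_mul_inv]
    norm_cast
  rw [norm_mul, Complex.norm_real, h6]
  calc _ ≤ K * (2 * a ^ α) * (2 * r * ((a / 2) ^ 3)⁻¹) := by
        gcongr
        exact h4.trans (by gcongr)
    _ = _ := by field_simp; norm_num

/-- Hölder estimate for the singular integral. -/
theorem norm_beurling_sub_le (hα₀ : 0 < α) (hα₁ : α < 1) (hf : Continuous f) (hK0 : 0 ≤ K)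
    (hK : ∀ w z, ‖f w - f z‖ ≤ K * ‖w - z‖ ^ α) (hz : z ∈ ball (0 : ℂ) (ρ / 2))
    (hz' : z' ∈ ball (0 : ℂ) (ρ / 2)) :
    ‖beurling ρ f z - beurling ρ f z'‖ ≤
      (64 * Real.pi / α + 64 * Real.pi / (1 - α) + 16 * Real.pi) * K * ‖z - z'‖ ^ α := by
  have hρ : 0 < ρ := by linarith [pos_of_mem_ball hz]
  have hπ := Real.pi_pos
  have h1α : 0 < 1 - α := by linarith
  have hsub : ball (0 : ℂ) (ρ / 2) ⊆ ball 0 ρ := ball_subset_ball (by linarith)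
  set r := ‖z - z'‖ with hr
  have hr0 : 0 ≤ r := norm_nonneg _
  have hpow : ∀ n : ℝ, 1 ≤ n → ∀ t : ℝ, 0 ≤ t → (n * t) ^ α ≤ n * t ^ α := by
    intro n hn t ht
    rw [Real.mul_rpow (by linarith) ht]
    gcongr
    calc n ^ α ≤ n ^ (1 : ℝ) := Real.rpow_le_rpow_of_exponent_le hn hα₁.le
      _ = n := Real.rpow_one n
  rcases hr0.eq_or_lt with h0 | hrpos
  · have : z = z' := sub_eq_zero.1 (norm_eq_zero.1 h0.symm)
    rw [this, sub_self, norm_zero]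
    positivity
  rcases le_or_gt (ρ / 8) r with hbig | hsmall
  -- When r is comparable to ρ the sup bound is enough. Otherwise 2r ≤ ρ/4, as the cancellation
  -- estimate requires.
  · have e1 := norm_beurling_le hα₀ hα₁ hK0 hK (hsub hz)
    have e2 := norm_beurling_le hα₀ hα₁ hK0 hK (hsub hz')
    have e3 : ρ ^ α ≤ 8 * r ^ α :=
      (Real.rpow_le_rpow hρ.le (by linarith : ρ ≤ 8 * r) hα₀.le).trans (hpow 8 (by norm_num) r hr0)
    calc _ ≤ ‖beurling ρ f z‖ + ‖beurling ρ f z'‖ := norm_sub_le _ _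
      _ ≤ 4 * Real.pi / α * (8 * r ^ α * K) + 4 * Real.pi / α * (8 * r ^ α * K) := by
        refine add_le_add (e1.trans ?_) (e2.trans ?_) <;> gcongr
      _ = (64 * Real.pi / α) * K * r ^ α := by ring
      _ ≤ _ := by
        gcongr
        have : 0 ≤ 64 * Real.pi / (1 - α) := by positivity
        linarith
  set N := ball z (2 * r) with hN
  set S := ball (0 : ℂ) ρ \ N with hS
  have hNm : MeasurableSet N := measurableSet_ball
  have hSm : MeasurableSet S := measurableSet_ball.diff measurableSet_ball
  have hNρ : N ⊆ ball 0 ρ := by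
    intro w hw
    rw [hN, mem_ball] at hw
    rw [mem_ball] at *
    linarith [dist_triangle w z 0]
  have hNz' : N ⊆ ball z' (3 * r) := by
    intro w hw
    rw [hN, mem_ball] at hw
    rw [mem_ball]
    have := dist_triangle w z z'
    rw [dist_eq_norm z z', ← hr] at this
    linarith
  have hSρ : S ⊆ ball 0 ρ := sdiff_subset
  have hunion : ball (0 : ℂ) ρ = N ∪ S := (union_sdiff_cancel hNρ).symm
  have hdisj : Disjoint N S := disjoint_sdiff_right
  set A : ℂ → ℂ := fun w => ((f w - f z : ℝ) : ℂ) * ((z - w) ^ 2)⁻¹ with hA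
  set B : ℂ → ℂ := fun w => ((f w - f z' : ℝ) : ℂ) * ((z' - w) ^ 2)⁻¹ with hB
  have hAi : IntegrableOn A (ball 0 ρ) :=
    integrableOn_beurling hα₀ hf hK (ball_zero_subset_ball (hsub hz))
  have hBi : IntegrableOn B (ball 0 ρ) :=
    integrableOn_beurling hα₀ hf hK (ball_zero_subset_ball (hsub hz'))
  obtain ⟨hVi, hV⟩ := norm_setIntegral_inv_sq_le hρ hz (s := 2 * r) (by positivity) (by linarith)
  set E : ℂ → ℂ := fun w => ((f w - f z' : ℝ) : ℂ) * (((z - w) ^ 2)⁻¹ - ((z' - w) ^ 2)⁻¹) with hE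
  -- On the far part both singular integrals are given the same subtracted constant f(z'). The error
  -- is f(z') - f(z) times a pure kernel integral, which stays bounded by cancellation.
  have hEeq : ∀ w, A w - B w = E w + ((f z' - f z : ℝ) : ℂ) * ((z - w) ^ 2)⁻¹ := by
    intro w
    simp only [hA, hB, hE]
    push_cast
    ring
  have hABi : IntegrableOn (fun w => A w - B w) S := (hAi.mono_set hSρ).sub (hBi.mono_set hSρ)
  have hVi' : IntegrableOn (fun w => ((f z' - f z : ℝ) : ℂ) * ((z - w) ^ 2)⁻¹) S :=
    hVi.const_mul _
  have hEi : IntegrableOn E S := by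
    have := hABi.sub hVi'
    refine this.congr (.of_forall fun w => ?_)
    simp only [Pi.sub_apply, hEeq, add_sub_cancel_right]
  have hdecomp : beurling ρ f z - beurling ρ f z' =
      (∫ w in N, A w) - (∫ w in N, B w) + (∫ w in S, E w) +
        ((f z' - f z : ℝ) : ℂ) * ∫ w in S, ((z - w) ^ 2)⁻¹ := by
    have h1 : beurling ρ f z = (∫ w in N, A w) + ∫ w in S, A w := by
      rw [beurling, ← setIntegral_union hdisj hSm (hAi.mono_set hNρ) (hAi.mono_set hSρ), ← hunion]
    have h2 : beurling ρ f z' = (∫ w in N, B w) + ∫ w in S, B w := by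
      rw [beurling, ← setIntegral_union hdisj hSm (hBi.mono_set hNρ) (hBi.mono_set hSρ), ← hunion]
    have h3 : (∫ w in S, A w) - ∫ w in S, B w =
        (∫ w in S, E w) + ((f z' - f z : ℝ) : ℂ) * ∫ w in S, ((z - w) ^ 2)⁻¹ := by
      rw [← integral_sub (hAi.mono_set hSρ) (hBi.mono_set hSρ), ← integral_const_mul,
        ← integral_add hEi hVi']
      exact integral_congr_ae (.of_forall hEeq)
    rw [h1, h2]
    linear_combination h3
  have bA : ‖∫ w in N, A w‖ ≤ 4 * Real.pi / α * K * r ^ α := by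
    refine (norm_setIntegral_beurling_le hα₀ hK0 hK (by positivity) hN.subset).trans ?_
    calc _ ≤ K * (2 * Real.pi * (2 * r ^ α / α)) := by
          gcongr
          exact hpow 2 (by norm_num) r hr0
      _ = _ := by ring
  have bB : ‖∫ w in N, B w‖ ≤ 6 * Real.pi / α * K * r ^ α := by
    refine (norm_setIntegral_beurling_le hα₀ hK0 hK (by positivity) hNz').trans ?_
    calc _ ≤ K * (2 * Real.pi * (3 * r ^ α / α)) := by
          gcongr
          exact hpow 3 (by norm_num) r hr0
      _ = _ := by ring
  have bE : ‖∫ w in S, E w‖ ≤ 64 * Real.pi / (1 - α) * K * r ^ α := by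
    have hSc : S ⊆ Nᶜ := fun w hw => hw.2
    have hi := (integrableOn_compl_ball_rpow (s := 3 - α) (by linarith) z
      (mul_pos two_pos hrpos)).const_mul (32 * K * r)
    refine (norm_integral_le_of_norm_le (hi.mono_measure (Measure.restrict_mono hSc le_rfl))
      ?_).trans ?_
    · filter_upwards [ae_restrict_mem hSm] with w hw
      refine norm_beurling_far_le hα₀ hα₁ hK0 hK hrpos ?_
      have := hw.2
      rw [hN, mem_ball, dist_eq_norm, norm_sub_rev, not_lt] at this
      exact this
    · refine (setIntegral_mono_set hi (.of_forall fun w => by positivity)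
        hSc.eventuallyLE).trans ?_
      rw [integral_const_mul, integral_compl_ball_rpow (by linarith) z (by positivity),
        show 3 - α - 2 = 1 - α by ring, show 2 - (3 - α) = α - 1 by ring]
      have e1 : (2 * r) ^ (α - 1) ≤ r ^ α / r := by
        rw [← Real.rpow_sub_one hrpos.ne']
        exact Real.rpow_le_rpow_of_nonpos hrpos (by linarith) (by linarith)
      calc _ ≤ 32 * K * r * (2 * Real.pi * (r ^ α / r / (1 - α))) := by gcongr
        _ = _ := by field_simp; ring
  have bV : ‖((f z' - f z : ℝ) : ℂ) * ∫ w in S, ((z - w) ^ 2)⁻¹‖ ≤ 16 * Real.pi * K * r ^ α := by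
    rw [norm_mul, Complex.norm_real]
    have := hK z' z
    rw [norm_sub_rev z' z, ← hr] at this
    calc _ ≤ K * r ^ α * (16 * Real.pi) := by gcongr
      _ = _ := by ring
  rw [hdecomp]
  refine (norm_add_le _ _).trans ((add_le_add_left ((norm_add_le _ _).trans (add_le_add_left
    (norm_sub_le _ _) _)) _).trans ?_)
  have e : (64 * Real.pi / α + 64 * Real.pi / (1 - α) + 16 * Real.pi) * K * r ^ α =
      4 * Real.pi / α * K * r ^ α + 6 * Real.pi / α * K * r ^ α +
        64 * Real.pi / (1 - α) * K * r ^ α + 16 * Real.pi * K * r ^ α +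
        54 * Real.pi / α * K * r ^ α := by ring
  have e' : 0 ≤ 54 * Real.pi / α * K * r ^ α := by positivity
  linarith

lemma norm_newtonHess_le (A : ℂ) (t : ℝ) :
    ‖ContinuousLinearMap.mul ℝ ℂ A + t • (Complex.conjCLE : ℂ →L[ℝ] ℂ)‖ ≤ ‖A‖ + ‖t‖ := by
  refine (norm_add_le _ _).trans (add_le_add (ContinuousLinearMap.opNorm_mul_apply_le ℝ ℂ A) ?_)
  rw [norm_smul, Complex.conjCLE_norm, mul_one]

/-- Bounds for the first and second derivatives of the logarithmic potential. -/
theorem exists_newton_bound (hα₀ : 0 < α) (hα₁ : α < 1) :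
    ∃ C : ℝ, 0 < C ∧ ∀ (ρ M K : ℝ) (f : ℂ → ℝ), Continuous f → (∀ w, ‖f w‖ ≤ M) → 0 ≤ K →
      (∀ w z, ‖f w - f z‖ ≤ K * ‖w - z‖ ^ α) →
      (∀ z ∈ ball (0 : ℂ) (ρ / 2), ‖newtonGrad ρ f z‖ ≤ C * (ρ * M)) ∧
      (∀ z ∈ ball (0 : ℂ) (ρ / 2), ∀ w ∈ ball (0 : ℂ) (ρ / 2),
        ‖newtonGrad ρ f z - newtonGrad ρ f w‖ ≤ C * (ρ ^ (1 - α) * M) * ‖z - w‖ ^ α) ∧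
      (∀ z ∈ ball (0 : ℂ) (ρ / 2), ‖newtonHess ρ f z‖ ≤ C * (M + ρ ^ α * K)) ∧
      ∀ z ∈ ball (0 : ℂ) (ρ / 2), ∀ w ∈ ball (0 : ℂ) (ρ / 2),
        ‖newtonHess ρ f z - newtonHess ρ f w‖ ≤ C * K * ‖z - w‖ ^ α := by
  have hπ := Real.pi_pos
  have h1α : 0 < 1 - α := by linarith
  refine ⟨64 * Real.pi / α + 64 * Real.pi / (1 - α) + 32 * Real.pi, by positivity, ?_⟩
  intro ρ M K f hf hM hK0 hK
  have p1 : 0 ≤ 64 * Real.pi / α := by positivity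
  have p2 : 0 ≤ 64 * Real.pi / (1 - α) := by positivity
  have hM0 : 0 ≤ M := (norm_nonneg _).trans (hM 0)
  have hsub : ∀ z ∈ ball (0 : ℂ) (ρ / 2), 0 < ρ ∧ z ∈ ball (0 : ℂ) ρ := fun z hz => by
    have := pos_of_mem_ball hz
    exact ⟨by linarith, ball_subset_ball (by linarith) hz⟩
  refine ⟨fun z hz => ?_, fun z hz w hw => ?_, fun z hz => ?_, fun z hz w hw => ?_⟩
  · have hρ := (hsub z hz).1
    refine (norm_newtonGrad_le hM (hsub z hz).2).trans ?_
    gcongr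
    linarith
  · have hρ := (hsub z hz).1
    refine (norm_newtonGrad_sub_le hα₀ hα₁ hf hM (hsub z hz).2 (hsub w hw).2).trans ?_
    gcongr
    have : 32 * Real.pi / (1 - α) ≤ 64 * Real.pi / (1 - α) := by gcongr; norm_num
    linarith
  · have hρ := (hsub z hz).1
    have e1 := norm_beurling_le hα₀ hα₁ hK0 hK (hsub z hz).2
    have e2 : 4 * Real.pi / α ≤ 64 * Real.pi / α := by gcongr; norm_num
    refine (norm_newtonHess_le _ _).trans ?_
    rw [norm_neg, norm_mul, Real.norm_of_nonneg hπ.le, mul_add, add_comm]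
    refine add_le_add ?_ (e1.trans ?_)
    · gcongr
      · linarith
      · exact hM z
    · gcongr
      linarith
  · have e1 := norm_beurling_sub_le hα₀ hα₁ hf hK0 hK hz hw
    have e2 : newtonHess ρ f z - newtonHess ρ f w =
        ContinuousLinearMap.mul ℝ ℂ (-(beurling ρ f z - beurling ρ f w)) +
          (Real.pi * (f z - f w)) • (Complex.conjCLE : ℂ →L[ℝ] ℂ) := by
      refine ContinuousLinearMap.ext fun v => ?_
      simp [newtonHess]
      ring
    rw [e2]
    refine (norm_newtonHess_le _ _).trans ?_
    rw [norm_neg, norm_mul, Real.norm_of_nonneg hπ.le]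
    have e3 : Real.pi * ‖f z - f w‖ ≤ 16 * Real.pi * K * ‖z - w‖ ^ α := by
      calc _ ≤ Real.pi * (K * ‖z - w‖ ^ α) := by gcongr; exact hK z w
        _ = 1 * (Real.pi * (K * ‖z - w‖ ^ α)) := by ring
        _ ≤ 16 * (Real.pi * (K * ‖z - w‖ ^ α)) := by gcongr; norm_num
        _ = _ := by ring
    calc _ ≤ _ := add_le_add e1 e3
      _ = _ := by ring

end Newton

/-! ### The volume potential as a sum of three potentials. -/

/-- Inversion in the circle of radius `R`, in complex coordinates. -/
noncomputable def invMap (R : ℝ) (w : ℂ) : ℂ := (((R / ‖w‖) ^ 2 : ℝ) : ℂ) * w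

/-- The open annulus in complex coordinates. -/
def complexAnnulus (r s : ℝ) : Set ℂ := {w | r < ‖w‖ ∧ ‖w‖ < s}

lemma planeToComplex_inversion (R : ℝ) (w : ℂ) :
    planeToComplex (EuclideanGeometry.inversion 0 R (planeToComplex.symm w)) = invMap R w := by
  rw [EuclideanGeometry.inversion, vsub_eq_sub, sub_zero, vadd_eq_add, add_zero, dist_zero_right,
    map_smul, planeToComplex.apply_symm_apply, planeToComplex.symm.norm_map, Complex.real_smul,
    invMap]

lemma measurable_invMap (R : ℝ) : Measurable (invMap R) := by
  unfold invMap
  fun_prop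

lemma norm_invMap {R : ℝ} {w : ℂ} (hw : w ≠ 0) : ‖invMap R w‖ = R ^ 2 / ‖w‖ := by
  have := norm_ne_zero_iff.2 hw
  rw [invMap, norm_mul, Complex.norm_real, Real.norm_of_nonneg (by positivity)]
  field_simp

lemma isOpen_complexAnnulus (r s : ℝ) : IsOpen (complexAnnulus r s) :=
  (isOpen_lt continuous_const continuous_norm).inter (isOpen_lt continuous_norm continuous_const)

lemma volume_real_complexAnnulus {r s : ℝ} (hr : 0 ≤ r) (hrs : r < s) :
    volume.real (complexAnnulus r s) = Real.pi * (s ^ 2 - r ^ 2) := by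
  have h1 : complexAnnulus r s = ball 0 s \ closedBall 0 r := by
    ext w
    simp only [complexAnnulus, mem_ofPred_eq, mem_sdiff, mem_ball, mem_closedBall, dist_zero_right,
      not_le]
    tauto
  have h2 : closedBall (0 : ℂ) r ⊆ ball 0 s := closedBall_subset_ball hrs
  rw [h1, measureReal_sdiff h2 measurableSet_closedBall, Measure.real, Measure.real,
    Complex.volume_ball, Complex.volume_closedBall]
  simp [hr, hr.trans hrs.le]
  ring

lemma greenN_eq {R : ℝ} (hR : 0 < R) {x : Plane} (hx : R < ‖x‖) {w : ℂ} (hw : R < ‖w‖) :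
    greenN R x (planeToComplex.symm w) =
      -(1 / (2 * Real.pi)) * (Real.log ‖planeToComplex x - w‖ +
        Real.log ‖planeToComplex x - invMap R w‖) + 1 / (2 * Real.pi) * Real.log ‖x‖ +
        (-(1 / (2 * Real.pi)) * Real.log ‖w‖ + ‖w‖ ^ 2 / (4 * Real.pi * R ^ 2)) := by
  set y := planeToComplex.symm w with hy
  have hyw : planeToComplex y = w := planeToComplex.apply_symm_apply w
  have hyn : ‖y‖ = ‖w‖ := planeToComplex.symm.norm_map w
  have hw0 : 0 < ‖w‖ := hR.trans hw
  have hx0 : 0 < ‖x‖ := hR.trans hx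
  have hne : ‖x - EuclideanGeometry.inversion 0 R y‖ ≠ 0 := by
    rw [norm_ne_zero_iff, sub_ne_zero]
    intro h
    have h1 : ‖planeToComplex x‖ = ‖invMap R w‖ := by rw [h, planeToComplex_inversion]
    rw [planeToComplex.norm_map, norm_invMap (norm_pos_iff.1 hw0)] at h1
    have h2 : R ^ 2 / ‖w‖ < R := by
      rw [div_lt_iff₀ hw0]
      nlinarith
    linarith
  have e1 : ‖y - x‖ = ‖planeToComplex x - w‖ := by
    rw [← hyw, norm_planeToComplex_sub, norm_sub_rev]
  have e2 : ‖x - EuclideanGeometry.inversion 0 R y‖ = ‖planeToComplex x - invMap R w‖ := by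
    rw [← planeToComplex_inversion, norm_planeToComplex_sub]
  have hy0 : y ≠ 0 := norm_pos_iff.1 (by rwa [hyn])
  rw [greenN, fundSol, corrector, norm_sub_inversion hR.ne' (norm_pos_iff.1 hx0) hy0, hyn, e1,
    Real.log_mul (div_ne_zero hw0.ne' hx0.ne') hne, Real.log_div hw0.ne' hx0.ne', e2]
  ring

section VolumePotential

variable {R d c M : ℝ} {h : ℂ → ℝ}

/-- Since |w*| = R²/|w|, the gap is at least R - R²/(R + d/3) = R d/(3R + d). This divided by d
increases with R, and equals c/(3c + 1) at R = c d. -/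
lemma sub_invMap_ge (hR : 0 < R) (hd : 0 < d) (hc : 0 < c) (hcd : c * d ≤ R) {z w : ℂ}
    (hz : R < ‖z‖) (hw : R + d / 3 < ‖w‖) : c / (3 * c + 1) * d ≤ ‖z - invMap R w‖ := by
  have hw0 : 0 < ‖w‖ := by linarith
  have h1 := norm_sub_norm_le z (invMap R w)
  rw [norm_invMap (norm_pos_iff.1 hw0)] at h1
  have h2 : R ^ 2 / ‖w‖ ≤ R ^ 2 / (R + d / 3) := by gcongr
  have h3 : R ^ 2 / (R + d / 3) ≤ R - c / (3 * c + 1) * d := by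
    rw [div_le_iff₀ (by positivity)]
    have h4 : c / (3 * c + 1) * d * (R + d / 3) ≤ R * d / 3 := by
      rw [div_mul_eq_mul_div, div_mul_eq_mul_div, div_le_div_iff₀ (by positivity) (by norm_num)]
      nlinarith [mul_le_mul_of_nonneg_left hcd hd.le]
    nlinarith
  linarith

/-- The same separation therefore serves for the pole at 0. -/
lemma delta_le (hd : 0 < d) (hc : 0 < c) (hcd : c * d ≤ R) : c / (3 * c + 1) * d ≤ R := by
  refine le_trans ?_ hcd
  gcongr
  exact div_le_self hc.le (by linarith)

lemma complexAnnulus_subset_ball (hd : 0 < d) (hR : 0 < R) :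
    complexAnnulus (R + d / 3) (R + 2 * d / 3) ⊆ ball (0 : ℂ) (2 * (R + d)) := by
  intro w hw
  rw [mem_ball, dist_zero_right]
  linarith [hw.2]

lemma isFiniteMeasure_restrict_complexAnnulus (hd : 0 < d) (hR : 0 < R) :
    IsFiniteMeasure (volume.restrict (complexAnnulus (R + d / 3) (R + 2 * d / 3))) :=
  ⟨by
    rw [Measure.restrict_apply_univ]
    exact (measure_mono (complexAnnulus_subset_ball hd hR)).trans_lt measure_ball_lt_top⟩

/-- The integrals entering the volume potential converge. -/
lemma integrableOn_volume_terms (hR : 0 < R) (hd : 0 < d) (hc : 0 < c) (hcd : c * d ≤ R)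
    (hh : Continuous h) (hM : ∀ w, ‖h w‖ ≤ M) {z : ℂ} (hz : z ∈ complexAnnulus R (R + d)) :
    IntegrableOn (fun w => h w * Real.log ‖z - w‖)
        (complexAnnulus (R + d / 3) (R + 2 * d / 3)) ∧
      IntegrableOn (fun w => h w * Real.log ‖z - invMap R w‖)
        (complexAnnulus (R + d / 3) (R + 2 * d / 3)) ∧
      IntegrableOn (fun w => h w * (-(1 / (2 * Real.pi)) * Real.log ‖w‖ +
        ‖w‖ ^ 2 / (4 * Real.pi * R ^ 2))) (complexAnnulus (R + d / 3) (R + 2 * d / 3)) ∧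
      IntegrableOn h (complexAnnulus (R + d / 3) (R + 2 * d / 3)) := by
  have hfin := isFiniteMeasure_restrict_complexAnnulus hd hR
  have hmem := ae_restrict_mem (μ := (volume : Measure ℂ))
    (isOpen_complexAnnulus (R + d / 3) (R + 2 * d / 3)).measurableSet
  have hzb : z ∈ ball (0 : ℂ) (2 * (R + d)) := by
    rw [mem_ball, dist_zero_right]
    linarith [hz.2]
  have hi : IntegrableOn h (complexAnnulus (R + d / 3) (R + 2 * d / 3)) :=
    Integrable.of_bound hh.aestronglyMeasurable M (.of_forall hM)
  refine ⟨(integrableOn_mul_log hh hM hzb).mono_set (complexAnnulus_subset_ball hd hR), ?_, ?_, hi⟩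
  · refine integrable_log_potential (M := M) (B := R) (δ := c / (3 * c + 1) * d)
      hh.aestronglyMeasurable (.of_forall hM) (measurable_invMap R).aemeasurable ?_ (by positivity)
      (hmem.mono fun w hw => sub_invMap_ge hR hd hc hcd hz.1 hw.1)
    filter_upwards [hmem] with w hw
    have hw0 : R < ‖w‖ := by linarith [hw.1]
    rw [norm_invMap (norm_pos_iff.1 (hR.trans hw0)), div_le_iff₀ (hR.trans hw0)]
    nlinarith
  · have h1 : IntegrableOn (fun w => h w * Real.log ‖(0 : ℂ) - w‖)
        (complexAnnulus (R + d / 3) (R + 2 * d / 3)) :=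
      (integrableOn_mul_log hh hM (z := 0) (mem_ball_self (by positivity))).mono_set
        (complexAnnulus_subset_ball hd hR)
    have h2 : IntegrableOn (fun w => h w * ‖w‖ ^ 2)
        (complexAnnulus (R + d / 3) (R + 2 * d / 3)) := by
      refine Integrable.of_bound (hh.mul (continuous_norm.pow 2)).aestronglyMeasurable
        (M * (R + 2 * d / 3) ^ 2) ?_
      filter_upwards [hmem] with w hw
      have := (norm_nonneg _).trans (hM w)
      rw [norm_mul, norm_pow, norm_norm]
      gcongr
      · exact hM w
      · exact hw.2.le
    refine ((h1.const_mul (-(1 / (2 * Real.pi)))).add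
      (h2.mul_const (1 / (4 * Real.pi * R ^ 2)))).congr (.of_forall fun w => ?_)
    simp only [Pi.add_apply, zero_sub, norm_neg]
    ring

/-- The complex gradient of the volume potential. -/
noncomputable def volumeGrad (R d : ℝ) (h : ℂ → ℝ) (z : ℂ) : ℂ :=
  ((-(1 / (2 * Real.pi)) : ℝ) : ℂ) * (newtonGrad (2 * (R + d)) h z +
    (∫ w in complexAnnulus (R + d / 3) (R + 2 * d / 3), (h w : ℂ) * (z - invMap R w)⁻¹) -
    ∫ w in complexAnnulus (R + d / 3) (R + 2 * d / 3), (h w : ℂ) * (z - 0)⁻¹)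

/-- The real derivative of the complex gradient of the volume potential. -/
noncomputable def volumeHess (R d : ℝ) (h : ℂ → ℝ) (z : ℂ) : ℂ →L[ℝ] ℂ :=
  (-(1 / (2 * Real.pi)) : ℝ) • (newtonHess (2 * (R + d)) h z +
    ContinuousLinearMap.mul ℝ ℂ (-∫ w in complexAnnulus (R + d / 3) (R + 2 * d / 3),
      (h w : ℂ) * ((z - invMap R w) ^ 2)⁻¹) -
    ContinuousLinearMap.mul ℝ ℂ (-∫ w in complexAnnulus (R + d / 3) (R + 2 * d / 3),
      (h w : ℂ) * ((z - 0) ^ 2)⁻¹))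

lemma volume_integrand_eq (hR : 0 < R) (hd : 0 < d) {x : Plane} (hx : R < ‖x‖) {w : ℂ}
    (hw : w ∈ complexAnnulus (R + d / 3) (R + 2 * d / 3)) :
    h w * greenN R x (planeToComplex.symm w) =
      -(1 / (2 * Real.pi)) * (h w * Real.log ‖planeToComplex x - w‖ +
        h w * Real.log ‖planeToComplex x - invMap R w‖) + h w * (1 / (2 * Real.pi) * Real.log ‖x‖) +
        h w * (-(1 / (2 * Real.pi)) * Real.log ‖w‖ + ‖w‖ ^ 2 / (4 * Real.pi * R ^ 2)) := by
  rw [greenN_eq hR hx (by linarith [hw.1])]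
  ring

lemma integrable_volume_integrand (hR : 0 < R) (hd : 0 < d) (hc : 0 < c) (hcd : c * d ≤ R)
    (hh : Continuous h) (hM : ∀ w, ‖h w‖ ≤ M)
    (h0 : ∀ w ∉ complexAnnulus (R + d / 3) (R + 2 * d / 3), h w = 0) {x : Plane}
    (hx : x ∈ annulus R (R + d)) :
    Integrable (fun w : ℂ => h w * greenN R x (planeToComplex.symm w)) := by
  have hz : planeToComplex x ∈ complexAnnulus R (R + d) := by
    rw [complexAnnulus, mem_ofPred_eq, planeToComplex.norm_map]
    exact hx
  obtain ⟨i1, i2, i3, i4⟩ := integrableOn_volume_terms hR hd hc hcd hh hM hz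
  have hm := (isOpen_complexAnnulus (R + d / 3) (R + 2 * d / 3)).measurableSet
  rw [← integrableOn_iff_integrable_of_support_subset
    (s := complexAnnulus (R + d / 3) (R + 2 * d / 3))]
  · have hsum : IntegrableOn (fun w => -(1 / (2 * Real.pi)) *
        (h w * Real.log ‖planeToComplex x - w‖ + h w * Real.log ‖planeToComplex x - invMap R w‖) +
        h w * (1 / (2 * Real.pi) * Real.log ‖x‖) +
        h w * (-(1 / (2 * Real.pi)) * Real.log ‖w‖ + ‖w‖ ^ 2 / (4 * Real.pi * R ^ 2)))
        (complexAnnulus (R + d / 3) (R + 2 * d / 3)) :=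
      (((i1.add i2).const_mul _).add (i4.mul_const _)).add i3
    exact hsum.congr_fun (fun w hw => (volume_integrand_eq hR hd hx.1 hw).symm) hm
  · intro w hw
    by_contra hcon
    exact hw (by simp [h0 w hcon])

/-- The singular term is integrated over a disc of radius 2(R + d), harmless because h vanishes off
the inner annulus; Ω then lies in the concentric disc of half the radius, where the Newtonian
estimates hold. -/
lemma volume_integral_eq (hR : 0 < R) (hd : 0 < d) (hc : 0 < c) (hcd : c * d ≤ R)
    (hh : Continuous h) (hM : ∀ w, ‖h w‖ ≤ M)
    (h0 : ∀ w ∉ complexAnnulus (R + d / 3) (R + 2 * d / 3), h w = 0) {x : Plane}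
    (hx : x ∈ annulus R (R + d)) :
    ∫ w : ℂ, h w * greenN R x (planeToComplex.symm w) =
      -(1 / (2 * Real.pi)) * ((∫ w in ball (0 : ℂ) (2 * (R + d)),
          h w * Real.log ‖planeToComplex x - w‖) +
        ∫ w in complexAnnulus (R + d / 3) (R + 2 * d / 3),
          h w * Real.log ‖planeToComplex x - invMap R w‖) +
      (∫ w in complexAnnulus (R + d / 3) (R + 2 * d / 3), h w) *
        (1 / (2 * Real.pi) * Real.log ‖planeToComplex x‖) +
      ∫ w in complexAnnulus (R + d / 3) (R + 2 * d / 3),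
        h w * (-(1 / (2 * Real.pi)) * Real.log ‖w‖ + ‖w‖ ^ 2 / (4 * Real.pi * R ^ 2)) := by
  have hz : planeToComplex x ∈ complexAnnulus R (R + d) := by
    rw [complexAnnulus, mem_ofPred_eq, planeToComplex.norm_map]
    exact hx
  obtain ⟨i1, i2, i3, i4⟩ := integrableOn_volume_terms hR hd hc hcd hh hM hz
  have hm := (isOpen_complexAnnulus (R + d / 3) (R + 2 * d / 3)).measurableSet
  have e1 : ∫ w in ball (0 : ℂ) (2 * (R + d)), h w * Real.log ‖planeToComplex x - w‖ =
      ∫ w in complexAnnulus (R + d / 3) (R + 2 * d / 3), h w * Real.log ‖planeToComplex x - w‖ :=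
    setIntegral_eq_of_subset_of_forall_sdiff_eq_zero
      (f := fun w => h w * Real.log ‖planeToComplex x - w‖) measurableSet_ball
      (complexAnnulus_subset_ball hd hR) fun w hw => by simp [h0 w hw.2]
  rw [← setIntegral_eq_integral_of_forall_compl_eq_zero
    (s := complexAnnulus (R + d / 3) (R + 2 * d / 3)) (fun w hw => by rw [h0 w hw, zero_mul]),
    setIntegral_congr_fun hm fun w hw => volume_integrand_eq hR hd hx.1 hw, e1,
    planeToComplex.norm_map]
  have i12 : IntegrableOn (fun w => -(1 / (2 * Real.pi)) *
      (h w * Real.log ‖planeToComplex x - w‖ + h w * Real.log ‖planeToComplex x - invMap R w‖))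
      (complexAnnulus (R + d / 3) (R + 2 * d / 3)) := (i1.add i2).const_mul _
  have i4' : IntegrableOn (fun w => h w * (1 / (2 * Real.pi) * Real.log ‖x‖))
      (complexAnnulus (R + d / 3) (R + 2 * d / 3)) := i4.mul_const _
  have i124 : IntegrableOn (fun w => -(1 / (2 * Real.pi)) *
      (h w * Real.log ‖planeToComplex x - w‖ + h w * Real.log ‖planeToComplex x - invMap R w‖) +
      h w * (1 / (2 * Real.pi) * Real.log ‖x‖))
      (complexAnnulus (R + d / 3) (R + 2 * d / 3)) := i12.add i4'
  rw [integral_add i124 i3, integral_add i12 i4', integral_const_mul, integral_add i1 i2,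
    integral_mul_const]

lemma hasFDerivAt_volume_integral (hR : 0 < R) (hd : 0 < d) (hc : 0 < c) (hcd : c * d ≤ R)
    (hh : Continuous h) (hM : ∀ w, ‖h w‖ ≤ M)
    (h0 : ∀ w ∉ complexAnnulus (R + d / 3) (R + 2 * d / 3), h w = 0) {x : Plane}
    (hx : x ∈ annulus R (R + d)) :
    HasFDerivAt (fun x => ∫ w : ℂ, h w * greenN R x (planeToComplex.symm w))
      (reMulPlane (volumeGrad R d h (planeToComplex x))) x := by
  have hfin := isFiniteMeasure_restrict_complexAnnulus hd hR
  have hmem := ae_restrict_mem (μ := (volume : Measure ℂ))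
    (isOpen_complexAnnulus (R + d / 3) (R + 2 * d / 3)).measurableSet
  have hzn : R < ‖planeToComplex x‖ := by
    rw [planeToComplex.norm_map]
    exact hx.1
  have hz : planeToComplex x ∈ ball (0 : ℂ) (2 * (R + d)) := by
    rw [mem_ball, dist_zero_right, planeToComplex.norm_map]
    linarith [hx.2]
  have h1 := hasFDerivAt_newton hh hM hz
  have h2 := hasFDerivAt_log_potential_of_le
    (μ := volume.restrict (complexAnnulus (R + d / 3) (R + 2 * d / 3))) (h := h) (p := invMap R)
    (z₀ := planeToComplex x) (M := M) (B := R) (δ := c / (3 * c + 1) * d)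
    hh.aestronglyMeasurable (.of_forall hM) (measurable_invMap R).aemeasurable
    (hmem.mono fun w hw => by
      have hw0 : R < ‖w‖ := by linarith [hw.1]
      rw [norm_invMap (norm_pos_iff.1 (hR.trans hw0)), div_le_iff₀ (hR.trans hw0)]
      nlinarith) (by positivity) (hmem.mono fun w hw => sub_invMap_ge hR hd hc hcd hzn hw.1)
  have h3 := ((hasFDerivAt_log_norm (norm_pos_iff.1 (hR.trans hzn))).const_mul
    (1 / (2 * Real.pi))).const_mul (∫ w in complexAnnulus (R + d / 3) (R + 2 * d / 3), h w)
  have h4 := (((h1.add h2).const_mul (-(1 / (2 * Real.pi)))).add h3).add_const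
    (∫ w in complexAnnulus (R + d / 3) (R + 2 * d / 3),
      h w * (-(1 / (2 * Real.pi)) * Real.log ‖w‖ + ‖w‖ ^ 2 / (4 * Real.pi * R ^ 2)))
  have h5 := h4.comp x (planeToComplex.toContinuousLinearEquiv : Plane →L[ℝ] ℂ).hasFDerivAt
  refine (h5.congr_of_eventuallyEq ?_).congr_fderiv ?_
  · filter_upwards [(isOpen_annulus R (R + d)).mem_nhds hx] with y hy
    exact volume_integral_eq hR hd hc hcd hh hM h0 hy
  · refine ContinuousLinearMap.ext fun v => ?_
    have hof : ∫ w in complexAnnulus (R + d / 3) (R + 2 * d / 3), (h w : ℂ) =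
        ((∫ w in complexAnnulus (R + d / 3) (R + 2 * d / 3), h w : ℝ) : ℂ) :=
      integral_complex_ofReal
    rw [volumeGrad, sub_zero, integral_mul_const, hof]
    set m := ∫ w in complexAnnulus (R + d / 3) (R + 2 * d / 3), h w
    set A := newtonGrad (2 * (R + d)) h (planeToComplex x)
    set B := ∫ w in complexAnnulus (R + d / 3) (R + 2 * d / 3),
      (h w : ℂ) * (planeToComplex x - invMap R w)⁻¹
    change -(1 / (2 * Real.pi)) * ((A * planeToComplex v).re + (B * planeToComplex v).re) +
      m * (1 / (2 * Real.pi) * ((planeToComplex x)⁻¹ * planeToComplex v).re) =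
      (((-(1 / (2 * Real.pi)) : ℝ) : ℂ) * (A + B - m * (planeToComplex x)⁻¹) *
        planeToComplex v).re
    rw [mul_assoc, Complex.re_ofReal_mul, sub_mul, add_mul, Complex.sub_re, Complex.add_re,
      mul_assoc (m : ℂ), Complex.re_ofReal_mul]
    ring

lemma hasFDerivAt_volumeGrad {α K : ℝ} (hα₀ : 0 < α) (hα₁ : α < 1) (hR : 0 < R) (hd : 0 < d)
    (hc : 0 < c) (hcd : c * d ≤ R) (hh : Continuous h) (hM : ∀ w, ‖h w‖ ≤ M) (hK0 : 0 ≤ K)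
    (hK : ∀ w z, ‖h w - h z‖ ≤ K * ‖w - z‖ ^ α) {z : ℂ} (hz : z ∈ complexAnnulus R (R + d)) :
    HasFDerivAt (volumeGrad R d h) (volumeHess R d h z) z := by
  have hfin := isFiniteMeasure_restrict_complexAnnulus hd hR
  have hmem := ae_restrict_mem (μ := (volume : Measure ℂ))
    (isOpen_complexAnnulus (R + d / 3) (R + 2 * d / 3)).measurableSet
  have hzb : z ∈ ball (0 : ℂ) (2 * (R + d)) := by
    rw [mem_ball, dist_zero_right]
    linarith [hz.2]
  have hhc : Continuous fun w => (h w : ℂ) := Complex.continuous_ofReal.comp hh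
  have hM' : ∀ w, ‖(h w : ℂ)‖ ≤ M := fun w => by rw [Complex.norm_real]; exact hM w
  have h1 := hasFDerivAt_newtonGrad hα₀ hα₁ hh hM hK0 hK hzb
  have h2 := hasFDerivAt_cauchy_potential_of_le
    (μ := volume.restrict (complexAnnulus (R + d / 3) (R + 2 * d / 3))) (h := fun w => (h w : ℂ))
    (p := invMap R) (z₀ := z) (M := M) (δ := c / (3 * c + 1) * d) hhc.aestronglyMeasurable
    (.of_forall hM') (measurable_invMap R).aemeasurable (by positivity)
    (hmem.mono fun w hw => sub_invMap_ge hR hd hc hcd hz.1 hw.1)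
  have h3 := hasFDerivAt_cauchy_potential_of_le
    (μ := volume.restrict (complexAnnulus (R + d / 3) (R + 2 * d / 3))) (h := fun w => (h w : ℂ))
    (p := fun _ => 0) (z₀ := z) (M := M) (δ := R) hhc.aestronglyMeasurable
    (.of_forall hM') aemeasurable_const hR
    (.of_forall fun w => by rw [sub_zero]; exact hz.1.le)
  have h4 := ((h1.add h2).sub h3).const_smul (-(1 / (2 * Real.pi)) : ℝ)
  refine h4.congr_of_eventuallyEq (.of_forall fun x => ?_)
  simp only [volumeGrad, Pi.smul_apply, Pi.sub_apply, Pi.add_apply, Complex.real_smul]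

end VolumePotential

/-! ### Bounds for the volume potential. -/

section VolumeBounds

variable {R d c M K α : ℝ} {h : ℂ → ℝ}

lemma norm_neg_inv_two_pi_le : ‖-(1 / (2 * Real.pi))‖ ≤ 1 := by
  have := Real.two_le_pi
  rw [norm_neg, Real.norm_of_nonneg (by positivity), div_le_one (by positivity)]
  linarith

lemma norm_volumeGrad_le {a b e : ℝ} {z : ℂ} (h1 : ‖newtonGrad (2 * (R + d)) h z‖ ≤ a)
    (h2 : ‖∫ w in complexAnnulus (R + d / 3) (R + 2 * d / 3), (h w : ℂ) * (z - invMap R w)⁻¹‖ ≤ b)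
    (h3 : ‖∫ w in complexAnnulus (R + d / 3) (R + 2 * d / 3), (h w : ℂ) * (z - 0)⁻¹‖ ≤ e) :
    ‖volumeGrad R d h z‖ ≤ a + b + e := by
  rw [volumeGrad, norm_mul, Complex.norm_real]
  exact (mul_le_of_le_one_left (norm_nonneg _) norm_neg_inv_two_pi_le).trans
    ((norm_sub_le _ _).trans (add_le_add ((norm_add_le _ _).trans (add_le_add h1 h2)) h3))

lemma norm_volumeGrad_sub_le {a b e : ℝ} {z z' : ℂ}
    (h1 : ‖newtonGrad (2 * (R + d)) h z - newtonGrad (2 * (R + d)) h z'‖ ≤ a)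
    (h2 : ‖(∫ w in complexAnnulus (R + d / 3) (R + 2 * d / 3), (h w : ℂ) * (z - invMap R w)⁻¹) -
      ∫ w in complexAnnulus (R + d / 3) (R + 2 * d / 3), (h w : ℂ) * (z' - invMap R w)⁻¹‖ ≤ b)
    (h3 : ‖(∫ w in complexAnnulus (R + d / 3) (R + 2 * d / 3), (h w : ℂ) * (z - 0)⁻¹) -
      ∫ w in complexAnnulus (R + d / 3) (R + 2 * d / 3), (h w : ℂ) * (z' - 0)⁻¹‖ ≤ e) :
    ‖volumeGrad R d h z - volumeGrad R d h z'‖ ≤ a + b + e := by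
  rw [volumeGrad, volumeGrad, ← mul_sub, norm_mul, Complex.norm_real, sub_sub_sub_comm,
    add_sub_add_comm]
  exact (mul_le_of_le_one_left (norm_nonneg _) norm_neg_inv_two_pi_le).trans
    ((norm_sub_le _ _).trans (add_le_add ((norm_add_le _ _).trans (add_le_add h1 h2)) h3))

lemma norm_volumeHess_le {a b e : ℝ} {z : ℂ} (h1 : ‖newtonHess (2 * (R + d)) h z‖ ≤ a)
    (h2 : ‖∫ w in complexAnnulus (R + d / 3) (R + 2 * d / 3),
      (h w : ℂ) * ((z - invMap R w) ^ 2)⁻¹‖ ≤ b)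
    (h3 : ‖∫ w in complexAnnulus (R + d / 3) (R + 2 * d / 3), (h w : ℂ) * ((z - 0) ^ 2)⁻¹‖ ≤ e) :
    ‖volumeHess R d h z‖ ≤ a + b + e := by
  rw [← norm_neg] at h2 h3
  rw [volumeHess, norm_smul]
  exact (mul_le_of_le_one_left (norm_nonneg _) norm_neg_inv_two_pi_le).trans
    ((norm_sub_le _ _).trans (add_le_add ((norm_add_le _ _).trans (add_le_add h1
      ((ContinuousLinearMap.opNorm_mul_apply_le ℝ ℂ _).trans h2)))
      ((ContinuousLinearMap.opNorm_mul_apply_le ℝ ℂ _).trans h3)))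

lemma norm_volumeHess_sub_le {a b e : ℝ} {z z' : ℂ}
    (h1 : ‖newtonHess (2 * (R + d)) h z - newtonHess (2 * (R + d)) h z'‖ ≤ a)
    (h2 : ‖(∫ w in complexAnnulus (R + d / 3) (R + 2 * d / 3),
        (h w : ℂ) * ((z - invMap R w) ^ 2)⁻¹) -
      ∫ w in complexAnnulus (R + d / 3) (R + 2 * d / 3),
        (h w : ℂ) * ((z' - invMap R w) ^ 2)⁻¹‖ ≤ b)
    (h3 : ‖(∫ w in complexAnnulus (R + d / 3) (R + 2 * d / 3), (h w : ℂ) * ((z - 0) ^ 2)⁻¹) -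
      ∫ w in complexAnnulus (R + d / 3) (R + 2 * d / 3), (h w : ℂ) * ((z' - 0) ^ 2)⁻¹‖ ≤ e) :
    ‖volumeHess R d h z - volumeHess R d h z'‖ ≤ a + b + e := by
  rw [← norm_neg, neg_sub'] at h2 h3
  have hsmul : ∀ (t : ℝ) (u v : ℂ →L[ℝ] ℂ), t • u - t • v = t • (u - v) := fun t u v =>
    ContinuousLinearMap.ext fun x => (smul_sub t (u x) (v x)).symm
  rw [volumeHess, volumeHess, hsmul, norm_smul, sub_sub_sub_comm, add_sub_add_comm, ← map_sub,
    ← map_sub]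
  exact (mul_le_of_le_one_left (norm_nonneg _) norm_neg_inv_two_pi_le).trans
    ((norm_sub_le _ _).trans (add_le_add ((norm_add_le _ _).trans (add_le_add h1
      ((ContinuousLinearMap.opNorm_mul_apply_le ℝ ℂ _).trans h2)))
      ((ContinuousLinearMap.opNorm_mul_apply_le ℝ ℂ _).trans h3)))

lemma volume_real_complexAnnulus_le (hR : 0 < R) (hd : 0 < d) (hc : 0 < c) (hcd : c * d ≤ R) :
    volume.real (complexAnnulus (R + d / 3) (R + 2 * d / 3)) ≤
      Real.pi * (1 + 1 / c) * (R * d) := by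
  have hπ := Real.pi_pos
  rw [volume_real_complexAnnulus (by positivity) (by linarith)]
  -- The area is π(2Rd/3 + d²/3), and d ≤ R/c absorbs the square.
  have h1 : d ≤ R / c := by rwa [le_div_iff₀' hc]
  have h2 : R * (d / 3 + d / 3) + d * d / 3 ≤ (1 + 1 / c) * (R * d) := by
    have h3 : d * d ≤ R / c * d := by gcongr
    have h4 : (1 + 1 / c) * (R * d) = R * d + R / c * d := by ring
    rw [h4]
    nlinarith [mul_pos hR hd]
  calc _ = Real.pi * (R * (d / 3 + d / 3) + d * d / 3) := by ring
    _ ≤ Real.pi * ((1 + 1 / c) * (R * d)) := by gcongr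
    _ = _ := by ring

/-- Estimates for the complex gradient of the volume potential and its derivative. -/
theorem exists_volume_bound (hα₀ : 0 < α) (hα₁ : α < 1) (hc : 0 < c) :
    ∃ C : ℝ, 0 < C ∧ ∀ (R d M K : ℝ) (h : ℂ → ℝ), 0 < d → c * d ≤ R → Continuous h →
      (∀ w, ‖h w‖ ≤ M) → 0 ≤ K → (∀ w z, ‖h w - h z‖ ≤ K * ‖w - z‖ ^ α) →
      (∀ z ∈ complexAnnulus R (R + d), ‖volumeGrad R d h z‖ ≤ C * (R * M)) ∧
      (∀ z ∈ complexAnnulus R (R + d), ∀ w ∈ complexAnnulus R (R + d),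
        ‖volumeGrad R d h z - volumeGrad R d h w‖ ≤
          C * (R ^ (2 - α) * d⁻¹ * M) * ‖z - w‖ ^ α) ∧
      (∀ z ∈ complexAnnulus R (R + d),
        ‖volumeHess R d h z‖ ≤ C * (R * d⁻¹ * M + R ^ α * K)) ∧
      ∀ z ∈ complexAnnulus R (R + d), ∀ w ∈ complexAnnulus R (R + d),
        ‖volumeHess R d h z - volumeHess R d h w‖ ≤
          C * (R ^ (2 - α) * (d ^ 2)⁻¹ * M + K) * ‖z - w‖ ^ α := by
  obtain ⟨C₀, hC₀, hN⟩ := exists_newton_bound hα₀ hα₁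
  have hπ := Real.pi_pos
  set v := Real.pi * (1 + 1 / c) with hv
  -- κ d separates Ω from the reflected poles, and b is such that 2(R + d) ≤ b R.
  set κ := c / (3 * c + 1) with hκ
  set b := 2 * (1 + 1 / c) with hb
  have hv0 : 0 < v := by positivity
  have hκ0 : 0 < κ := by positivity
  have hb1 : 1 ≤ b := by
    have : 0 < 1 / c := by positivity
    linarith
  have hb0 : 0 < b := by linarith
  obtain ⟨D, hD⟩ : ∃ D, D = C₀ + C₀ / c + 2 * v / κ + 2 * v / κ ^ 2 + 4 * v / κ ^ 3 := ⟨_, rfl⟩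
  refine ⟨D * b, by rw [hD]; positivity, ?_⟩
  intro R d M K h hd hcd hh hM hK0 hK
  have hR : 0 < R := (mul_pos hc hd).trans_le hcd
  have hM0 : 0 ≤ M := (norm_nonneg _).trans (hM 0)
  obtain ⟨n0, n1, n2, n3⟩ := hN (2 * (R + d)) M K h hh hM hK0 hK
  have hfin := isFiniteMeasure_restrict_complexAnnulus hd hR
  have hmem := ae_restrict_mem (μ := (volume : Measure ℂ))
    (isOpen_complexAnnulus (R + d / 3) (R + 2 * d / 3)).measurableSet
  have hVle := volume_real_complexAnnulus_le hR hd hc hcd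
  rw [← hv, ← measureReal_restrict_apply_univ] at hVle
  set μ := (volume : Measure ℂ).restrict (complexAnnulus (R + d / 3) (R + 2 * d / 3)) with hμ
  set V := μ.real univ with hV
  have hV0 : 0 ≤ V := measureReal_nonneg
  set ρ := 2 * (R + d) with hρ
  have hρ0 : 0 < ρ := by positivity
  have hρb : ρ ≤ b * R := by
    have h1 : d ≤ R / c := by rwa [le_div_iff₀' hc]
    calc ρ ≤ 2 * (R + R / c) := by rw [hρ]; gcongr
      _ = _ := by rw [hb]; ring
  have hpow : ∀ s : ℝ, 0 ≤ s → s ≤ 1 → ρ ^ s ≤ b * R ^ s := by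
    intro s hs0 hs1
    calc ρ ^ s ≤ (b * R) ^ s := by gcongr
      _ = b ^ s * R ^ s := Real.mul_rpow hb0.le hR.le
      _ ≤ b ^ (1 : ℝ) * R ^ s := by gcongr
      _ = _ := by rw [Real.rpow_one]
  have hR2 : R ^ (2 - α) = R ^ (1 - α) * R := by
    rw [show 2 - α = 1 - α + 1 by ring, Real.rpow_add_one hR.ne']
  have hball : ∀ z ∈ complexAnnulus R (R + d), z ∈ ball (0 : ℂ) (ρ / 2) := by
    intro z hz
    rw [mem_ball, dist_zero_right]
    linarith [hz.2]
  -- Turns the Lipschitz bounds for the nonsingular terms into Hölder bounds, the diameter of Ω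
  -- being O(R).
  have hr : ∀ z ∈ complexAnnulus R (R + d), ∀ w ∈ complexAnnulus R (R + d),
      ‖z - w‖ ≤ b * R ^ (1 - α) * ‖z - w‖ ^ α := by
    intro z hz w hw
    have h1 : ‖z - w‖ ≤ ρ := (norm_sub_le _ _).trans (by linarith [hz.2, hw.2])
    calc ‖z - w‖ = ‖z - w‖ ^ (1 - α) * ‖z - w‖ ^ α := by
          rw [← Real.rpow_add' (norm_nonneg _) (by simp), sub_add_cancel, Real.rpow_one]
      _ ≤ ρ ^ (1 - α) * ‖z - w‖ ^ α := by
          have : 0 ≤ 1 - α := by linarith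
          gcongr
      _ ≤ _ := by
          gcongr
          exact hpow _ (by linarith) (by linarith)
  have hδ : 0 < κ * d := by positivity
  have hhc : Continuous fun w => (h w : ℂ) := Complex.continuous_ofReal.comp hh
  have hhm : AEStronglyMeasurable (fun w => (h w : ℂ)) μ := hhc.aestronglyMeasurable
  have hM' : ∀ᵐ w ∂μ, ‖(h w : ℂ)‖ ≤ M := .of_forall fun w => by
    rw [Complex.norm_real]
    exact hM w
  have hp : AEMeasurable (invMap R) μ := (measurable_invMap R).aemeasurable
  have hp0 : AEMeasurable (fun _ : ℂ => (0 : ℂ)) μ := aemeasurable_const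
  have hz1 : ∀ z ∈ complexAnnulus R (R + d), ∀ᵐ w ∂μ, κ * d ≤ ‖z - invMap R w‖ := fun z hz =>
    hmem.mono fun w hw => sub_invMap_ge hR hd hc hcd hz.1 hw.1
  have hz2 : ∀ z ∈ complexAnnulus R (R + d), ∀ᵐ w ∂μ, κ * d ≤ ‖z - 0‖ := fun z hz =>
    .of_forall fun w => by
      rw [sub_zero]
      exact (delta_le hd hc hcd).trans hz.1.le
  -- Multiplying by this factor brings the Newtonian terms, which carry no negative power of d, to
  -- the form of the other two.
  have hone : 1 ≤ R * d⁻¹ / c := by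
    rw [one_le_div hc, ← div_eq_mul_inv, le_div_iff₀ hd]
    exact hcd
  have q1 : 0 ≤ C₀ / c := by positivity
  have q2 : 0 ≤ 2 * v / κ := by positivity
  have q3 : 0 ≤ 2 * v / κ ^ 2 := by positivity
  have q4 : 0 ≤ 4 * v / κ ^ 3 := by positivity
  have d1 : C₀ + 2 * v / κ ≤ D := by linarith
  have d2 : C₀ / c + 2 * v / κ ^ 2 ≤ D := by linarith
  have d3 : C₀ ≤ D := by linarith
  have d4 : 4 * v / κ ^ 3 ≤ D := by linarith
  have hD0 : 0 ≤ D := by linarith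
  -- Kernel bound times area: (κ d)^(-n) times O(R d), for n = 1, 2, 3.
  have v1 : (κ * d)⁻¹ * V ≤ v / κ * R := by
    calc (κ * d)⁻¹ * V ≤ (κ * d)⁻¹ * (v * (R * d)) := by gcongr
      _ = _ := by field_simp
  have v2 : ((κ * d) ^ 2)⁻¹ * V ≤ v / κ ^ 2 * (R * d⁻¹) := by
    calc ((κ * d) ^ 2)⁻¹ * V ≤ ((κ * d) ^ 2)⁻¹ * (v * (R * d)) := by gcongr
      _ = _ := by field_simp
  have v3 : ((κ * d) ^ 3)⁻¹ * V ≤ v / κ ^ 3 * (R * (d ^ 2)⁻¹) := by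
    calc ((κ * d) ^ 3)⁻¹ * V ≤ ((κ * d) ^ 3)⁻¹ * (v * (R * d)) := by gcongr
      _ = _ := by field_simp
  refine ⟨fun z hz => ?_, fun z hz w hw => ?_, fun z hz => ?_, fun z hz w hw => ?_⟩
  · have e1 := norm_cauchy_potential_le (h := fun w => (h w : ℂ)) hM' hδ (hz1 z hz) 1
    have e2 := norm_cauchy_potential_le (h := fun w => (h w : ℂ)) hM' hδ (hz2 z hz) 1
    simp only [pow_one] at e1 e2
    refine (norm_volumeGrad_le (n0 z (hball z hz)) e1 e2).trans ?_
    calc C₀ * (ρ * M) + M * (κ * d)⁻¹ * V + M * (κ * d)⁻¹ * V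
        = C₀ * (ρ * M) + 2 * (M * ((κ * d)⁻¹ * V)) := by ring
      _ ≤ C₀ * (b * R * M) + 2 * (M * (v / κ * R)) := by gcongr
      _ = (C₀ * b + 2 * v / κ * 1) * (R * M) := by ring
      _ ≤ (C₀ * b + 2 * v / κ * b) * (R * M) := by gcongr
      _ = (C₀ + 2 * v / κ) * b * (R * M) := by ring
      _ ≤ _ := by
        gcongr
  · have e1 := norm_cauchy_potential_sub_le (h := fun w => (h w : ℂ)) hhm hM' hp hδ (hz1 z hz)
      (hz1 w hw)
    have e2 := norm_cauchy_potential_sub_le (h := fun w => (h w : ℂ)) hhm hM' hp0 hδ (hz2 z hz)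
      (hz2 w hw)
    refine (norm_volumeGrad_sub_le (n1 z (hball z hz) w (hball w hw)) e1 e2).trans ?_
    have hr' := hr z hz w hw
    set r := ‖z - w‖
    have hr0 : 0 ≤ r := norm_nonneg _
    calc C₀ * (ρ ^ (1 - α) * M) * r ^ α + M * (r * ((κ * d) ^ 2)⁻¹) * V +
          M * (r * ((κ * d) ^ 2)⁻¹) * V
        = 1 * (C₀ * (ρ ^ (1 - α) * M) * r ^ α) + 2 * M * r * (((κ * d) ^ 2)⁻¹ * V) := by ring
      _ ≤ R * d⁻¹ / c * (C₀ * (b * R ^ (1 - α) * M) * r ^ α) +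
          2 * M * (b * R ^ (1 - α) * r ^ α) * (v / κ ^ 2 * (R * d⁻¹)) := by
        gcongr
        exact hpow _ (by linarith) (by linarith)
      _ = (C₀ / c + 2 * v / κ ^ 2) * b * (R ^ (1 - α) * R * d⁻¹ * M) * r ^ α := by ring
      _ ≤ _ := by
        rw [hR2]
        gcongr
  · have e1 := norm_cauchy_potential_le (h := fun w => (h w : ℂ)) hM' hδ (hz1 z hz) 2
    have e2 := norm_cauchy_potential_le (h := fun w => (h w : ℂ)) hM' hδ (hz2 z hz) 2
    refine (norm_volumeHess_le (n2 z (hball z hz)) e1 e2).trans ?_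
    calc C₀ * (M + ρ ^ α * K) + M * ((κ * d) ^ 2)⁻¹ * V + M * ((κ * d) ^ 2)⁻¹ * V
        = C₀ * (1 * M + ρ ^ α * K) + 2 * M * (((κ * d) ^ 2)⁻¹ * V) := by ring
      _ ≤ C₀ * (R * d⁻¹ / c * M + b * R ^ α * K) + 2 * M * (v / κ ^ 2 * (R * d⁻¹)) := by
        gcongr
        exact hpow _ hα₀.le hα₁.le
      _ = (C₀ / c + 2 * v / κ ^ 2) * 1 * (R * d⁻¹ * M) + C₀ * b * (R ^ α * K) := by ring
      _ ≤ D * b * (R * d⁻¹ * M) +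
          D * b * (R ^ α * K) := by gcongr
      _ = _ := by ring
  · have e1 := norm_cauchy_potential_sq_sub_le (h := fun w => (h w : ℂ)) hhm hM' hp hδ (hz1 z hz)
      (hz1 w hw)
    have e2 := norm_cauchy_potential_sq_sub_le (h := fun w => (h w : ℂ)) hhm hM' hp0 hδ (hz2 z hz)
      (hz2 w hw)
    refine (norm_volumeHess_sub_le (n3 z (hball z hz) w (hball w hw)) e1 e2).trans ?_
    have hr' := hr z hz w hw
    set r := ‖z - w‖
    have hr0 : 0 ≤ r := norm_nonneg _
    calc C₀ * K * r ^ α + M * (2 * r * ((κ * d) ^ 3)⁻¹) * V + M * (2 * r * ((κ * d) ^ 3)⁻¹) * V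
        = C₀ * K * r ^ α + 4 * M * r * (((κ * d) ^ 3)⁻¹ * V) := by ring
      _ ≤ C₀ * K * r ^ α + 4 * M * (b * R ^ (1 - α) * r ^ α) * (v / κ ^ 3 * (R * (d ^ 2)⁻¹)) := by
        gcongr
      _ = (4 * v / κ ^ 3 * b * (R ^ (1 - α) * R * (d ^ 2)⁻¹ * M) + C₀ * 1 * K) * r ^ α := by ring
      _ ≤ (D * b *
            (R ^ (1 - α) * R * (d ^ 2)⁻¹ * M) +
          D * b * K) * r ^ α := by gcongr
      _ = _ := by rw [hR2]; ring

end VolumeBounds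

/-! ### Transfer to the plane and conclusion. -/

lemma norm_planeToComplex_symm_sub (w z : ℂ) :
    ‖planeToComplex.symm w - planeToComplex.symm z‖ = ‖w - z‖ := by
  rw [← map_sub, planeToComplex.symm.norm_map]

lemma continuous_of_isHolder {α : ℝ≥0} (hα : 0 < α) {f : Plane → ℝ}
    (hf : holderOn α univ f ≠ ∞) : Continuous f := by
  have h1 : Continuous ((univ : Set Plane).domRestrict f) :=
    (eHolderNorm_ne_top.1 hf).holderWith.continuous hα
  exact h1.comp (continuous_id.subtype_mk fun x => mem_univ x)

/-- Estimates for the volume potential. -/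
theorem exists_volumePotential_estimates (α : ℝ≥0) (hα0 : 0 < α) (hα1 : α < 1) {c : ℝ}
    (hc : 0 < c) :
    ∃ C : ℝ, 0 < C ∧ ∀ R d : ℝ, 0 < d → c * d ≤ R → ∀ f : Plane → ℝ,
      IsHolderCompactlySupportedIn α (annulus (R + d / 3) (R + 2 * d / 3)) f →
      (∀ x ∈ annulus R (R + d), Integrable (fun y => f y * greenN R x y)) ∧
      ContDiffOn ℝ 2 (volumePotential R f) (annulus R (R + d)) ∧
      supOn (annulus R (R + d)) (grad (volumePotential R f)) ≤
        ENNReal.ofReal C * (ENNReal.ofReal R * supOn univ f) ∧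
      holderOn α (annulus R (R + d)) (grad (volumePotential R f)) ≤
        ENNReal.ofReal C * (ENNReal.ofReal (R ^ (2 - (α : ℝ)) * d⁻¹) * supOn univ f) ∧
      supOn (annulus R (R + d)) (hess (volumePotential R f)) ≤
        ENNReal.ofReal C * (ENNReal.ofReal (R * d⁻¹) * supOn univ f
          + ENNReal.ofReal (R ^ (α : ℝ)) * holderOn α univ f) ∧
      holderOn α (annulus R (R + d)) (hess (volumePotential R f)) ≤
        ENNReal.ofReal C * (ENNReal.ofReal (R ^ (2 - (α : ℝ)) * (d ^ 2)⁻¹) * supOn univ f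
          + holderOn α univ f) := by
  obtain ⟨C, hC, hCb⟩ := exists_volume_bound (α := α) hα0 hα1 hc
  refine ⟨C, hC, fun R d hd hcd f hf => ?_⟩
  have hR : 0 < R := (mul_pos hc hd).trans_le hcd
  have hfc := continuous_of_isHolder hα0 hf.2.2
  -- The sup of f is finite by compactness of the support.
  have hMt : supOn univ f ≠ ∞ := by
    obtain ⟨B, hB⟩ := hf.1.exists_bound_of_continuous hfc
    exact ne_top_of_le_ne_top ENNReal.ofReal_ne_top (supOn_le (A := B) fun y _ => hB y)
  have hKt := hf.2.2
  obtain ⟨M, hM⟩ : ∃ M, M = (supOn univ f).toReal := ⟨_, rfl⟩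
  obtain ⟨K, hK⟩ : ∃ K, K = (holderOn α univ f).toReal := ⟨_, rfl⟩
  have hM0 : 0 ≤ M := hM ▸ ENNReal.toReal_nonneg
  have hK0 : 0 ≤ K := hK ▸ ENNReal.toReal_nonneg
  rw [← ENNReal.ofReal_toReal hMt, ← ENNReal.ofReal_toReal hKt, ← hM, ← hK]
  set h : ℂ → ℝ := fun w => f (planeToComplex.symm w) with hh
  have hhc : Continuous h := hfc.comp planeToComplex.symm.continuous
  have bM : ∀ w, ‖h w‖ ≤ M := fun w => hM ▸ norm_le_toReal_supOn hMt (mem_univ _)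
  have bK : ∀ w z, ‖h w - h z‖ ≤ K * ‖w - z‖ ^ (α : ℝ) := fun w z => by
    rw [hK, ← norm_planeToComplex_symm_sub]
    exact norm_sub_le_toReal_holderOn hKt (mem_univ _) (mem_univ _)
  have h0 : ∀ w ∉ complexAnnulus (R + d / 3) (R + 2 * d / 3), h w = 0 := fun w hw => by
    refine image_eq_zero_of_notMem_tsupport (f := f) fun hcon => hw ?_
    have := hf.2.1 hcon
    rwa [annulus, mem_ofPred_eq, planeToComplex.symm.norm_map] at this
  have hpres := planeToComplex.symm.measurePreserving
  have hemb := planeToComplex.symm.toHomeomorph.measurableEmbedding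
  have hann : ∀ x ∈ annulus R (R + d), planeToComplex x ∈ complexAnnulus R (R + d) :=
    fun x hx => by
      rw [complexAnnulus, mem_ofPred_eq, planeToComplex.norm_map]
      exact hx
  have hpot : volumePotential R f =
      fun x => ∫ w : ℂ, h w * greenN R x (planeToComplex.symm w) := by
    ext x
    exact (hpres.integral_comp hemb fun y => f y * greenN R x y).symm
  refine ⟨fun x hx => (hpres.integrable_comp_emb hemb).1
    (integrable_volume_integrand hR hd hc hcd hhc bM h0 hx), ?_⟩
  obtain ⟨b0, b1, b2, b3⟩ := hCb R d M K h hd hcd hhc bM hK0 bK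
  obtain ⟨r0, r1, r2, r3, r4⟩ := estimates_of_complex_gradient (isOpen_annulus R (R + d)) hα0
    (u := volumePotential R f) (F := volumeGrad R d h) (G := volumeHess R d h)
    (A₀ := C * (R * M)) (A₁ := C * (R ^ (2 - (α : ℝ)) * d⁻¹ * M))
    (A₂ := C * (R * d⁻¹ * M + R ^ (α : ℝ) * K))
    (A₃ := C * (R ^ (2 - (α : ℝ)) * (d ^ 2)⁻¹ * M + K))
    (fun x hx => by
      rw [hpot]
      exact hasFDerivAt_volume_integral hR hd hc hcd hhc bM h0 hx)
    (fun x hx => hasFDerivAt_volumeGrad hα0 hα1 hR hd hc hcd hhc bM hK0 bK (hann x hx))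
    (by positivity) (by positivity) (fun x hx => b0 _ (hann x hx))
    (fun x hx y hy => by
      rw [← norm_planeToComplex_sub]
      exact b1 _ (hann x hx) _ (hann y hy))
    (fun x hx => b2 _ (hann x hx))
    (fun x hx y hy => by
      rw [← norm_planeToComplex_sub]
      exact b3 _ (hann x hx) _ (hann y hy))
  refine ⟨r0, r1.trans_eq ?_, r2.trans_eq ?_, r3.trans_eq ?_, r4.trans_eq ?_⟩
  · rw [← ENNReal.ofReal_mul (by positivity), ← ENNReal.ofReal_mul (by positivity)]
  · rw [← ENNReal.ofReal_mul (by positivity), ← ENNReal.ofReal_mul (by positivity)]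
  · rw [← ENNReal.ofReal_mul (by positivity), ← ENNReal.ofReal_mul (by positivity),
      ← ENNReal.ofReal_add (by positivity) (by positivity), ← ENNReal.ofReal_mul (by positivity)]
  · rw [← ENNReal.ofReal_mul (by positivity), ← ENNReal.ofReal_add (by positivity) (by positivity),
      ← ENNReal.ofReal_mul (by positivity)]
theorem mainTheorem8 (α : ℝ≥0) (hα0 : 0 < α) (hα1 : α < 1) (c : ℝ) (hc : 0 < c) :
    ∃ C : ℝ, 0 < C ∧ ∀ R d : ℝ, 0 < d → c * d ≤ R →
      -- the single-layer potential
      (∀ g : Plane → ℝ, IsC1HolderOnCircle α R g →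
        (∀ x ∈ annulus R (R + d), IntervalIntegrable
          (fun θ => g (circlePoint R θ) * greenN R x (circlePoint R θ) * R)
          volume 0 (2 * Real.pi)) ∧
        ContDiffOn ℝ 2 (singleLayer R g) (annulus R (R + d)) ∧
        supOn (annulus R (R + d)) (grad (singleLayer R g)) ≤
          ENNReal.ofReal C * (supOn (sphere 0 R) g
            + ENNReal.ofReal (R ^ (α : ℝ)) * holderOn α (sphere 0 R) g) ∧
        holderOn α (annulus R (R + d)) (grad (singleLayer R g)) ≤
          ENNReal.ofReal C * (ENNReal.ofReal (R ^ (-(α : ℝ))) * supOn (sphere 0 R) g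
            + holderOn α (sphere 0 R) g) ∧
        supOn (annulus R (R + d)) (hess (singleLayer R g)) ≤
          ENNReal.ofReal C * (ENNReal.ofReal R⁻¹ * supOn (sphere 0 R) g
            + ENNReal.ofReal (R ^ ((α : ℝ) - 1)) * holderOn α (sphere 0 R) g
            + supOn (sphere 0 R) (tangentialDeriv R g)
            + ENNReal.ofReal (R ^ (α : ℝ)) * holderOn α (sphere 0 R) (tangentialDeriv R g)) ∧
        holderOn α (annulus R (R + d)) (hess (singleLayer R g)) ≤
          ENNReal.ofReal C * (ENNReal.ofReal (R ^ (-1 - (α : ℝ))) * supOn (sphere 0 R) g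
            + ENNReal.ofReal R⁻¹ * holderOn α (sphere 0 R) g
            + ENNReal.ofReal (R ^ (-(α : ℝ))) * supOn (sphere 0 R) (tangentialDeriv R g)
            + holderOn α (sphere 0 R) (tangentialDeriv R g))) ∧
      -- the volume potential
      (∀ f : Plane → ℝ,
        IsHolderCompactlySupportedIn α (annulus (R + d / 3) (R + 2 * d / 3)) f →
        (∀ x ∈ annulus R (R + d), Integrable (fun y => f y * greenN R x y)) ∧
        ContDiffOn ℝ 2 (volumePotential R f) (annulus R (R + d)) ∧
        supOn (annulus R (R + d)) (grad (volumePotential R f)) ≤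
          ENNReal.ofReal C * (ENNReal.ofReal R * supOn univ f) ∧
        holderOn α (annulus R (R + d)) (grad (volumePotential R f)) ≤
          ENNReal.ofReal C * (ENNReal.ofReal (R ^ (2 - (α : ℝ)) * d⁻¹) * supOn univ f) ∧
        supOn (annulus R (R + d)) (hess (volumePotential R f)) ≤
          ENNReal.ofReal C * (ENNReal.ofReal (R * d⁻¹) * supOn univ f
            + ENNReal.ofReal (R ^ (α : ℝ)) * holderOn α univ f) ∧
        holderOn α (annulus R (R + d)) (hess (volumePotential R f)) ≤
          ENNReal.ofReal C * (ENNReal.ofReal (R ^ (2 - (α : ℝ)) * (d ^ 2)⁻¹) * supOn univ f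
            + holderOn α univ f)) := by
  obtain ⟨C₁, hC₁, h₁⟩ := exists_singleLayer_estimates α hα0 hα1
  obtain ⟨C₂, hC₂, h₂⟩ := exists_volumePotential_estimates α hα0 hα1 hc
  have hle₁ : ENNReal.ofReal C₁ ≤ ENNReal.ofReal (max C₁ C₂) :=
    ENNReal.ofReal_le_ofReal (le_max_left _ _)
  have hle₂ : ENNReal.ofReal C₂ ≤ ENNReal.ofReal (max C₁ C₂) :=
    ENNReal.ofReal_le_ofReal (le_max_right _ _)
  refine ⟨max C₁ C₂, lt_max_of_lt_left hC₁, fun R d hd hcd => ⟨fun g hg => ?_, fun f hf => ?_⟩⟩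
  · have hR : 0 < R := (mul_pos hc hd).trans_le hcd
    obtain ⟨r0, r1, r2, r3, r4⟩ := h₁ R (R + d) hR g hg
    exact ⟨fun x hx => intervalIntegrable_singleLayer hR (continuous_comp_circlePoint hR hg) hx.1,
      r0, r1.trans (mul_le_mul_left hle₁ _), r2.trans (mul_le_mul_left hle₁ _),
      r3.trans (mul_le_mul_left hle₁ _), r4.trans (mul_le_mul_left hle₁ _)⟩
  · obtain ⟨hi, r0, r1, r2, r3, r4⟩ := h₂ R d hd hcd f hf
    exact ⟨hi, r0, r1.trans (mul_le_mul_left hle₂ _), r2.trans (mul_le_mul_left hle₂ _),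
      r3.trans (mul_le_mul_left hle₂ _), r4.trans (mul_le_mul_left hle₂ _)⟩
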